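/- **Theorem (inversion of Riesz potentials on matrix space).** Let $2\le m\le n$, and let $\mathfrak M_{n,m}$ be the space of real $n\times m$ matrices with Lebesgue measure, $x'$ the transpose of $x$, and $|x|_m=\det(x'x)^{1/2}$. Let $\mathcal P_m$ be the cone of positive definite symmetric $m\times m$ matrices, $|a|=\det a$ for $a\in\mathcal P_m$, $dr=\prod_{i\le j}dr_{ij}$, $d_*a=|a|^{-(m+1)/2}da$ on $\mathcal P_m$; $\int_{\varepsilon I}^{\rho I}$ denotes integration over $\{a:\ a-\varepsilon I\in\mathcal P_m,\ \rho I-a\in\mathcal P_m\}$, and $z'z<B$ means $B-z'z\in\mathcal P_m$. Let $\Gamma_m(\alpha)=\int_{\mathcal P_m}e^{-\operatorname{tr} r}|r|^{\alpha-(m+1)/2}\,dr$, $\sigma_{n,m}=2^m\pi^{nm/2}/\Gamma_m(n/2)$, and $(\mathcal Ff)(y)=\int_{\mathfrak M_{n,m}}e^{i\operatorname{tr}(y'x)}f(x)\,dx$. Let $\mathbf W_{n,m}=\{0,1,\dots,\min(m-1,n-m)\}\cup\{\alpha\in\mathbb C:\ \operatorname{Re}\alpha>m-1,\ \alpha\ne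 n-m+1,n-m+2,\dots\}$. For $\alpha\in\mathbf W_{n,m}$ define the Riesz potential $$(I^\alpha f)(x)=\frac1{\gamma_{n,m}(\alpha)}\int_{\mathfrak M_{n,m}}f(x-y)\,|y|_m^{\alpha-n}\,dy,\qquad \gamma_{n,m}(\alpha)=\frac{2^{\alpha m}\pi^{nm/2}\Gamma_m(\alpha/2)}{\Gamma_m((n-\alpha)/2)},$$ if $\operatorname{Re}\alpha>m-1$, and, if $\alpha=k\in\{0,1,\dots,\min(m-1,n-m)\}$, $$(I^kf)(x)=c_k\int_{\mathfrak M_{k,m}}dy\int_{O(n)}f\Big(x-\gamma\begin{bmatrix}y\\0\end{bmatrix}\Big)d\gamma,\qquad c_k=2^{-km}\pi^{-km/2}\,\frac{\Gamma_m((n-k)/2)}{\Gamma_m(n/2)},$$ where $d\gamma$ is the invariant probability measure on $O(n)$ (so $I^0f=f$). For $w$ on $\mathfrak M_{n,m}$ and $a\in\mathcal P_m$ let $(\mathcal W_af)(x)=\int_{\mathfrak M_{n,m}}f(x-ya^{1/2})\,w(y)\,dy$. Let $\alpha\in\mathbf W_{n,m}$ and let $f\in L^2\cap L^p$ on $\mathfrak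 M_{n,m}$ for some $p$ with $1\le p<n/(\operatorname{Re}\alpha+m-1)$. Let $w$ be a radial Schwartz function on $\mathfrak M_{n,m}$ (that is, $w(y)$ depends only on $y'y$) such that (a) $(\mathcal Fw)(y)=u_0(y'y)$ for all $y$ with $y'y\in\mathcal P_m$, where $u_0$ is a function on $\mathcal P_m$ which is symmetric, i.e. $u_0(s^{1/2}rs^{1/2})=u_0(r^{1/2}sr^{1/2})$ for all $r,s\in\mathcal P_m$, and which vanishes identically in a neighbourhood of the boundary $\partial\mathcal P_m$ (the set of singular positive semidefinite matrices); (b) the integral $$d_w(\alpha)=\frac{2^m}{\sigma_{n,m}}\int_{\mathfrak M_{n,m}}\frac{(\mathcal Fw)(z)}{|z|_m^{n+\alpha}}\,dz$$ is finite (absolutely convergent). Then $$d_w(\alpha)=\lim_{B\to\infty,\ B\in\mathcal P_m}\frac{2^m}{\sigma_{n,m}}\int_{z'z<B}\frac{(\mathcal Fw)(z)}{|z|_m^{n+\alpha}}\,dz ;$$ the integral defining $(I^\alpha f)(x)$ converges absolutely for almost all $x$; for all $0<\varepsilon<\rho<\infty$ the (iterated) integral $$T_{\varepsilon,\rho}(x)=\int_{\varepsilon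 I}^{\rho I}\frac{(\mathcal W_aI^\alpha f)(x)}{|a|^{\alpha/2}}\,d_*a$$ converges absolutely for almost all $x$ and $T_{\varepsilon,\rho}\in L^2(\mathfrak M_{n,m})$; and $$d_w(\alpha)\,f=\lim_{\varepsilon\to0,\ \rho\to\infty}\int_{\varepsilon I}^{\rho I}\frac{\mathcal W_aI^\alpha f}{|a|^{\alpha/2}}\,d_*a\qquad\text{in }L^2(\mathfrak M_{n,m}).$$ -/

import Mathlib

open MeasureTheory Filter Topology
open scoped ENNReal MatrixOrder

namespace MatrixWavelet

noncomputable section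

/-! ### Matrix spaces -/

/-- The space of real `n × m` matrices, identified with the Euclidean space `ℝ^{nm}`; `volume` is
Lebesgue measure `∏ dx_{ij}`. -/
abbrev MatSpace (n m : ℕ) := EuclideanSpace ℝ (Fin n × Fin m)

/-- A point of `MatSpace n m` read as a matrix. -/
def toMat {n m : ℕ} (x : MatSpace n m) : Matrix (Fin n) (Fin m) ℝ :=
  Matrix.of fun i j => x (i, j)

/-- A matrix read as a point of `MatSpace n m`. -/
def ofMat {n m : ℕ} (A : Matrix (Fin n) (Fin m) ℝ) : MatSpace n m :=
  WithLp.toLp 2 fun p => A p.1 p.2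

/-- The Gram matrix `x'x`. -/
def gram {n m : ℕ} (x : MatSpace n m) : Matrix (Fin m) (Fin m) ℝ :=
  (toMat x).transpose * toMat x

/-- `|x|_m = det(x'x)^{1/2}`. -/
def matAbs {n m : ℕ} (x : MatSpace n m) : ℝ := Real.sqrt (gram x).det

/-- The product `x b` with a square matrix `b` on the right. -/
def rmul {n m : ℕ} (x : MatSpace n m) (b : Matrix (Fin m) (Fin m) ℝ) : MatSpace n m :=
  ofMat (toMat x * b)

/-- The Fourier transform `(𝓕 f)(y) = ∫ exp(i tr(y'x)) f(x) dx`. -/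
def matFourier {n m : ℕ} (f : MatSpace n m → ℂ) (y : MatSpace n m) : ℂ :=
  ∫ x, Complex.exp (Complex.I * (((toMat y).transpose * toMat x).trace : ℝ)) * f x

/-- A radial function: `w(y) = w₀(y'y)`. -/
def IsRadial {n m : ℕ} (w : MatSpace n m → ℂ) : Prop :=
  ∃ w₀ : Matrix (Fin m) (Fin m) ℝ → ℂ, ∀ y, w y = w₀ (gram y)

/-- Matrices carry the (product) Borel σ-algebra. -/
instance instMeasurableSpaceMat (n m : ℕ) : MeasurableSpace (Matrix (Fin n) (Fin m) ℝ) :=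
  MeasurableSpace.pi

instance instBorelSpaceMat (n m : ℕ) : BorelSpace (Matrix (Fin n) (Fin m) ℝ) :=
  inferInstanceAs (BorelSpace (Fin n → Fin m → ℝ))

/-! ### The cone of positive definite matrices -/

/-- The cone `P_m` of positive definite symmetric matrices. -/
def cone (m : ℕ) : Set (Matrix (Fin m) (Fin m) ℝ) := {r | r.PosDef}

/-- The boundary of the cone: positive semidefinite matrices that are not positive definite. -/
def coneBoundary (m : ℕ) : Set (Matrix (Fin m) (Fin m) ℝ) := {r | r.PosSemidef ∧ ¬ r.PosDef}

/-- `(a, b) = {s : s - a ∈ P_m, b - s ∈ P_m}`. -/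
def coneInterval {m : ℕ} (a b : Matrix (Fin m) (Fin m) ℝ) : Set (Matrix (Fin m) (Fin m) ℝ) :=
  {s | (s - a).PosDef ∧ (b - s).PosDef}

/-- The symmetric matrix with given entries on and above the diagonal. -/
def symOf (m : ℕ) (c : {p : Fin m × Fin m // p.1 ≤ p.2} → ℝ) : Matrix (Fin m) (Fin m) ℝ :=
  Matrix.of fun i j => if h : i ≤ j then c ⟨(i, j), h⟩ else c ⟨(j, i), le_of_not_ge h⟩

/-- The elementary volume `dr = ∏_{i ≤ j} dr_{ij}` on symmetric matrices. -/
def symVolume (m : ℕ) : Measure (Matrix (Fin m) (Fin m) ℝ) :=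
  Measure.map (symOf m) volume

/-- The invariant measure `d_* r = |r|^{-(m+1)/2} dr` on `P_m`. -/
def coneMeasure (m : ℕ) : Measure (Matrix (Fin m) (Fin m) ℝ) :=
  ((symVolume m).restrict (cone m)).withDensity
    fun r => ENNReal.ofReal (r.det ^ (-(((m : ℝ) + 1) / 2)))

/-- A symmetric function on the cone:
`u(s^{1/2} r s^{1/2}) = u(r^{1/2} s r^{1/2})` for all `r, s ∈ P_m`. -/
def IsSymmetricFun {m : ℕ} (u : Matrix (Fin m) (Fin m) ℝ → ℂ) : Prop :=
  ∀ r ∈ cone m, ∀ s ∈ cone m,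
    u (CFC.sqrt s * r * CFC.sqrt s) = u (CFC.sqrt r * s * CFC.sqrt r)

/-- `u`, as a function on `P_m`, vanishes identically in a neighbourhood of the boundary. -/
def VanishesNearBoundary {m : ℕ} (u : Matrix (Fin m) (Fin m) ℝ → ℂ) : Prop :=
  ∃ U : Set (Matrix (Fin m) (Fin m) ℝ), IsOpen U ∧ coneBoundary m ⊆ U ∧
    ∀ r ∈ U ∩ cone m, u r = 0

/-! ### Constants -/

/-- The Siegel gamma function `Γ_m(α) = ∫_{P_m} exp(-tr r) |r|^{α - (m+1)/2} dr`; the integral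
converges absolutely iff `Re α > (m-1)/2`, which holds for every argument at which it is used
below when `0 ≤ Re α < n - m + 1`. -/
def siegelGamma (m : ℕ) (α : ℂ) : ℂ :=
  ∫ r in cone m, Complex.exp (-((r.trace : ℝ) : ℂ)) *
    ((r.det : ℝ) : ℂ) ^ (α - ((m : ℂ) + 1) / 2) ∂(symVolume m)

/-- `σ_{n,m} = 2^m π^{nm/2} / Γ_m(n/2)`, the total mass of the Stiefel manifold. -/
def stiefelMass (n m : ℕ) : ℂ :=
  2 ^ m * (Real.pi : ℂ) ^ ((n : ℂ) * m / 2) / siegelGamma m ((n : ℂ) / 2)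

/-- `γ_{n,m}(α) = 2^{αm} π^{nm/2} Γ_m(α/2) / Γ_m((n-α)/2)`. -/
def rieszConst (n m : ℕ) (α : ℂ) : ℂ :=
  2 ^ (α * m) * (Real.pi : ℂ) ^ ((n : ℂ) * m / 2) * siegelGamma m (α / 2) /
    siegelGamma m (((n : ℂ) - α) / 2)

/-- `c_k = 2^{-km} π^{-km/2} Γ_m((n-k)/2) / Γ_m(n/2)`. -/
def rankConst (n m k : ℕ) : ℂ :=
  2 ^ (-((k : ℂ) * m)) * (Real.pi : ℂ) ^ (-((k : ℂ) * m / 2)) *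
    siegelGamma m (((n : ℂ) - k) / 2) / siegelGamma m ((n : ℂ) / 2)

/-! ### Riesz potentials -/

instance instCompactSpaceOrthogonal (n : ℕ) :
    CompactSpace (Matrix.orthogonalGroup (Fin n) ℝ) := by
  refine isCompact_iff_compactSpace.mp ?_
  have hK : IsCompact (Set.pi Set.univ fun _ : Fin n => Set.pi Set.univ fun _ : Fin n =>
      Set.Icc (-1 : ℝ) 1) :=
    isCompact_univ_pi fun _ => isCompact_univ_pi fun _ => isCompact_Icc
  refine IsCompact.of_isClosed_subset hK ?_ ?_
  · have : ((Matrix.orthogonalGroup (Fin n) ℝ : Submonoid (Matrix (Fin n) (Fin n) ℝ)) :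
        Set (Matrix (Fin n) (Fin n) ℝ)) = {A | A * star A = 1} := by
      ext A
      exact Matrix.mem_orthogonalGroup_iff (Fin n) ℝ
    change IsClosed ((Matrix.orthogonalGroup (Fin n) ℝ : Submonoid (Matrix (Fin n) (Fin n) ℝ)) :
        Set (Matrix (Fin n) (Fin n) ℝ))
    rw [this]
    exact isClosed_eq (continuous_id.matrix_mul continuous_id.matrix_conjTranspose)
      continuous_const
  · intro A hA i _ j _
    have h := entry_norm_bound_of_unitary (𝕜 := ℝ) hA i j
    exact abs_le.mp h

/-- The invariant measure of total mass `1` on `O(n)`. -/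
def orthogonalHaar (n : ℕ) : Measure (Matrix.orthogonalGroup (Fin n) ℝ) :=
  Measure.haarMeasure ⊤

/-- The `n × m` matrix `[y; 0]` obtained from the `k × m` matrix `y` by adding zero rows below
(for `k ≤ n`). -/
def padRows (n : ℕ) {k m : ℕ} (y : MatSpace k m) : Matrix (Fin n) (Fin m) ℝ :=
  Matrix.of fun i j => if h : i.val < k then y (⟨i.val, h⟩, j) else 0

/-- The measure `ψ ↦ ∫_{M_{k,m}} dy ∫_{O(n)} ψ(γ [y; 0]) dγ` on `n × m` matrices. For `k = 0` it is
the unit mass at `0`. -/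
def rankMeasure (n m k : ℕ) : Measure (MatSpace n m) :=
  Measure.map
    (fun q : MatSpace k m × Matrix.orthogonalGroup (Fin n) ℝ =>
      ofMat ((q.2 : Matrix (Fin n) (Fin n) ℝ) * padRows n q.1))
    ((volume : Measure (MatSpace k m)).prod (orthogonalHaar n))

/-- The Wallach-like set: the union of `{0, 1, …, min(m-1, n-m)}` and
`{α : Re α > m-1, α ≠ n-m+1, n-m+2, …}`. -/
def wallachSet (n m : ℕ) : Set ℂ :=
  {α | ∃ k : ℕ, k ≤ min (m - 1) (n - m) ∧ α = k} ∪
    {α | (m : ℝ) - 1 < α.re ∧ ∀ j : ℕ, α ≠ (n : ℂ) - m + 1 + j}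

/-- The Riesz potential `(I^α f)(x) = ∫ f(x-y) dμ_α(y)`, where `μ_α` is
`γ_{n,m}(α)⁻¹ |y|_m^{α-n} dy` if `Re α > m-1`, and `c_k` times `rankMeasure n m k` if
`α = k ∈ {0, …, m-1}`. (In the second case `k = ⌊Re α⌋₊`.) -/
def rieszPotential (n m : ℕ) (α : ℂ) (f : MatSpace n m → ℂ) (x : MatSpace n m) : ℂ :=
  if (m : ℝ) - 1 < α.re then
    (rieszConst n m α)⁻¹ * ∫ y, f (x - y) * ((matAbs y : ℝ) : ℂ) ^ (α - n)
  else
    rankConst n m ⌊α.re⌋₊ * ∫ y, f (x - y) ∂(rankMeasure n m ⌊α.re⌋₊)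

/-- Absolute convergence of the integral that defines `(I^α f)(x)`. -/
def RieszConverges (n m : ℕ) (α : ℂ) (f : MatSpace n m → ℂ) (x : MatSpace n m) : Prop :=
  if (m : ℝ) - 1 < α.re then
    Integrable (fun y => f (x - y) * ((matAbs y : ℝ) : ℂ) ^ (α - n))
  else
    Integrable (fun y => f (x - y)) (rankMeasure n m ⌊α.re⌋₊)

/-! ### Wavelet transforms -/

/-- The continuous wavelet transform `(W_a f)(x) = ∫ f(x - y a^{1/2}) w(y) dy`. -/
def waveletTransform {n m : ℕ} (w : MatSpace n m → ℂ) (a : Matrix (Fin m) (Fin m) ℝ)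
    (f : MatSpace n m → ℂ) (x : MatSpace n m) : ℂ :=
  ∫ y, f (x - rmul y (CFC.sqrt a)) * w y

/-- The truncated integral `∫_{εI}^{ρI} (W_a φ)(x) |a|^{-α/2} d_* a`. -/
def truncatedInverse {n m : ℕ} (w : MatSpace n m → ℂ) (α : ℂ) (ε ρ : ℝ)
    (φ : MatSpace n m → ℂ) (x : MatSpace n m) : ℂ :=
  ∫ a in coneInterval (ε • (1 : Matrix (Fin m) (Fin m) ℝ)) (ρ • 1),
    waveletTransform w a φ x / ((a.det : ℝ) : ℂ) ^ (α / 2) ∂(coneMeasure m)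

/-- `d_w(α) = (2^m / σ_{n,m}) ∫ (𝓕 w)(z) |z|_m^{-(n+α)} dz`. -/
def waveletConst {n m : ℕ} (w : MatSpace n m → ℂ) (α : ℂ) : ℂ :=
  2 ^ m / stiefelMass n m *
    ∫ z, matFourier w z / ((matAbs z : ℝ) : ℂ) ^ ((n : ℂ) + α)

/-- `(2^m / σ_{n,m}) ∫_{z'z < B} (𝓕 w)(z) |z|_m^{-(n+α)} dz`. -/
def truncatedWaveletConst {n m : ℕ} (w : MatSpace n m → ℂ) (α : ℂ)
    (B : Matrix (Fin m) (Fin m) ℝ) : ℂ :=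
  2 ^ m / stiefelMass n m *
    ∫ z in {z : MatSpace n m | (B - gram z).PosDef},
      matFourier w z / ((matAbs z : ℝ) : ℂ) ^ ((n : ℂ) + α)

end

end MatrixWavelet

/-! On the Fourier side every operator is a multiplication. `I^α` multiplies by |y|_m^{-α}, and
`W_a` multiplies by (𝓕w)(y a^{1/2}) = u₀(a^{1/2} r a^{1/2}) with r = y'y. The symmetry of u₀
rewrites this as u₀(r^{1/2} a r^{1/2}), and |y|_m^{-α} |a|^{-α/2} = |r^{1/2} a r^{1/2}|^{-α/2}. The
truncated integral therefore has the multiplier ∫_{εI}^{ρI} g(r^{1/2} a r^{1/2}) d_*a, where g(s) =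
u₀(s)|s|^{-α/2} (`waveletMultiplier_eq`). As d_* is invariant under congruences, the multiplier is
bounded by ∫|g| d_* and tends to ∫ g d_* when the interval exhausts the cone
(`norm_waveletMultiplier_le`, `tendsto_waveletMultiplier`). Polar coordinates identify the limit
with d_w(α) (`waveletConst_eq`), and Plancherel with dominated convergence gives the limit in L².

The difficulty is to justify the multiplier for integrals that are defined pointwise. For this, `I^α
f` is written as a mixture of averages of f(x - G c(s)) over a standard Gaussian matrix G
(`RieszMixture`). If Re α > m - 1, then c = q^{1/2} with q in the cone, weighted by a multiple of
|q|^{α/2} d_*q. If α = k, then c runs through all k × m matrices, because the law of G c is a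
multiple of the rank k measure (`lintegral_gauss_mul_eq`). The symbol of a Gaussian average is a
Gaussian, and the mixture of these symbols is |2πz|_m^{-α}; from there on both cases are treated
alike.

Absolute convergence comes from an L^p bound: a Gaussian average of |f|, smoothed by a further
Gaussian, is at most a multiple of det(1 + c'c)^{-n/(2p)} ‖f‖_p (`lintegral_gauss_shift_enorm_le`).
Its integral over the mixture converges for n/(2p) > (Re α + m - 1)/2, which is the hypothesis on p.
Fubini then computes the pairings with Schwartz functions (`integral_schwartz_smul_mixtureAverage`).

The analysis on the cone rests on the invariance of d_*, the recursion for the Siegel gamma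
function, and the uniqueness of invariant measures, which yields polar coordinates
(`lintegral_gram`). -/

namespace MatrixWavelet

noncomputable section

open scoped RealInnerProductSpace Matrix

/-! ### Linear algebra on matrix space -/

/-! ### Linear algebra, linear changes of variable and null sets on matrix space. -/

section Basics

variable {n m l k : ℕ}

@[simp] lemma toMat_ofMat (A : Matrix (Fin n) (Fin m) ℝ) : toMat (ofMat A) = A := rfl

@[simp] lemma ofMat_toMat (x : MatSpace n m) : ofMat (toMat x) = x := rfl

lemma toMat_injective : Function.Injective (toMat : MatSpace n m → _) := fun x y h => by
  rw [← ofMat_toMat x, h, ofMat_toMat]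

@[simp] lemma toMat_add (x y : MatSpace n m) : toMat (x + y) = toMat x + toMat y := rfl

@[simp] lemma toMat_smul (c : ℝ) (x : MatSpace n m) : toMat (c • x) = c • toMat x := rfl

@[simp] lemma toMat_neg (x : MatSpace n m) : toMat (-x) = -toMat x := rfl

lemma continuous_toMat : Continuous (toMat : MatSpace n m → _) :=
  continuous_matrix fun i j => by simp only [toMat, Matrix.of_apply]; fun_prop

lemma continuous_ofMat :
    Continuous (ofMat : Matrix (Fin n) (Fin m) ℝ → MatSpace n m) := by
  refine (PiLp.continuous_toLp 2 _).comp (continuous_pi fun p => ?_)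
  exact continuous_id.matrix_elem p.1 p.2

/-- Right multiplication by an `l × m` matrix. -/
def mulRight (n : ℕ) (c : Matrix (Fin l) (Fin m) ℝ) : MatSpace n l →ₗ[ℝ] MatSpace n m where
  toFun x := ofMat (toMat x * c)
  map_add' x y := toMat_injective (by simp [Matrix.add_mul])
  map_smul' a x := toMat_injective (by simp)

lemma toMat_mulRight (c : Matrix (Fin l) (Fin m) ℝ) (x : MatSpace n l) :
    toMat (mulRight n c x) = toMat x * c := rfl

lemma rmul_eq_mulRight (x : MatSpace n m) (b : Matrix (Fin m) (Fin m) ℝ) :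
    rmul x b = mulRight n b x := rfl

lemma mulRight_mulRight (c : Matrix (Fin l) (Fin m) ℝ) (d : Matrix (Fin m) (Fin k) ℝ)
    (x : MatSpace n l) : mulRight n d (mulRight n c x) = mulRight n (c * d) x :=
  toMat_injective (by simp [toMat_mulRight, Matrix.mul_assoc])

@[simp] lemma mulRight_one (x : MatSpace n m) : mulRight n 1 x = x :=
  toMat_injective (by simp [toMat_mulRight])

lemma continuous_mulRight_uncurry :
    Continuous fun p : Matrix (Fin l) (Fin m) ℝ × MatSpace n l => mulRight n p.1 p.2 :=
  continuous_ofMat.comp ((continuous_toMat.comp continuous_snd).matrix_mul continuous_fst)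

lemma inner_eq_trace (x y : MatSpace n m) : ⟪x, y⟫ = ((toMat x)ᵀ * toMat y).trace := by
  simp only [PiLp.inner_apply, Matrix.trace, Matrix.diag, Matrix.mul_apply, Matrix.transpose_apply,
    toMat, Matrix.of_apply, Fintype.sum_prod_type]
  rw [Finset.sum_comm]
  simp [mul_comm]

lemma inner_mulRight (c : Matrix (Fin l) (Fin m) ℝ) (x : MatSpace n l) (z : MatSpace n m) :
    ⟪mulRight n c x, z⟫ = ⟪x, mulRight n cᵀ z⟫ := by
  rw [inner_eq_trace, inner_eq_trace, toMat_mulRight, toMat_mulRight, Matrix.transpose_mul,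
    Matrix.mul_assoc, Matrix.trace_mul_comm, Matrix.mul_assoc]

lemma norm_sq_eq_trace_gram (x : MatSpace n m) : ‖x‖ ^ 2 = (gram x).trace := by
  rw [← real_inner_self_eq_norm_sq, inner_eq_trace, gram]

lemma gram_mulRight (c : Matrix (Fin l) (Fin m) ℝ) (x : MatSpace n l) :
    gram (mulRight n c x) = cᵀ * gram x * c := by
  simp [gram, toMat_mulRight, Matrix.mul_assoc]

lemma gram_smul (a : ℝ) (x : MatSpace n m) : gram (a • x) = a ^ 2 • gram x := by
  simp [gram, smul_smul, sq]

lemma gram_posSemidef (x : MatSpace n m) : (gram x).PosSemidef := by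
  simpa [gram] using Matrix.posSemidef_conjTranspose_mul_self (toMat x)

lemma continuous_gram : Continuous (gram : MatSpace n m → _) :=
  (continuous_toMat.matrix_transpose).matrix_mul continuous_toMat

lemma matAbs_sq (x : MatSpace n m) : matAbs x ^ 2 = (gram x).det :=
  Real.sq_sqrt (gram_posSemidef x).det_nonneg

lemma matAbs_nonneg (x : MatSpace n m) : 0 ≤ matAbs x := Real.sqrt_nonneg _

lemma continuous_matAbs : Continuous (matAbs : MatSpace n m → ℝ) :=
  (continuous_gram.matrix_det).sqrt

lemma matAbs_mulRight (c : Matrix (Fin m) (Fin m) ℝ) (x : MatSpace n m) :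
    matAbs (mulRight n c x) = |c.det| * matAbs x := by
  rw [matAbs, gram_mulRight, Matrix.det_mul, Matrix.det_mul, Matrix.det_transpose, matAbs,
    show c.det * (gram x).det * c.det = c.det ^ 2 * (gram x).det by ring,
    Real.sqrt_mul (sq_nonneg _), Real.sqrt_sq_eq_abs]

lemma gram_posDef_iff (x : MatSpace n m) : (gram x).PosDef ↔ matAbs x ≠ 0 := by
  rw [(gram_posSemidef x).posDef_iff_det_ne_zero, ← matAbs_sq]
  simp

lemma matAbs_pos (x : MatSpace n m) : 0 < matAbs x ↔ (gram x).PosDef := by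
  rw [gram_posDef_iff, (matAbs_nonneg x).lt_iff_ne, ne_comm]

/-! ### Square roots in the cone -/

lemma sqrt_posSemidef (a : Matrix (Fin m) (Fin m) ℝ) : (CFC.sqrt a).PosSemidef :=
  Matrix.nonneg_iff_posSemidef.1 (CFC.sqrt_nonneg a)

lemma sqrt_posDef {a : Matrix (Fin m) (Fin m) ℝ} (ha : a.PosDef) : (CFC.sqrt a).PosDef := by
  rw [(sqrt_posSemidef a).posDef_iff_isUnit]
  exact (CFC.isUnit_sqrt_iff a ha.posSemidef.nonneg).2 ha.isUnit

lemma sqrt_mul_sqrt {a : Matrix (Fin m) (Fin m) ℝ} (ha : a.PosSemidef) :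
    CFC.sqrt a * CFC.sqrt a = a := CFC.sqrt_mul_sqrt_self a ha.nonneg

lemma sqrt_transpose (a : Matrix (Fin m) (Fin m) ℝ) : (CFC.sqrt a)ᵀ = CFC.sqrt a := by
  simpa using (sqrt_posSemidef a).isHermitian.eq

lemma det_sqrt {a : Matrix (Fin m) (Fin m) ℝ} (ha : a.PosSemidef) :
    (CFC.sqrt a).det = Real.sqrt a.det := by
  have h := congrArg Matrix.det (sqrt_mul_sqrt ha)
  rw [Matrix.det_mul] at h
  rw [← h, Real.sqrt_mul_self (sqrt_posSemidef a).det_nonneg]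

lemma isClosed_posSemidef : IsClosed {a : Matrix (Fin m) (Fin m) ℝ | a.PosSemidef} := by
  have : {a : Matrix (Fin m) (Fin m) ℝ | a.PosSemidef} =
      {a | aᵀ = a} ∩ ⋂ x : Fin m → ℝ, {a | 0 ≤ x ⬝ᵥ (a *ᵥ x)} := by
    ext a
    simp only [Set.mem_ofPred_eq, Matrix.posSemidef_iff_dotProduct_mulVec, Set.mem_inter_iff,
      Set.mem_iInter, Matrix.IsHermitian, Matrix.conjTranspose_eq_transpose_of_trivial,
      star_trivial]
  rw [this]
  refine (isClosed_eq continuous_id.matrix_transpose continuous_id).inter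
    (isClosed_iInter fun x => isClosed_le continuous_const ?_)
  exact continuous_const.dotProduct (continuous_id.matrix_mulVec continuous_const)

lemma cone_eq : cone m = {a | a.PosSemidef} ∩ {a | a.det ≠ 0} := by
  ext a
  exact ⟨fun h => ⟨h.posSemidef, h.det_pos.ne'⟩, fun h => (h.1.posDef_iff_det_ne_zero).2 h.2⟩

lemma measurableSet_cone : MeasurableSet (cone m) := by
  rw [cone_eq]
  exact isClosed_posSemidef.measurableSet.inter
    (isOpen_ne_fun continuous_id.matrix_det continuous_const).measurableSet

/-- On positive semidefinite matrices the square root inverts squaring, which is continuous and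
injective on a closed subset of a Polish space. By the Lusin–Souslin theorem its images of Borel
sets are Borel. -/
lemma measurable_sqrt :
    Measurable (CFC.sqrt : Matrix (Fin m) (Fin m) ℝ → Matrix (Fin m) (Fin m) ℝ) := by
  intro B hB
  have : PolishSpace (Matrix (Fin m) (Fin m) ℝ) :=
    inferInstanceAs (PolishSpace (Fin m → Fin m → ℝ))
  set S := {a : Matrix (Fin m) (Fin m) ℝ | a.PosSemidef}
  have hS : MeasurableSet S := isClosed_posSemidef.measurableSet
  have h1 : MeasurableSet ((fun a => a * a) '' (B ∩ S)) := by
    refine (hB.inter hS).image_of_continuousOn_injOn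
      (continuous_id.matrix_mul continuous_id).continuousOn fun a ha b hb hab => ?_
    have := congrArg CFC.sqrt hab
    simpa [CFC.sqrt_mul_self a ha.2.nonneg, CFC.sqrt_mul_self b hb.2.nonneg] using this
  -- Off the positive semidefinite matrices `CFC.sqrt` has the default value 0, so these points lie
  -- in the preimage exactly when 0 ∈ B.
  have h2 : CFC.sqrt ⁻¹' B = ((fun a => a * a) '' (B ∩ S)) ∪ (Sᶜ ∩ {_a | (0 : Matrix _ _ ℝ) ∈ B}) := by
    ext a
    constructor
    · intro ha
      by_cases h : a ∈ S
      · exact Or.inl ⟨CFC.sqrt a, ⟨ha, (sqrt_posSemidef a)⟩, sqrt_mul_sqrt h⟩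
      · refine Or.inr ⟨h, ?_⟩
        have : CFC.sqrt a = 0 := CFC.sqrt_of_not_nonneg fun h0 => h (Matrix.nonneg_iff_posSemidef.1 h0)
        simpa [this] using ha
    · rintro (⟨b, ⟨hb, hbS⟩, rfl⟩ | ⟨h, h0⟩)
      · simpa [CFC.sqrt_mul_self b hbS.nonneg] using hb
      · have : CFC.sqrt a = 0 := CFC.sqrt_of_not_nonneg fun h0 => h (Matrix.nonneg_iff_posSemidef.1 h0)
        simpa [this] using h0
  rw [h2]
  exact h1.union (hS.compl.inter (MeasurableSet.const _))

lemma measurable_det : Measurable (Matrix.det : Matrix (Fin m) (Fin m) ℝ → ℝ) :=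
  (continuous_id.matrix_det).measurable

lemma measurable_trace : Measurable (Matrix.trace : Matrix (Fin m) (Fin m) ℝ → ℝ) :=
  (continuous_id.matrix_trace).measurable

lemma measurable_mulRight_sqrt : Measurable fun q : Matrix (Fin m) (Fin m) ℝ × MatSpace n m =>
    mulRight n (CFC.sqrt q.1) q.2 :=
  continuous_mulRight_uncurry.measurable.comp
    ((measurable_sqrt.comp measurable_fst).prodMk measurable_snd)

lemma measurableSet_coneInterval (a b : Matrix (Fin m) (Fin m) ℝ) :
    MeasurableSet (coneInterval a b) :=
  ((measurableSet_cone (m := m)).preimage (continuous_id.sub continuous_const).measurable).inter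
    ((measurableSet_cone (m := m)).preimage (continuous_const.sub continuous_id).measurable)

/-! ### Changes of variables -/

/-- In coordinates, right multiplication by b is the Kronecker product of the n × n identity with
b', hence the n-th power. -/
lemma det_mulRight (b : Matrix (Fin m) (Fin m) ℝ) : LinearMap.det (mulRight n b) = b.det ^ n := by
  let e := WithLp.linearEquiv 2 ℝ (Fin n × Fin m → ℝ)
  have h : mulRight n b = e.symm.toLinearMap ∘ₗ
      (Matrix.toLin' (Matrix.kroneckerMap (· * ·) (1 : Matrix (Fin n) (Fin n) ℝ) bᵀ)) ∘ₗ e.toLinearMap := by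
    ext x p
    simp [e, mulRight, ofMat, toMat, Matrix.mul_apply, Matrix.mulVec, dotProduct,
      Fintype.sum_prod_type, Matrix.one_apply, mul_comm]
  rw [h]
  have := LinearMap.det_conj (Matrix.toLin' (Matrix.kroneckerMap (· * ·) (1 : Matrix (Fin n) (Fin n) ℝ) bᵀ))
    e.symm
  simp only [LinearEquiv.symm_symm] at this
  rw [this, LinearMap.det_toLin', Matrix.det_kronecker]
  simp

/-- Right multiplication by an invertible matrix, as a measurable equivalence. -/
def mulRightEquiv (n : ℕ) (b : Matrix (Fin m) (Fin m) ℝ) (hb : b.det ≠ 0) :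
    MatSpace n m ≃ᵐ MatSpace n m where
  toFun := mulRight n b
  invFun := mulRight n b⁻¹
  left_inv x := by
    rw [mulRight_mulRight, Matrix.mul_nonsing_inv _ (isUnit_iff_ne_zero.2 hb), mulRight_one]
  right_inv x := by
    rw [mulRight_mulRight, Matrix.nonsing_inv_mul _ (isUnit_iff_ne_zero.2 hb), mulRight_one]
  measurable_toFun := (mulRight n b).continuous_of_finiteDimensional.measurable
  measurable_invFun := (mulRight n b⁻¹).continuous_of_finiteDimensional.measurable

lemma map_mulRight_volume (b : Matrix (Fin m) (Fin m) ℝ) (hb : b.det ≠ 0) :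
    Measure.map (mulRight n b) volume = ENNReal.ofReal (|b.det|⁻¹ ^ n) • volume := by
  rw [Measure.map_linearMap_addHaar_eq_smul_addHaar volume (by rw [det_mulRight]; positivity),
    det_mulRight, abs_inv, abs_pow, inv_pow]

lemma lintegral_mulRight (b : Matrix (Fin m) (Fin m) ℝ) (hb : b.det ≠ 0)
    (F : MatSpace n m → ℝ≥0∞) :
    ∫⁻ x, F (mulRight n b x) = ENNReal.ofReal (|b.det|⁻¹ ^ n) * ∫⁻ x, F x := by
  have := lintegral_map_equiv (μ := (volume : Measure (MatSpace n m))) F (mulRightEquiv n b hb)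
  rw [← smul_eq_mul, ← lintegral_smul_measure, ← map_mulRight_volume b hb]
  exact this.symm

lemma integral_mulRight (b : Matrix (Fin m) (Fin m) ℝ) (hb : b.det ≠ 0)
    (F : MatSpace n m → ℂ) :
    ∫ x, F (mulRight n b x) = ((|b.det|⁻¹ ^ n : ℝ) : ℂ) * ∫ x, F x := by
  have := integral_map_equiv (μ := (volume : Measure (MatSpace n m))) (mulRightEquiv n b hb) F
  have h2 : Measure.map (mulRightEquiv n b hb) volume
    = ENNReal.ofReal (|b.det|⁻¹ ^ n) • (volume : Measure (MatSpace n m)) := map_mulRight_volume b hb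
  rw [h2, integral_smul_measure, ENNReal.toReal_ofReal (by positivity)] at this
  rw [← Complex.real_smul, this]
  rfl

/-- Left multiplication by an orthogonal matrix, as a linear isometry. -/
def mulLeftIsometry (m : ℕ) (V : Matrix.orthogonalGroup (Fin n) ℝ) :
    MatSpace n m →ₗᵢ[ℝ] MatSpace n m where
  toFun x := ofMat ((V : Matrix (Fin n) (Fin n) ℝ) * toMat x)
  map_add' x y := toMat_injective (by simp [Matrix.mul_add])
  map_smul' a x := toMat_injective (by simp)
  norm_map' x := by
    have h : ((V : Matrix (Fin n) (Fin n) ℝ))ᵀ * V = 1 := by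
      simpa [Matrix.star_eq_conjTranspose] using Unitary.coe_star_mul_self V
    have : ‖(ofMat ((V : Matrix (Fin n) (Fin n) ℝ) * toMat x) : MatSpace n m)‖ ^ 2 = ‖x‖ ^ 2 := by
      rw [norm_sq_eq_trace_gram, norm_sq_eq_trace_gram, gram, gram, toMat_ofMat,
        Matrix.transpose_mul, Matrix.mul_assoc, ← Matrix.mul_assoc _ _ (toMat x), h,
        Matrix.one_mul]
    simpa using this

lemma toMat_mulLeftIsometry (V : Matrix.orthogonalGroup (Fin n) ℝ) (x : MatSpace n m) :
    toMat (mulLeftIsometry m V x) = (V : Matrix (Fin n) (Fin n) ℝ) * toMat x := rfl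

lemma measurePreserving_mulLeftIsometry (V : Matrix.orthogonalGroup (Fin n) ℝ) :
    MeasurePreserving (mulLeftIsometry m V) :=
  ((mulLeftIsometry m V).toLinearIsometryEquiv rfl).measurePreserving

lemma measurableEmbedding_mulLeftIsometry (V : Matrix.orthogonalGroup (Fin n) ℝ) :
    MeasurableEmbedding (mulLeftIsometry m V) :=
  ((mulLeftIsometry m V).toLinearIsometryEquiv rfl).toHomeomorph.measurableEmbedding

/-! ### Singular matrices are negligible -/

/-- The `n × m` matrix with ones on the diagonal. -/
def eyeMat (n m : ℕ) : MatSpace n m := ofMat (Matrix.of fun i j => if i.val = j.val then 1 else 0)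

lemma matAbs_ne_zero_of_det_submatrix (hnm : m ≤ n) (x : MatSpace n m)
    (h : ((toMat x).submatrix (Fin.castLE hnm) id).det ≠ 0) : matAbs x ≠ 0 := by
  rw [← gram_posDef_iff, gram, ← Matrix.conjTranspose_eq_transpose_of_trivial]
  refine Matrix.PosDef.conjTranspose_mul_self _ fun u v huv => ?_
  have h2 : Function.Injective ((toMat x).submatrix (Fin.castLE hnm) id).mulVec :=
    Matrix.mulVec_injective_iff_isUnit.2 ((Matrix.isUnit_iff_isUnit_det _).2
      (isUnit_iff_ne_zero.2 h))
  exact h2 (funext fun i => congrFun huv (Fin.castLE hnm i))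

/-- Along this line the top block A becomes A + tI, whose determinant is the characteristic
polynomial of -A at t. It is monic, so it has finitely many roots. -/
lemma finite_singular_line (hnm : m ≤ n) (x : MatSpace n m) :
    {t : ℝ | matAbs (x + t • eyeMat n m) = 0}.Finite := by
  set A := (toMat x).submatrix (Fin.castLE hnm) id
  have hp : ((-A).charpoly) ≠ 0 := (Matrix.charpoly_monic _).ne_zero
  refine ((-A).charpoly.roots.toFinset.finite_toSet).subset fun t ht => ?_
  by_contra hcon
  refine matAbs_ne_zero_of_det_submatrix hnm _ (fun h0 => hcon ?_) ht
  simp only [Finset.mem_coe, Multiset.mem_toFinset, Polynomial.mem_roots hp, Polynomial.IsRoot]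
  rw [Matrix.eval_charpoly]
  convert h0 using 2
  ext i j
  simp only [Matrix.scalar_apply, Matrix.sub_apply, Matrix.diagonal_apply, Matrix.neg_apply,
    Matrix.submatrix_apply, toMat, Matrix.of_apply, eyeMat, ofMat, A, PiLp.add_apply,
    PiLp.smul_apply, id, Fin.val_castLE, smul_eq_mul, Fin.ext_iff]
  split_ifs <;> ring

/-- All translates of the singular set by t·`eyeMat` have the same measure. Averaging over 0 ≤ t ≤ 1
and exchanging the integrals leaves lines that meet the set in finitely many points. -/
lemma ae_matAbs_ne_zero (hnm : m ≤ n) : ∀ᵐ x : MatSpace n m, matAbs x ≠ 0 := by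
  have hS : MeasurableSet {x : MatSpace n m | matAbs x = 0} :=
    (isClosed_eq continuous_matAbs continuous_const).measurableSet
  set F : MatSpace n m → ℝ≥0∞ := {x : MatSpace n m | matAbs x = 0}.indicator 1
  have hF : Measurable F := measurable_one.indicator hS
  have h1 : ∀ t : ℝ, ∫⁻ x, F (x + t • eyeMat n m) = volume {x : MatSpace n m | matAbs x = 0} := by
    intro t
    rw [lintegral_add_right_eq_self F, lintegral_indicator_one hS]
  have h2 : ∫⁻ t in Set.Icc (0 : ℝ) 1, ∫⁻ x, F (x + t • eyeMat n m) = 0 := by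
    rw [lintegral_lintegral_swap]
    · refine lintegral_eq_zero_of_ae_eq_zero (Eventually.of_forall fun x => ?_)
      refine lintegral_eq_zero_of_ae_eq_zero ?_
      have h3 : ∀ᵐ t : ℝ ∂volume.restrict (Set.Icc (0 : ℝ) 1),
          t ∉ {t : ℝ | matAbs (x + t • eyeMat n m) = 0} :=
        ae_restrict_of_ae (measure_eq_zero_iff_ae_notMem.1
          ((finite_singular_line hnm x).measure_zero _))
      filter_upwards [h3] with t ht
      simpa [F] using ht
    · exact (hF.comp (by fun_prop : Measurable fun p : ℝ × MatSpace n m =>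
        p.2 + p.1 • eyeMat n m)).aemeasurable
  simp only [h1, lintegral_const, Measure.restrict_apply MeasurableSet.univ, Set.univ_inter,
    Real.volume_Icc, sub_zero, ENNReal.ofReal_one, mul_one] at h2
  rw [ae_iff]
  simpa using h2

end Basics

end

end MatrixWavelet

namespace MatrixWavelet

noncomputable section

open scoped RealInnerProductSpace Matrix

/-! ### The Jacobian of congruences and the invariance of d_*. -/

section SymVolume

variable {m : ℕ}

/-! ### Invariance of the volume of symmetric matrices -/

/-- Index set of the coordinates of symmetric matrices. -/
abbrev SymIndex (m : ℕ) := {p : Fin m × Fin m // p.1 ≤ p.2}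

/-- The entries of a matrix on and above the diagonal. -/
def symCoord (r : Matrix (Fin m) (Fin m) ℝ) : SymIndex m → ℝ := fun p => r p.1.1 p.1.2

lemma symCoord_symOf (c : SymIndex m → ℝ) : symCoord (symOf m c) = c := by
  ext ⟨⟨i, j⟩, h⟩
  have h' : i ≤ j := h
  simp [symCoord, symOf, h']

lemma symOf_transpose (c : SymIndex m → ℝ) : (symOf m c)ᵀ = symOf m c := by
  ext i j
  simp only [symOf, Matrix.transpose_apply, Matrix.of_apply]
  rcases lt_trichotomy i j with h | rfl | h
  · simp [h.le, h.not_ge]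
  · rfl
  · simp [h.le, h.not_ge]

lemma symOf_symCoord {r : Matrix (Fin m) (Fin m) ℝ} (hr : rᵀ = r) : symOf m (symCoord r) = r := by
  ext i j
  simp only [symOf, Matrix.of_apply, symCoord]
  split_ifs
  · rfl
  · exact congrFun (congrFun hr i) j

lemma continuous_symOf : Continuous (symOf m) := by
  refine continuous_matrix fun i j => ?_
  simp only [symOf, Matrix.of_apply]
  split_ifs <;> fun_prop

instance : SFinite (symVolume m) := by unfold symVolume; infer_instance

lemma lintegral_symVolume {F : Matrix (Fin m) (Fin m) ℝ → ℝ≥0∞} (hF : Measurable F) :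
    ∫⁻ r, F r ∂(symVolume m) = ∫⁻ c, F (symOf m c) :=
  lintegral_map hF continuous_symOf.measurable

/-- The congruence `r ↦ g r g'` in coordinates. -/
def symConj (g : Matrix (Fin m) (Fin m) ℝ) : (SymIndex m → ℝ) →ₗ[ℝ] (SymIndex m → ℝ) where
  toFun c := symCoord (g * symOf m c * gᵀ)
  map_add' c d := by
    have : symOf m (c + d) = symOf m c + symOf m d := by
      ext i j; simp only [symOf, Matrix.of_apply, Matrix.add_apply]; split_ifs <;> rfl
    rw [this, Matrix.mul_add, Matrix.add_mul]; rfl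
  map_smul' a c := by
    have : symOf m (a • c) = a • symOf m c := by
      ext i j; simp only [symOf, Matrix.of_apply, Matrix.smul_apply]; split_ifs <;> rfl
    rw [this, Matrix.mul_smul, Matrix.smul_mul]; rfl

lemma symOf_symConj (g : Matrix (Fin m) (Fin m) ℝ) (c : SymIndex m → ℝ) :
    symOf m (symConj g c) = g * symOf m c * gᵀ :=
  symOf_symCoord (r := g * symOf m c * gᵀ) (by simp [Matrix.mul_assoc, symOf_transpose])

lemma symConj_mul (g h : Matrix (Fin m) (Fin m) ℝ) :
    symConj (g * h) = symConj g ∘ₗ symConj h := by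
  refine LinearMap.ext fun c => ?_
  change symCoord (g * h * symOf m c * (g * h)ᵀ) = symCoord (g * symOf m (symConj h c) * gᵀ)
  rw [symOf_symConj]
  simp [Matrix.mul_assoc]

lemma symConj_one : symConj (1 : Matrix (Fin m) (Fin m) ℝ) = LinearMap.id := by
  refine LinearMap.ext fun c => ?_
  change symCoord (1 * symOf m c * 1ᵀ) = c
  simp [symCoord_symOf]

/-- The coordinate r_{ij} is multiplied by d_i d_j. With indices starting at 0, i is the first index
of m - i pairs and the second index of i + 1 pairs, so each d_i occurs m + 1 times. -/
lemma det_symConj_diagonal (d : Fin m → ℝ) :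
    LinearMap.det (symConj (Matrix.diagonal d)) = (∏ i, d i) ^ (m + 1) := by
  have h : symConj (Matrix.diagonal d) =
      Matrix.toLin' (Matrix.diagonal fun p : SymIndex m => d p.1.1 * d p.1.2) := by
    refine LinearMap.ext fun c => ?_
    ext ⟨⟨i, j⟩, h⟩
    have h' : i ≤ j := h
    simp [symConj, symCoord, symOf, Matrix.mulVec_diagonal, h']
    ring
  rw [h, LinearMap.det_toLin', Matrix.det_diagonal, Finset.prod_mul_distrib]
  have hs : ∀ f : Fin m × Fin m → ℝ, ∏ p : SymIndex m, f p.1 =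
      ∏ i, ∏ j, if i ≤ j then f (i, j) else 1 := fun f => by
    rw [← Finset.prod_subtype (Finset.univ.filter fun p : Fin m × Fin m => p.1 ≤ p.2) (by simp) f,
      Finset.prod_filter, Fintype.prod_prod_type]
  have h1 : ∏ p : SymIndex m, d p.1.1 = ∏ i : Fin m, d i ^ (m - i.val) := by
    rw [hs fun p => d p.1]
    refine Finset.prod_congr rfl fun i _ => ?_
    change (∏ j, if i ≤ j then d i else 1) = _
    rw [← Finset.prod_filter, Finset.prod_const, Finset.filter_le_eq_Ici, Fin.card_Ici]
  have h2 : ∏ p : SymIndex m, d p.1.2 = ∏ i : Fin m, d i ^ (i.val + 1) := by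
    rw [hs fun p => d p.2, Finset.prod_comm]
    refine Finset.prod_congr rfl fun i _ => ?_
    change (∏ j, if j ≤ i then d i else 1) = _
    rw [← Finset.prod_filter, Finset.prod_const, Finset.filter_ge_eq_Iic, Fin.card_Iic]
  rw [h1, h2, ← Finset.prod_mul_distrib, ← Finset.prod_pow]
  refine Finset.prod_congr rfl fun i _ => ?_
  rw [← pow_add]
  congr 1
  omega

/-- Squaring a transvection doubles its parameter, and so does conjugating it by a diagonal matrix
with a single entry 2. The determinant is therefore idempotent and nonzero, hence 1. -/
lemma det_symConj_transvection (t : Matrix.TransvectionStruct (Fin m) ℝ) :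
    LinearMap.det (symConj t.toMatrix) = 1 := by
  have hmul : ∀ g h : Matrix (Fin m) (Fin m) ℝ, LinearMap.det (symConj (g * h)) =
      LinearMap.det (symConj g) * LinearMap.det (symConj h) := fun g h => by
    rw [symConj_mul, LinearMap.det_comp]
  obtain ⟨i, j, hij, c⟩ := t
  set T : ℝ → Matrix (Fin m) (Fin m) ℝ := Matrix.transvection i j
  set D : ℝ → Matrix (Fin m) (Fin m) ℝ := fun a => Matrix.diagonal (Function.update 1 i a)
  have hadd : ∀ a b, T a * T b = T (a + b) := fun a b =>
    Matrix.transvection_mul_transvection_same i j hij a b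
  have hconj : D 2 * T c * D (1 / 2) = T (c + c) := by
    ext p q
    simp only [D, T, Matrix.mul_diagonal, Matrix.diagonal_mul, Matrix.transvection,
      Matrix.add_apply, Matrix.one_apply, Matrix.single_apply, Function.update_apply, Pi.one_apply]
    by_cases hp : p = i <;> by_cases hq : q = j <;> by_cases hq' : q = i <;> subst_vars <;>
      simp_all [eq_comm] <;> ring
  have hD : LinearMap.det (symConj (D 2)) * LinearMap.det (symConj (D (1 / 2))) = 1 := by
    rw [← hmul]
    have : D 2 * D (1 / 2) = 1 := by
      simp only [D, Matrix.diagonal_mul_diagonal, ← Matrix.diagonal_one]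
      congr 1
      ext p
      simp only [Function.update_apply]
      split_ifs <;> norm_num
    rw [this, symConj_one, LinearMap.det_id]
  have h1 : LinearMap.det (symConj (T c)) * LinearMap.det (symConj (T (-c))) = 1 := by
    rw [← hmul, hadd, add_neg_cancel]
    simp [T, symConj_one]
  have h2 : LinearMap.det (symConj (T c)) * LinearMap.det (symConj (T c)) =
      LinearMap.det (symConj (T c)) := by
    rw [← hmul, hadd, ← hconj, hmul, hmul]
    linear_combination LinearMap.det (symConj (T c)) * hD
  change LinearMap.det (symConj (T c)) = 1
  exact mul_left_cancel₀ (left_ne_zero_of_mul_eq_one h1) (by rw [h2, mul_one])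

/-- The determinant is multiplicative in g, and every square matrix is a product of diagonal
matrices and transvections. -/
lemma det_symConj (g : Matrix (Fin m) (Fin m) ℝ) :
    LinearMap.det (symConj g) = g.det ^ (m + 1) := by
  induction g using Matrix.diagonal_transvection_induction with
  | hdiag d _ => rw [det_symConj_diagonal, Matrix.det_diagonal]
  | htransvec t => rw [det_symConj_transvection, t.det, one_pow]
  | hmul A B hA hB => rw [symConj_mul, LinearMap.det_comp, hA, hB, Matrix.det_mul, mul_pow]

lemma lintegral_symVolume_congr (g : Matrix (Fin m) (Fin m) ℝ) (hg : g.det ≠ 0)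
    {F : Matrix (Fin m) (Fin m) ℝ → ℝ≥0∞} (hF : Measurable F) :
    ∫⁻ r, F (g * r * gᵀ) ∂(symVolume m) =
      ENNReal.ofReal (|g.det|⁻¹ ^ (m + 1)) * ∫⁻ r, F r ∂(symVolume m) := by
  have hc : Measurable fun r : Matrix (Fin m) (Fin m) ℝ => g * r * gᵀ :=
    ((continuous_const.matrix_mul continuous_id).matrix_mul continuous_const).measurable
  rw [lintegral_symVolume (F := fun r => F (g * r * gᵀ)) (hF.comp hc), lintegral_symVolume hF]
  simp only [← symOf_symConj]
  have h1 := Measure.map_linearMap_addHaar_eq_smul_addHaar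
    (volume : Measure (SymIndex m → ℝ)) (f := symConj g) (by rw [det_symConj]; positivity)
  have h2 := lintegral_map (μ := (volume : Measure (SymIndex m → ℝ)))
    (hF.comp continuous_symOf.measurable)
    (symConj g).continuous_of_finiteDimensional.measurable
  rw [h1, lintegral_smul_measure, det_symConj, smul_eq_mul] at h2
  simp only [Function.comp_apply] at h2
  rw [← h2, abs_inv, abs_pow, inv_pow]

lemma congr_posDef_iff {g r : Matrix (Fin m) (Fin m) ℝ} (hg : g.det ≠ 0) :
    (g * r * gᵀ).PosDef ↔ r.PosDef := by
  have := Matrix.IsUnit.posDef_star_right_conjugate_iff (x := r)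
    ((Matrix.isUnit_iff_isUnit_det _).2 (isUnit_iff_ne_zero.2 hg))
  simpa [Matrix.star_eq_conjTranspose] using this

instance : SFinite (coneMeasure m) := by unfold coneMeasure; infer_instance

lemma lintegral_coneMeasure (F : Matrix (Fin m) (Fin m) ℝ → ℝ≥0∞) (hF : Measurable F) :
    ∫⁻ r, F r ∂(coneMeasure m) = ∫⁻ r, (cone m).indicator
      (fun r => ENNReal.ofReal (r.det ^ (-(((m : ℝ) + 1) / 2))) * F r) r ∂(symVolume m) := by
  rw [coneMeasure, lintegral_withDensity_eq_lintegral_mul _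
    (measurable_det.pow_const _).ennreal_ofReal hF, lintegral_indicator measurableSet_cone]
  rfl

lemma ae_mem_cone : ∀ᵐ r ∂(coneMeasure m), r ∈ cone m :=
  (withDensity_absolutelyContinuous _ _).ae_le (ae_restrict_mem measurableSet_cone)

/-- The congruence `r ↦ g r g'` as a measurable equivalence. -/
def congrEquiv (g : Matrix (Fin m) (Fin m) ℝ) (hg : g.det ≠ 0) :
    Matrix (Fin m) (Fin m) ℝ ≃ᵐ Matrix (Fin m) (Fin m) ℝ where
  toFun r := g * r * gᵀ
  invFun r := g⁻¹ * r * g⁻¹ᵀ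
  left_inv r := by
    have h : g⁻¹ * g = 1 := Matrix.nonsing_inv_mul _ (isUnit_iff_ne_zero.2 hg)
    have h' : gᵀ * g⁻¹ᵀ = 1 := by rw [← Matrix.transpose_mul, h, Matrix.transpose_one]
    calc g⁻¹ * (g * r * gᵀ) * g⁻¹ᵀ = (g⁻¹ * g) * r * (gᵀ * g⁻¹ᵀ) := by simp only [Matrix.mul_assoc]
      _ = r := by rw [h, h', Matrix.one_mul, Matrix.mul_one]
  right_inv r := by
    have h : g * g⁻¹ = 1 := Matrix.mul_nonsing_inv _ (isUnit_iff_ne_zero.2 hg)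
    have h' : g⁻¹ᵀ * gᵀ = 1 := by rw [← Matrix.transpose_mul, h, Matrix.transpose_one]
    calc g * (g⁻¹ * r * g⁻¹ᵀ) * gᵀ = (g * g⁻¹) * r * (g⁻¹ᵀ * gᵀ) := by simp only [Matrix.mul_assoc]
      _ = r := by rw [h, h', Matrix.one_mul, Matrix.mul_one]
  measurable_toFun :=
    ((continuous_const.matrix_mul continuous_id).matrix_mul continuous_const).measurable
  measurable_invFun :=
    ((continuous_const.matrix_mul continuous_id).matrix_mul continuous_const).measurable

/-- The Jacobian |det g|^{m+1} is cancelled by the factor |det g|^{-(m+1)} that the density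
|r|^{-(m+1)/2} acquires. -/
lemma measurePreserving_congr (g : Matrix (Fin m) (Fin m) ℝ) (hg : g.det ≠ 0) :
    MeasurePreserving (congrEquiv g hg) (coneMeasure m) (coneMeasure m) := by
  refine ⟨(congrEquiv g hg).measurable, Measure.ext_of_lintegral _ fun F hF => ?_⟩
  rw [lintegral_map hF (congrEquiv g hg).measurable,
    lintegral_coneMeasure (fun r => F (congrEquiv g hg r)) (hF.comp (congrEquiv g hg).measurable),
    lintegral_coneMeasure _ hF]
  set K : Matrix (Fin m) (Fin m) ℝ → ℝ≥0∞ := (cone m).indicator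
    fun r => ENNReal.ofReal (r.det ^ (-(((m : ℝ) + 1) / 2))) * F r
  have hK : Measurable K :=
    ((measurable_det.pow_const _).ennreal_ofReal.mul hF).indicator measurableSet_cone
  have h1 := lintegral_symVolume_congr g hg hK
  have h0 : 0 < |g.det| := abs_pos.2 hg
  have h2 : ∀ r, (cone m).indicator (fun r => ENNReal.ofReal (r.det ^ (-(((m : ℝ) + 1) / 2))) *
      F (congrEquiv g hg r)) r = ENNReal.ofReal (|g.det| ^ (m + 1)) * K (g * r * gᵀ) := by
    intro r
    by_cases hr : r ∈ cone m
    · have hr' : g * r * gᵀ ∈ cone m := (congr_posDef_iff hg).2 hr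
      have hdet : 0 < r.det := Matrix.PosDef.det_pos hr
      simp only [K, Set.indicator_of_mem hr, Set.indicator_of_mem hr', ← mul_assoc]
      rw [← ENNReal.ofReal_mul (by positivity)]
      congr 2
      rw [Matrix.det_mul, Matrix.det_mul, Matrix.det_transpose,
        show g.det * r.det * g.det = |g.det| ^ 2 * r.det by rw [sq_abs]; ring,
        Real.mul_rpow (by positivity) hdet.le, ← mul_assoc, ← Real.rpow_natCast |g.det| 2,
        ← Real.rpow_mul h0.le, ← Real.rpow_natCast |g.det| (m + 1), ← Real.rpow_add h0,
        show ((m + 1 : ℕ) : ℝ) + (2 : ℕ) * -(((m : ℝ) + 1) / 2) = 0 by push_cast; ring,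
        Real.rpow_zero, one_mul]
    · have hr' : g * r * gᵀ ∉ cone m := fun h => hr ((congr_posDef_iff hg).1 h)
      simp only [K, Set.indicator_of_notMem hr, Set.indicator_of_notMem hr', mul_zero]
  rw [lintegral_congr h2, lintegral_const_mul (f := fun r => K (g * r * gᵀ)) _
    (hK.comp (congrEquiv g hg).measurable), h1,
    ← mul_assoc, ← ENNReal.ofReal_mul (by positivity), ← mul_pow,
    mul_inv_cancel₀ h0.ne', one_pow, ENNReal.ofReal_one, one_mul]

end SymVolume

end

end MatrixWavelet

namespace MatrixWavelet

noncomputable section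

open scoped RealInnerProductSpace Matrix

/-! ### Schur complements and the recursion for the law of the determinant. -/

section Border

variable {m : ℕ}

/-! ### The block decomposition of the cone -/

/-- The symmetric matrix `[[r, v], [v', t]]`. -/
def border (r : Matrix (Fin m) (Fin m) ℝ) (v : Fin m → ℝ) (t : ℝ) :
    Matrix (Fin (m + 1)) (Fin (m + 1)) ℝ :=
  (Matrix.fromBlocks r (Matrix.of fun i _ => v i) (Matrix.of fun i _ => v i)ᴴ
    (Matrix.of fun _ _ => t) : Matrix (Fin m ⊕ Fin 1) (Fin m ⊕ Fin 1) ℝ).submatrix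
      finSumFinEquiv.symm finSumFinEquiv.symm

lemma trace_border (r : Matrix (Fin m) (Fin m) ℝ) (v : Fin m → ℝ) (t : ℝ) :
    (border r v t).trace = r.trace + t := by
  rw [border, Matrix.trace, ← Equiv.sum_comp finSumFinEquiv]
  simp [Matrix.trace]

lemma det_border {r : Matrix (Fin m) (Fin m) ℝ} (hr : r.PosDef) (v : Fin m → ℝ) (t : ℝ) :
    (border r v t).det = r.det * (t - v ⬝ᵥ (r⁻¹ *ᵥ v)) := by
  let _ := hr.isUnit.invertible
  rw [border, Matrix.det_submatrix_equiv_self, Matrix.det_fromBlocks₁₁]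
  congr 1
  simp [Matrix.det_unique, Matrix.mul_apply, dotProduct, Matrix.mulVec, Finset.sum_mul,
    Finset.mul_sum]
  rw [Finset.sum_comm]
  exact Finset.sum_congr rfl fun _ _ => Finset.sum_congr rfl fun _ _ => by ring

/-- Semidefiniteness of the bordered matrix is nonnegativity of the Schur complement t - v'r⁻¹v; the
determinant formula makes the inequality strict. -/
lemma posDef_border_iff {r : Matrix (Fin m) (Fin m) ℝ} (hr : r.PosDef) (v : Fin m → ℝ) (t : ℝ) :
    (border r v t).PosDef ↔ v ⬝ᵥ (r⁻¹ *ᵥ v) < t := by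
  let _ := hr.isUnit.invertible
  have hpsd : (border r v t).PosSemidef ↔ 0 ≤ t - v ⬝ᵥ (r⁻¹ *ᵥ v) := by
    rw [border, Matrix.posSemidef_submatrix_equiv, Matrix.PosDef.fromBlocks₁₁ _ _ hr]
    have : (Matrix.of fun _ _ => t : Matrix (Fin 1) (Fin 1) ℝ) -
        (Matrix.of fun i _ => v i)ᴴ * r⁻¹ * (Matrix.of fun i _ => v i) =
        Matrix.diagonal fun _ => t - v ⬝ᵥ (r⁻¹ *ᵥ v) := by
      ext i j
      simp [Subsingleton.elim i j, Matrix.mul_apply, dotProduct, Matrix.mulVec, Finset.sum_mul,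
        Finset.mul_sum]
      rw [Finset.sum_comm]
      exact Finset.sum_congr rfl fun _ _ => Finset.sum_congr rfl fun _ _ => by ring
    rw [this, Matrix.posSemidef_diagonal_iff]
    simp
  constructor
  · intro h
    have h1 := hpsd.1 h.posSemidef
    have h2 := h.det_pos
    rw [det_border hr] at h2
    have := (pos_iff_pos_of_mul_pos h2).1 hr.det_pos
    linarith
  · intro h
    rw [(hpsd.2 (by linarith)).posDef_iff_det_ne_zero, det_border hr]
    exact (mul_pos hr.det_pos (by linarith)).ne'

lemma posDef_of_border {r : Matrix (Fin m) (Fin m) ℝ} {v : Fin m → ℝ} {t : ℝ}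
    (h : (border r v t).PosDef) : r.PosDef := by
  have := h.submatrix (e := finSumFinEquiv ∘ Sum.inl)
    (finSumFinEquiv.injective.comp Sum.inl_injective)
  convert this using 1
  ext i j
  simp [border]

/-- The splitting of the coordinates of a bordered symmetric matrix. -/
def symIndexEquiv (m : ℕ) : (SymIndex m ⊕ Fin m) ⊕ Unit ≃ SymIndex (m + 1) :=
  Equiv.ofBijective
    (Sum.elim (Sum.elim (fun p => ⟨(p.1.1.castSucc, p.1.2.castSucc), p.2⟩)
      fun i => ⟨(i.castSucc, Fin.last m), Fin.le_last _⟩)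
      fun _ => ⟨(Fin.last m, Fin.last m), le_rfl⟩) <| by
    constructor
    · rintro ((⟨⟨i, j⟩, h⟩ | i) | _) ((⟨⟨i', j'⟩, h'⟩ | i') | _) h <;>
        simp_all [Fin.ext_iff] <;> omega
    · rintro ⟨⟨i, j⟩, h⟩
      have h' : i ≤ j := h
      induction j using Fin.lastCases with
      | last =>
        induction i using Fin.lastCases with
        | last => exact ⟨Sum.inr (), rfl⟩
        | cast i => exact ⟨Sum.inl (Sum.inr i), rfl⟩
      | cast j =>
        induction i using Fin.lastCases with
        | last => exact absurd h' (by simp [Fin.le_def])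
        | cast i => exact ⟨Sum.inl (Sum.inl ⟨(i, j), h'⟩), rfl⟩

lemma symOf_succ (c : SymIndex (m + 1) → ℝ) :
    symOf (m + 1) c = border (symOf m fun p => c (symIndexEquiv m (Sum.inl (Sum.inl p))))
      (fun i => c (symIndexEquiv m (Sum.inl (Sum.inr i)))) (c (symIndexEquiv m (Sum.inr ()))) := by
  have hl : finSumFinEquiv.symm (Fin.last m) = (Sum.inr 0 : Fin m ⊕ Fin 1) :=
    finSumFinEquiv_symm_last
  have hc : ∀ i : Fin m, finSumFinEquiv.symm i.castSucc = (Sum.inl i : Fin m ⊕ Fin 1) := fun i =>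
    finSumFinEquiv_symm_apply_castAdd i
  have h1 : ∀ p : SymIndex m, symIndexEquiv m (Sum.inl (Sum.inl p)) =
    ⟨(p.1.1.castSucc, p.1.2.castSucc), p.2⟩ := fun _ => rfl
  have h2 : ∀ i : Fin m, symIndexEquiv m (Sum.inl (Sum.inr i)) =
    ⟨(i.castSucc, Fin.last m), Fin.le_last _⟩ := fun _ => rfl
  have h3 : symIndexEquiv m (Sum.inr ()) = ⟨(Fin.last m, Fin.last m), le_rfl⟩ := rfl
  ext i j
  induction i using Fin.lastCases with
  | last =>
    induction j using Fin.lastCases with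
    | last => simp [border, symOf, hl, h1, h2, h3]
    | cast j => simp [border, symOf, hl, hc, h1, h2, h3, Fin.last_le_iff, Fin.castSucc_ne_last]
  | cast i =>
    induction j using Fin.lastCases with
    | last => simp [border, symOf, hl, hc, h1, h2, h3, Fin.le_last]
    | cast j => simp [border, symOf, hc, h1, h2, h3]

lemma continuous_border : Continuous fun q : Matrix (Fin m) (Fin m) ℝ × (Fin m → ℝ) × ℝ =>
    border q.1 q.2.1 q.2.2 := by
  unfold border
  refine Continuous.matrix_submatrix (Continuous.matrix_fromBlocks continuous_fst ?_ ?_ ?_) _ _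
  · exact continuous_matrix fun i j => by simp only [Matrix.of_apply]; fun_prop
  · exact continuous_matrix fun i j => by
      simp only [Matrix.of_apply, Matrix.conjTranspose_apply, star_trivial]; fun_prop
  · exact continuous_matrix fun i j => by simp only [Matrix.of_apply]; fun_prop

/-- Fubini: the entries of the leading block, of the last column above the corner, and of the corner
are separate coordinates of a product Lebesgue measure. -/
lemma lintegral_symVolume_succ {F : Matrix (Fin (m + 1)) (Fin (m + 1)) ℝ → ℝ≥0∞}
    (hF : Measurable F) :
    ∫⁻ r, F r ∂(symVolume (m + 1)) =
      ∫⁻ r, (∫⁻ v : Fin m → ℝ, ∫⁻ t : ℝ, F (border r v t)) ∂(symVolume m) := by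
  have hb := (continuous_border (m := m)).measurable
  have h1 : Measurable fun q : (Matrix (Fin m) (Fin m) ℝ × (Fin m → ℝ)) × ℝ =>
      F (border q.1.1 q.1.2 q.2) :=
    hF.comp (hb.comp (measurable_fst.fst.prodMk (measurable_fst.snd.prodMk measurable_snd)))
  have h2 : Measurable fun q : Matrix (Fin m) (Fin m) ℝ × (Fin m → ℝ) =>
      ∫⁻ t : ℝ, F (border q.1 q.2 t) := h1.lintegral_prod_right'
  have h3 : Measurable fun r : Matrix (Fin m) (Fin m) ℝ =>
      ∫⁻ v : Fin m → ℝ, ∫⁻ t : ℝ, F (border r v t) := h2.lintegral_prod_right'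
  have hS := (continuous_symOf (m := m)).measurable
  set K : (SymIndex m ⊕ Fin m → ℝ) × (Unit → ℝ) → ℝ≥0∞ := fun q =>
    F (border (symOf m fun p => q.1 (Sum.inl p)) (fun i => q.1 (Sum.inr i)) (q.2 ()))
  have hK : Measurable K := by
    have k1 : Measurable fun q : (SymIndex m ⊕ Fin m → ℝ) × (Unit → ℝ) =>
        fun p : SymIndex m => q.1 (Sum.inl p) :=
      measurable_pi_lambda _ fun p => (measurable_pi_apply (Sum.inl p)).comp measurable_fst
    have k2 : Measurable fun q : (SymIndex m ⊕ Fin m → ℝ) × (Unit → ℝ) =>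
        fun i : Fin m => q.1 (Sum.inr i) :=
      measurable_pi_lambda _ fun p => (measurable_pi_apply (Sum.inr p)).comp measurable_fst
    have k3 : Measurable fun q : (SymIndex m ⊕ Fin m → ℝ) × (Unit → ℝ) => q.2 () :=
      (measurable_pi_apply ()).comp measurable_snd
    exact h1.comp (((hS.comp k1).prodMk k2).prodMk k3)
  rw [lintegral_symVolume hF, lintegral_symVolume h3]
  have e1 := (volume_measurePreserving_piCongrLeft (fun _ => ℝ)
    (symIndexEquiv m)).lintegral_comp_emb (MeasurableEquiv.measurableEmbedding _)
      fun c => F (symOf (m + 1) c)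
  have e2 := (volume_measurePreserving_sumPiEquivProdPi
    (fun _ : (SymIndex m ⊕ Fin m) ⊕ Unit => ℝ)).lintegral_comp hK
  have e3 : ∀ c, F (symOf (m + 1) (MeasurableEquiv.piCongrLeft (fun _ => ℝ) (symIndexEquiv m) c)) =
      K (MeasurableEquiv.sumPiEquivProdPi (fun _ : (SymIndex m ⊕ Fin m) ⊕ Unit => ℝ) c) := by
    intro c
    rw [symOf_succ]
    simp only [MeasurableEquiv.coe_piCongrLeft, Equiv.piCongrLeft_apply_apply]
    rfl
  have e4 := (volume_measurePreserving_sumPiEquivProdPi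
    (fun _ : SymIndex m ⊕ Fin m => ℝ)).lintegral_comp
      (f := fun q : (SymIndex m → ℝ) × (Fin m → ℝ) => ∫⁻ t : ℝ, F (border (symOf m q.1) q.2 t))
      (h2.comp ((hS.comp measurable_fst).prodMk measurable_snd))
  rw [← e1, lintegral_congr e3, e2, Measure.volume_eq_prod, lintegral_prod _ hK.aemeasurable]
  have e5 : ∀ a : SymIndex m ⊕ Fin m → ℝ, ∫⁻ b : Unit → ℝ, K (a, b) = ∫⁻ t : ℝ,
      F (border (symOf m fun p => a (Sum.inl p)) (fun i => a (Sum.inr i)) t) := fun a =>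
    (volume_preserving_funUnique Unit ℝ).lintegral_comp_emb
      (MeasurableEquiv.measurableEmbedding _) fun t =>
        F (border (symOf m fun p => a (Sum.inl p)) (fun i => a (Sum.inr i)) t)
  rw [lintegral_congr e5]
  refine e4.trans ?_
  rw [Measure.volume_eq_prod, lintegral_prod]
  exact (h2.comp ((hS.comp measurable_fst).prodMk measurable_snd)).aemeasurable

/-! ### Gaussian integrals -/

lemma lintegral_exp_neg_norm_sq_pi (m : ℕ) :
    ∫⁻ v : Fin m → ℝ, ENNReal.ofReal (Real.exp (-(v ⬝ᵥ v))) =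
      ENNReal.ofReal (Real.pi ^ ((m : ℝ) / 2)) := by
  have h1 : ∀ v : Fin m → ℝ, Real.exp (-(v ⬝ᵥ v)) = ∏ i, Real.exp (-1 * v i ^ 2) := fun v => by
    rw [← Real.exp_sum]
    congr 1
    simp [dotProduct, sq]
  have h2 : Integrable fun v : Fin m → ℝ => ∏ i, Real.exp (-1 * v i ^ 2) :=
    Integrable.fintype_prod fun _ => integrable_exp_neg_mul_sq one_pos
  simp_rw [h1]
  rw [← ofReal_integral_eq_lintegral_ofReal h2
    (Eventually.of_forall fun v => Finset.prod_nonneg fun i _ => (Real.exp_pos _).le),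
    integral_fintype_prod_volume_eq_prod (fun _ : Fin m => fun x : ℝ => Real.exp (-1 * x ^ 2))]
  simp only [integral_gaussian, div_one, Finset.prod_const, Finset.card_univ, Fintype.card_fin]
  rw [Real.sqrt_eq_rpow, ← Real.rpow_natCast, ← Real.rpow_mul Real.pi_pos.le]
  congr 2
  ring

/-- The linear substitution by r^{-1/2} reduces this to the standard Gaussian; its Jacobian produces
|r|^{1/2}. -/
lemma lintegral_exp_neg_quadratic {r : Matrix (Fin m) (Fin m) ℝ} (hr : r.PosDef) :
    ∫⁻ v : Fin m → ℝ, ENNReal.ofReal (Real.exp (-(v ⬝ᵥ (r⁻¹ *ᵥ v)))) =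
      ENNReal.ofReal (Real.pi ^ ((m : ℝ) / 2) * Real.sqrt r.det) := by
  set s := CFC.sqrt r⁻¹
  have hs : s.PosDef := sqrt_posDef hr.inv
  have h1 : ∀ v : Fin m → ℝ, v ⬝ᵥ (r⁻¹ *ᵥ v) = (s *ᵥ v) ⬝ᵥ (s *ᵥ v) := fun v => by
    rw [← sqrt_mul_sqrt hr.inv.posSemidef, ← Matrix.mulVec_mulVec, Matrix.dotProduct_mulVec,
      ← Matrix.mulVec_transpose, sqrt_transpose]
  have h2 := lintegral_map (μ := (volume : Measure (Fin m → ℝ)))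
    (f := fun v => ENNReal.ofReal (Real.exp (-(v ⬝ᵥ v))))
    (by simp only [dotProduct]; fun_prop)
    ((Matrix.toLin' s).continuous_of_finiteDimensional.measurable)
  rw [Real.map_matrix_volume_pi_eq_smul_volume_pi hs.det_pos.ne', lintegral_smul_measure,
    lintegral_exp_neg_norm_sq_pi, smul_eq_mul, ← ENNReal.ofReal_mul (by positivity)] at h2
  simp_rw [h1]
  simp only [Matrix.toLin'_apply] at h2
  rw [← h2, det_sqrt hr.inv.posSemidef, Matrix.det_nonsing_inv, Ring.inverse_eq_inv',
    Real.sqrt_inv, inv_inv, abs_of_nonneg (Real.sqrt_nonneg _), mul_comm]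

/-- The image under `det` of the measure `exp (- tr r) dr` on the cone. -/
def detMeasure (m : ℕ) : Measure ℝ :=
  Measure.map Matrix.det (((symVolume m).restrict (cone m)).withDensity
    fun r => ENNReal.ofReal (Real.exp (-r.trace)))

instance : SFinite (detMeasure m) := by unfold detMeasure; infer_instance

lemma lintegral_detMeasure {φ : ℝ → ℝ≥0∞} (hφ : Measurable φ) :
    ∫⁻ t, φ t ∂(detMeasure m) = ∫⁻ r in cone m,
      ENNReal.ofReal (Real.exp (-r.trace)) * φ r.det ∂(symVolume m) := by
  rw [detMeasure, lintegral_map hφ measurable_det]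
  exact lintegral_withDensity_eq_lintegral_mul _ (measurable_trace.neg.exp.ennreal_ofReal)
    (hφ.comp measurable_det)

/-- Put t = v'r⁻¹v + τ. Positivity becomes τ > 0, the determinant is |r|τ and the trace is tr r +
v'r⁻¹v + τ. The Gaussian integral over v leaves π^{m/2}|r|^{1/2}, and |r| and τ decouple. This
drives the inductions for both gamma functions. -/
lemma lintegral_detMeasure_succ {φ : ℝ → ℝ≥0∞} (hφ : Measurable φ) :
    ∫⁻ t, φ t ∂(detMeasure (m + 1)) = ENNReal.ofReal (Real.pi ^ ((m : ℝ) / 2)) *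
      ∫⁻ t, (∫⁻ τ in Set.Ioi 0, ENNReal.ofReal (Real.sqrt t * Real.exp (-τ)) * φ (t * τ))
        ∂(detMeasure m) := by
  have hm1 : Measurable fun q : ℝ × ℝ =>
      ENNReal.ofReal (Real.sqrt q.1 * Real.exp (-q.2)) * φ (q.1 * q.2) := by fun_prop
  rw [lintegral_detMeasure hφ, lintegral_detMeasure hm1.lintegral_prod_right',
    ← lintegral_indicator measurableSet_cone, ← lintegral_indicator measurableSet_cone]
  have hm2 : Measurable fun r : Matrix (Fin (m+1)) (Fin (m+1)) ℝ =>
      ENNReal.ofReal (Real.exp (-r.trace)) * φ r.det :=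
    (measurable_trace.neg.exp.ennreal_ofReal).mul (hφ.comp measurable_det)
  rw [lintegral_symVolume_succ (hm2.indicator measurableSet_cone),
    ← lintegral_const_mul' _ _ ENNReal.ofReal_ne_top]
  refine lintegral_congr fun r => ?_
  by_cases hr : r ∈ cone m
  swap
  · rw [Set.indicator_of_notMem hr, mul_zero]
    refine lintegral_eq_zero_of_ae_eq_zero (Eventually.of_forall fun v =>
      lintegral_eq_zero_of_ae_eq_zero (Eventually.of_forall fun t =>
        Set.indicator_of_notMem (s := cone (m + 1)) (fun h => hr (posDef_of_border h)) _))
  rw [Set.indicator_of_mem hr]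
  have hdet : 0 < r.det := Matrix.PosDef.det_pos hr
  have hin : ∀ v : Fin m → ℝ, ∫⁻ t : ℝ, (cone (m + 1)).indicator
      (fun r => ENNReal.ofReal (Real.exp (-r.trace)) * φ r.det) (border r v t) =
      ENNReal.ofReal (Real.exp (-(v ⬝ᵥ (r⁻¹ *ᵥ v)))) * (ENNReal.ofReal (Real.exp (-r.trace)) *
        ∫⁻ τ in Set.Ioi 0, ENNReal.ofReal (Real.exp (-τ)) * φ (r.det * τ)) := by
    intro v
    rw [← lintegral_add_right_eq_self _ (v ⬝ᵥ (r⁻¹ *ᵥ v)), ← lintegral_indicator measurableSet_Ioi,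
      ← lintegral_const_mul' _ _ ENNReal.ofReal_ne_top,
      ← lintegral_const_mul' _ _ ENNReal.ofReal_ne_top]
    refine lintegral_congr fun τ => ?_
    by_cases hτ : 0 < τ
    · rw [Set.indicator_of_mem (by exact (posDef_border_iff hr v _).2 (by linarith)),
        Set.indicator_of_mem (by exact hτ), trace_border, det_border hr, add_sub_cancel_right,
        ← mul_assoc, ← mul_assoc, ← ENNReal.ofReal_mul (by positivity),
        ← ENNReal.ofReal_mul (by positivity), ← Real.exp_add, ← Real.exp_add]
      congr 3
      ring_nf
    · rw [Set.indicator_of_notMem, Set.indicator_of_notMem (by exact hτ), mul_zero, mul_zero]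
      intro h
      have := (posDef_border_iff hr v _).1 h
      exact hτ (by linarith)
  rw [lintegral_congr hin, lintegral_mul_const _ (by
    simp only [dotProduct, Matrix.mulVec]; fun_prop), lintegral_exp_neg_quadratic hr,
    ENNReal.ofReal_mul (by positivity), mul_assoc]
  congr 1
  rw [← mul_assoc, mul_comm (ENNReal.ofReal √r.det), mul_assoc,
    ← lintegral_const_mul' _ _ ENNReal.ofReal_ne_top]
  congr 1
  refine lintegral_congr fun τ => ?_
  rw [← mul_assoc, ← ENNReal.ofReal_mul (Real.sqrt_nonneg _)]

end Border

end

end MatrixWavelet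

namespace MatrixWavelet

noncomputable section

open scoped RealInnerProductSpace Matrix

/-! ### The Siegel gamma function: recursion, finiteness, nonvanishing and matrix parameters. -/

section Gamma

variable {m : ℕ}

/-! ### The Siegel gamma function -/

instance (n m : ℕ) : SecondCountableTopology (Matrix (Fin n) (Fin m) ℝ) :=
  inferInstanceAs (SecondCountableTopology (Fin n → Fin m → ℝ))

lemma measurable_exp_neg_trace :
    Measurable fun r : Matrix (Fin m) (Fin m) ℝ => Real.exp (-r.trace) :=
  Real.measurable_exp.comp measurable_trace.neg

lemma measurable_exp_neg_trace_mul_det_rpow (b : ℝ) :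
    Measurable fun r : Matrix (Fin m) (Fin m) ℝ => Real.exp (-r.trace) * r.det ^ b :=
  measurable_exp_neg_trace.mul (measurable_det.pow_const b)

lemma measurable_ofReal_cpow (s : ℂ) : Measurable fun t : ℝ => (t : ℂ) ^ s :=
  Complex.measurable_ofReal.pow_const s

/-- The gamma integral of the cone at a real argument. -/
def coneGamma (m : ℕ) (b : ℝ) : ℝ≥0∞ :=
  ∫⁻ r, ENNReal.ofReal (Real.exp (-r.trace) * r.det ^ b) ∂(coneMeasure m)

lemma ae_detMeasure_pos : ∀ᵐ t ∂(detMeasure m), 0 < t := by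
  rw [detMeasure, ae_map_iff measurable_det.aemeasurable measurableSet_Ioi]
  refine (withDensity_absolutelyContinuous _ _).ae_le ?_
  filter_upwards [ae_restrict_mem measurableSet_cone] with r hr
  exact Matrix.PosDef.det_pos hr

lemma coneGamma_eq (b : ℝ) :
    coneGamma m b = ∫⁻ t, ENNReal.ofReal (t ^ (b - ((m : ℝ) + 1) / 2)) ∂(detMeasure m) := by
  rw [coneGamma, lintegral_coneMeasure _
    (measurable_exp_neg_trace_mul_det_rpow b).ennreal_ofReal,
    lintegral_detMeasure (by fun_prop), ← lintegral_indicator measurableSet_cone]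
  refine lintegral_congr fun r => congrFun (Set.indicator_congr fun r hr => ?_) r
  have h : 0 < r.det := Matrix.PosDef.det_pos hr
  rw [← ENNReal.ofReal_mul (by positivity), ← ENNReal.ofReal_mul (by positivity),
    mul_left_comm, ← Real.rpow_add h, neg_add_eq_sub]

lemma lintegral_exp_neg_mul_rpow {s : ℝ} (hs : 0 < s) :
    ∫⁻ τ in Set.Ioi (0 : ℝ), ENNReal.ofReal (Real.exp (-τ) * τ ^ (s - 1)) =
      ENNReal.ofReal (Real.Gamma s) := by
  rw [Real.Gamma_eq_integral hs, ofReal_integral_eq_lintegral_ofReal (Real.GammaIntegral_convergent hs)]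
  filter_upwards [ae_restrict_mem measurableSet_Ioi] with τ hτ
  have : 0 < τ := hτ
  positivity

/-- In the recursion for `detMeasure` the variables separate: τ contributes Γ(b - m/2), and √t
adjusts the exponent from size m + 1 to size m. -/
lemma coneGamma_succ {b : ℝ} (hb : (m : ℝ) / 2 < b) :
    coneGamma (m + 1) b = ENNReal.ofReal (Real.pi ^ ((m : ℝ) / 2) * Real.Gamma (b - m / 2)) *
      coneGamma m b := by
  rw [coneGamma_eq, coneGamma_eq, lintegral_detMeasure_succ (by fun_prop),
    ENNReal.ofReal_mul (by positivity), mul_assoc]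
  congr 1
  rw [← lintegral_exp_neg_mul_rpow (by linarith), mul_comm, ← lintegral_mul_const _ (by fun_prop)]
  refine lintegral_congr_ae ?_
  filter_upwards [ae_detMeasure_pos] with t ht
  rw [← lintegral_const_mul _ (by fun_prop)]
  refine setLIntegral_congr_fun measurableSet_Ioi fun τ hτ => ?_
  have hτ : 0 < τ := hτ
  rw [← ENNReal.ofReal_mul (by positivity), ← ENNReal.ofReal_mul (by positivity),
    Real.mul_rpow ht.le hτ.le, Real.sqrt_eq_rpow,
    show b - ((m : ℝ) + 1) / 2 = 1 / 2 + (b - (((m + 1 : ℕ) : ℝ) + 1) / 2) by push_cast; ring,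
    Real.rpow_add ht, show b - m / 2 - 1 = b - (((m + 1 : ℕ) : ℝ) + 1) / 2 by push_cast; ring]
  congr 1
  ring

/-- There is a single 0 × 0 matrix; this is the base of the inductions on m. -/
lemma symVolume_zero : symVolume 0 = Measure.dirac 1 := by
  have : IsEmpty (SymIndex 0) := ⟨fun p => p.1.1.elim0⟩
  rw [symVolume, volume_pi, Measure.pi_of_empty, Measure.map_dirac' continuous_symOf.measurable]
  congr 1
  exact Subsingleton.elim _ _

lemma detMeasure_zero : detMeasure 0 = Measure.dirac 1 := by
  refine Measure.ext_of_lintegral _ fun φ hφ => ?_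
  rw [lintegral_detMeasure hφ, lintegral_dirac' _ hφ, symVolume_zero,
    ← lintegral_indicator measurableSet_cone, lintegral_dirac']
  · rw [Set.indicator_of_mem (show (1 : Matrix (Fin 0) (Fin 0) ℝ) ∈ cone 0 from Matrix.PosDef.one)]
    simp
  · exact (measurable_exp_neg_trace.ennreal_ofReal.mul
      (hφ.comp measurable_det)).indicator measurableSet_cone

lemma coneGamma_pos_lt_top : ∀ (m : ℕ) (b : ℝ), ((m : ℝ) - 1) / 2 < b →
    coneGamma m b ≠ 0 ∧ coneGamma m b ≠ ⊤
  | 0, b, _ => by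
    rw [coneGamma_eq, detMeasure_zero, lintegral_dirac' _ (by fun_prop)]
    simp
  | m + 1, b, hb => by
    have hb' : (m : ℝ) / 2 < b := by push_cast at hb; linarith
    obtain ⟨h1, h2⟩ := coneGamma_pos_lt_top m b (by linarith)
    have : 0 < Real.Gamma (b - m / 2) := Real.Gamma_pos_of_pos (by linarith)
    rw [coneGamma_succ hb']
    exact ⟨mul_ne_zero (by simp; positivity) h1, ENNReal.mul_ne_top ENNReal.ofReal_ne_top h2⟩

/-- Apart from exp(-tr r) the integrand depends on the determinant alone, so the gamma function is a
Mellin transform on the line. -/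
lemma siegelGamma_eq_detMeasure (β : ℂ) :
    siegelGamma m β = ∫ t, (t : ℂ) ^ (β - ((m : ℂ) + 1) / 2) ∂(detMeasure m) := by
  rw [detMeasure, integral_map measurable_det.aemeasurable
      (measurable_ofReal_cpow _).aestronglyMeasurable,
    integral_withDensity_eq_integral_toReal_smul measurable_exp_neg_trace.ennreal_ofReal
      (Eventually.of_forall fun _ => ENNReal.ofReal_lt_top), siegelGamma]
  refine integral_congr_ae (Eventually.of_forall fun r => ?_)
  simp only
  rw [ENNReal.toReal_ofReal (Real.exp_pos _).le, Complex.real_smul]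
  push_cast
  rfl

lemma siegelGamma_eq_coneMeasure (β : ℂ) :
    siegelGamma m β = ∫ r, ((Real.exp (-r.trace) : ℝ) : ℂ) * (r.det : ℂ) ^ β ∂(coneMeasure m) := by
  rw [coneMeasure, integral_withDensity_eq_integral_toReal_smul
    (measurable_det.pow_const _).ennreal_ofReal (Eventually.of_forall fun _ => ENNReal.ofReal_lt_top),
    siegelGamma]
  refine setIntegral_congr_fun measurableSet_cone fun r hr => ?_
  have h : 0 < r.det := Matrix.PosDef.det_pos hr
  rw [ENNReal.toReal_ofReal (by positivity), Complex.real_smul, sub_eq_add_neg,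
    Complex.cpow_add _ _ (by exact_mod_cast h.ne'), Complex.ofReal_cpow h.le]
  push_cast
  ring

lemma detMeasure_succ : detMeasure (m + 1) = ENNReal.ofReal (Real.pi ^ ((m : ℝ) / 2)) •
    Measure.map (fun q : ℝ × ℝ => q.1 * q.2)
      (((detMeasure m).withDensity fun t => ENNReal.ofReal (Real.sqrt t)).prod
        ((volume.restrict (Set.Ioi 0)).withDensity fun τ => ENNReal.ofReal (Real.exp (-τ)))) := by
  refine Measure.ext_of_lintegral _ fun φ hφ => ?_
  rw [lintegral_detMeasure_succ hφ, lintegral_smul_measure, lintegral_map hφ (by fun_prop),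
    lintegral_prod _ (by fun_prop), lintegral_withDensity_eq_lintegral_mul _ (by fun_prop)
      (Measurable.lintegral_prod_right' (f := fun q : ℝ × ℝ => φ (q.1 * q.2)) (by fun_prop)),
    smul_eq_mul]
  congr 1
  refine lintegral_congr fun t => ?_
  rw [Pi.mul_apply, lintegral_withDensity_eq_lintegral_mul _ (by fun_prop) (by fun_prop),
    ← lintegral_const_mul' _ _ ENNReal.ofReal_ne_top]
  refine lintegral_congr fun τ => ?_
  rw [Pi.mul_apply, ← mul_assoc, ← ENNReal.ofReal_mul (Real.sqrt_nonneg _)]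

/-- The law of the determinant in size m + 1 is, up to a constant, a multiplicative convolution, so
its Mellin transform is a product. -/
lemma siegelGamma_succ {β : ℂ} (hβ : (m : ℝ) / 2 < β.re) :
    siegelGamma (m + 1) β = ((Real.pi ^ ((m : ℝ) / 2) : ℝ) : ℂ) * Complex.Gamma (β - m / 2) *
      siegelGamma m β := by
  rw [siegelGamma_eq_detMeasure, siegelGamma_eq_detMeasure, detMeasure_succ, integral_smul_measure,
    integral_map (by fun_prop) (measurable_ofReal_cpow _).aestronglyMeasurable, ENNReal.toReal_ofReal (by positivity),
    Complex.real_smul, mul_assoc]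
  congr 1
  set s : ℂ := β - (((m + 1 : ℕ) : ℂ) + 1) / 2
  have h1 : ∫ q : ℝ × ℝ, ((q.1 * q.2 : ℝ) : ℂ) ^ s
      ∂(((detMeasure m).withDensity fun t => ENNReal.ofReal (Real.sqrt t)).prod
        ((volume.restrict (Set.Ioi 0)).withDensity fun τ => ENNReal.ofReal (Real.exp (-τ)))) =
      ∫ q : ℝ × ℝ, (q.1 : ℂ) ^ s * (q.2 : ℂ) ^ s
      ∂(((detMeasure m).withDensity fun t => ENNReal.ofReal (Real.sqrt t)).prod
        ((volume.restrict (Set.Ioi 0)).withDensity fun τ => ENNReal.ofReal (Real.exp (-τ)))) := by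
    refine integral_congr_ae ?_
    have ha : ∀ᵐ t ∂((detMeasure m).withDensity fun t => ENNReal.ofReal (Real.sqrt t)), 0 < t :=
      (withDensity_absolutelyContinuous _ _).ae_le ae_detMeasure_pos
    have hb : ∀ᵐ τ ∂((volume.restrict (Set.Ioi (0 : ℝ))).withDensity
        fun τ => ENNReal.ofReal (Real.exp (-τ))), 0 < τ :=
      (withDensity_absolutelyContinuous _ _).ae_le (ae_restrict_mem measurableSet_Ioi)
    filter_upwards [Measure.quasiMeasurePreserving_fst.ae ha,
      Measure.quasiMeasurePreserving_snd.ae hb] with q hq hq'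
    rw [Complex.ofReal_mul, Complex.mul_cpow_ofReal_nonneg hq.le hq'.le]
  rw [h1, integral_prod_mul (fun t : ℝ => (t : ℂ) ^ s) (fun t : ℝ => (t : ℂ) ^ s),
    integral_withDensity_eq_integral_toReal_smul (by fun_prop)
      (Eventually.of_forall fun _ => ENNReal.ofReal_lt_top),
    integral_withDensity_eq_integral_toReal_smul (by fun_prop)
      (Eventually.of_forall fun _ => ENNReal.ofReal_lt_top), mul_comm]
  congr 1
  · rw [Complex.Gamma_eq_integral (by simp; linarith), Complex.GammaIntegral]
    refine setIntegral_congr_fun measurableSet_Ioi fun τ hτ => ?_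
    rw [ENNReal.toReal_ofReal (Real.exp_pos _).le, Complex.real_smul,
      show β - m / 2 - 1 = s by simp only [s]; push_cast; ring]
  · refine integral_congr_ae ?_
    filter_upwards [ae_detMeasure_pos] with t ht
    rw [ENNReal.toReal_ofReal (Real.sqrt_nonneg _), Complex.real_smul, Real.sqrt_eq_rpow,
      Complex.ofReal_cpow ht.le, ← Complex.cpow_add _ _ (by exact_mod_cast ht.ne')]
    congr 1
    simp only [s]
    push_cast
    ring

/-- By the recursion the value is a power of π times values of Γ at arguments with positive real
part, where Γ has no zeros. -/
lemma siegelGamma_ne_zero : ∀ (m : ℕ) (β : ℂ), ((m : ℝ) - 1) / 2 < β.re → siegelGamma m β ≠ 0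
  | 0, β, _ => by
    rw [siegelGamma_eq_detMeasure, detMeasure_zero, integral_dirac]
    simp
  | m + 1, β, hβ => by
    have hβ' : (m : ℝ) / 2 < β.re := by push_cast at hβ; linarith
    rw [siegelGamma_succ hβ']
    refine mul_ne_zero (mul_ne_zero ?_ ?_) (siegelGamma_ne_zero m β (by linarith))
    · exact_mod_cast (by positivity : Real.pi ^ ((m : ℝ) / 2) ≠ 0)
    · exact Complex.Gamma_ne_zero_of_re_pos (by simp; linarith)

lemma siegelGamma_ofReal (b : ℝ) : siegelGamma m (b : ℂ) = ((coneGamma m b).toReal : ℂ) := by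
  rw [siegelGamma_eq_coneMeasure, coneGamma, ← integral_eq_lintegral_of_nonneg_ae, ← integral_complex_ofReal]
  · refine integral_congr_ae ?_
    filter_upwards [ae_mem_cone] with r hr
    rw [← Complex.ofReal_cpow (Matrix.PosDef.det_pos hr).le]
    push_cast
    rfl
  · filter_upwards [ae_mem_cone] with r hr
    have := Matrix.PosDef.det_pos hr
    positivity
  · exact (measurable_exp_neg_trace_mul_det_rpow b).aestronglyMeasurable

/-! ### Gamma integrals with a matrix parameter -/

lemma trace_congr_sqrt {s : Matrix (Fin m) (Fin m) ℝ} (hs : s.PosSemidef)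
    (r : Matrix (Fin m) (Fin m) ℝ) :
    (CFC.sqrt s * r * (CFC.sqrt s)ᵀ).trace = (r * s).trace := by
  rw [sqrt_transpose, Matrix.mul_assoc, Matrix.trace_mul_comm, Matrix.mul_assoc, sqrt_mul_sqrt hs]

lemma det_congr_sqrt {s : Matrix (Fin m) (Fin m) ℝ} (hs : s.PosSemidef)
    (r : Matrix (Fin m) (Fin m) ℝ) :
    (CFC.sqrt s * r * (CFC.sqrt s)ᵀ).det = r.det * s.det := by
  rw [sqrt_transpose, Matrix.det_mul, Matrix.det_mul, mul_comm _ r.det, mul_assoc,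
    ← Matrix.det_mul, sqrt_mul_sqrt hs]

/-- The substitution r ↦ s^{1/2} r s^{1/2} preserves d_* and turns tr(rs) into tr r, at the cost of
|s|^{-b}. -/
lemma lintegral_exp_neg_trace_mul {s : Matrix (Fin m) (Fin m) ℝ} (hs : s.PosDef) (b : ℝ) :
    ∫⁻ r, ENNReal.ofReal (Real.exp (-(r * s).trace) * r.det ^ b) ∂(coneMeasure m) =
      coneGamma m b * ENNReal.ofReal (s.det ^ (-b)) := by
  have h := (measurePreserving_congr _ (sqrt_posDef hs).det_pos.ne').lintegral_comp_emb
    (MeasurableEquiv.measurableEmbedding _)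
    fun r => ENNReal.ofReal (Real.exp (-r.trace) * r.det ^ b)
  rw [coneGamma, ← h, ← lintegral_mul_const' _ _ ENNReal.ofReal_ne_top]
  refine lintegral_congr_ae ?_
  filter_upwards [ae_mem_cone] with r hr
  have hr' : 0 < r.det := Matrix.PosDef.det_pos hr
  have hs' := hs.det_pos
  change _ = ENNReal.ofReal (Real.exp (-(CFC.sqrt s * r * (CFC.sqrt s)ᵀ).trace) *
    (CFC.sqrt s * r * (CFC.sqrt s)ᵀ).det ^ b) * _
  rw [trace_congr_sqrt hs.posSemidef, det_congr_sqrt hs.posSemidef,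
    ← ENNReal.ofReal_mul (by positivity), Real.mul_rpow hr'.le hs'.le, mul_assoc, mul_assoc,
    ← Real.rpow_add hs', add_neg_cancel, Real.rpow_zero, mul_one]

lemma integral_exp_neg_trace_mul {s : Matrix (Fin m) (Fin m) ℝ} (hs : s.PosDef) (β : ℂ) :
    ∫ r, ((Real.exp (-(r * s).trace) : ℝ) : ℂ) * (r.det : ℂ) ^ β ∂(coneMeasure m) =
      siegelGamma m β * (s.det : ℂ) ^ (-β) := by
  have h := (measurePreserving_congr _ (sqrt_posDef hs).det_pos.ne').integral_comp
    (MeasurableEquiv.measurableEmbedding _)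
    fun r => ((Real.exp (-r.trace) : ℝ) : ℂ) * (r.det : ℂ) ^ β
  rw [siegelGamma_eq_coneMeasure, ← h, ← integral_mul_const]
  refine integral_congr_ae ?_
  filter_upwards [ae_mem_cone] with r hr
  have hr' : 0 < r.det := Matrix.PosDef.det_pos hr
  have hs' := hs.det_pos
  change _ = ((Real.exp (-(CFC.sqrt s * r * (CFC.sqrt s)ᵀ).trace) : ℝ) : ℂ) *
    ((CFC.sqrt s * r * (CFC.sqrt s)ᵀ).det : ℂ) ^ β * _
  rw [trace_congr_sqrt hs.posSemidef, det_congr_sqrt hs.posSemidef, Complex.ofReal_mul,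
    Complex.mul_cpow_ofReal_nonneg hr'.le hs'.le, mul_assoc, mul_assoc,
    ← Complex.cpow_add _ _ (by exact_mod_cast hs'.ne'), add_neg_cancel, Complex.cpow_zero, mul_one]

lemma trace_mul_comm_one_add (q r : Matrix (Fin m) (Fin m) ℝ) :
    (r * (1 + q)).trace = r.trace + (q * r).trace := by
  rw [Matrix.mul_add, Matrix.mul_one, Matrix.trace_add, Matrix.trace_mul_comm r q]

/-- Convergence of the beta integral of the cone. -/
lemma lintegral_det_rpow_mul_one_add_lt_top (hm : 1 ≤ m) {b c : ℝ} (hb : ((m : ℝ) - 1) / 2 < b)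
    (hc : ((m : ℝ) - 1) / 2 < c - b) :
    ∫⁻ q, ENNReal.ofReal (q.det ^ b * (1 + q).det ^ (-c)) ∂(coneMeasure m) < ⊤ := by
  -- Write |1 + q|^{-c} as a gamma integral over r. After exchanging the integrals, the one over q
  -- is a gamma integral with parameter r. The product form is valid before finiteness is known.
  have key : coneGamma m c * ∫⁻ q, ENNReal.ofReal (q.det ^ b * (1 + q).det ^ (-c))
      ∂(coneMeasure m) = coneGamma m b * coneGamma m (c - b) := by
    have hmeas : Measurable fun p : Matrix (Fin m) (Fin m) ℝ × Matrix (Fin m) (Fin m) ℝ =>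
        ENNReal.ofReal (p.1.det ^ b * (Real.exp (-(p.2 * (1 + p.1)).trace) * p.2.det ^ c)) := by
      refine (Measurable.mul ((measurable_det.comp measurable_fst).pow_const b)
        (Measurable.mul ?_ ((measurable_det.comp measurable_snd).pow_const c))).ennreal_ofReal
      exact ((continuous_snd.matrix_mul
        (continuous_const.add continuous_fst)).matrix_trace).neg.rexp.measurable
    have h1 : ∀ᵐ q ∂(coneMeasure m), coneGamma m c *
        ENNReal.ofReal (q.det ^ b * (1 + q).det ^ (-c)) = ∫⁻ r, ENNReal.ofReal
          (q.det ^ b * (Real.exp (-(r * (1 + q)).trace) * r.det ^ c)) ∂(coneMeasure m) := by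
      filter_upwards [ae_mem_cone] with q hq
      have hq' : 0 < q.det := Matrix.PosDef.det_pos hq
      have h1q : (1 + q).PosDef := Matrix.PosDef.one.add hq
      rw [ENNReal.ofReal_mul (by positivity), mul_left_comm, ← lintegral_exp_neg_trace_mul h1q,
        ← lintegral_const_mul' _ _ ENNReal.ofReal_ne_top]
      refine lintegral_congr fun r => ?_
      rw [← ENNReal.ofReal_mul (by positivity)]
    rw [← lintegral_const_mul'' _ (by
        refine (Measurable.mul (measurable_det.pow_const b) ?_).ennreal_ofReal.aemeasurable
        exact ((continuous_const.add continuous_id).matrix_det.measurable).pow_const _),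
      lintegral_congr_ae h1, lintegral_lintegral_swap hmeas.aemeasurable]
    rw [coneGamma.eq_def m (c - b), ← lintegral_const_mul _
      (measurable_exp_neg_trace_mul_det_rpow _).ennreal_ofReal]
    refine lintegral_congr_ae ?_
    filter_upwards [ae_mem_cone] with r hr
    have hr' : 0 < r.det := Matrix.PosDef.det_pos hr
    have h2 : ∀ᵐ q ∂(coneMeasure m), ENNReal.ofReal
        (q.det ^ b * (Real.exp (-(r * (1 + q)).trace) * r.det ^ c)) =
        ENNReal.ofReal (Real.exp (-r.trace) * r.det ^ c) *
          ENNReal.ofReal (Real.exp (-(q * r).trace) * q.det ^ b) := by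
      filter_upwards with q
      rw [← ENNReal.ofReal_mul (by positivity), trace_mul_comm_one_add, neg_add, Real.exp_add]
      congr 1
      ring
    rw [lintegral_congr_ae h2, lintegral_const_mul' _ _ ENNReal.ofReal_ne_top,
      lintegral_exp_neg_trace_mul hr, mul_left_comm, ← ENNReal.ofReal_mul (by positivity),
      mul_assoc, ← Real.rpow_add hr', sub_eq_add_neg]
  have h1 := coneGamma_pos_lt_top m b hb
  have h2 := coneGamma_pos_lt_top m (c - b) hc
  -- For m ≥ 1 the two hypotheses give c > m - 1 ≥ (m - 1)/2, so the gamma integral at c is finite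
  -- and nonzero.
  have h1m : (1 : ℝ) ≤ m := by exact_mod_cast hm
  have h3 := coneGamma_pos_lt_top m c (by linarith)
  refine lt_top_iff_ne_top.2 fun htop => ?_
  rw [htop, ENNReal.mul_top h3.1] at key
  exact ENNReal.mul_ne_top h1.2 h2.2 key.symm

end Gamma

end

end MatrixWavelet

namespace MatrixWavelet

noncomputable section

open scoped RealInnerProductSpace Matrix

/-! ### Uniqueness of the invariant measure on the cone, inversion, and polar coordinates. -/

section Polar

variable {m n : ℕ}

/-! ### Uniqueness of the invariant measure and polar coordinates -/

lemma measurable_matrix_inv :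
    Measurable fun r : Matrix (Fin m) (Fin m) ℝ => r⁻¹ := by
  have h : (fun r : Matrix (Fin m) (Fin m) ℝ => r⁻¹) = fun r => r.det⁻¹ • r.adjugate := by
    ext1 r
    rw [Matrix.inv_def, Ring.inverse_eq_inv']
  rw [h]
  refine measurable_pi_lambda _ fun i => measurable_pi_lambda _ fun j => ?_
  exact (measurable_det.inv).mul ((continuous_id.matrix_adjugate.matrix_elem i j).measurable)

/-- Invariance of a measure under all congruences `r ↦ g r g'`. -/
def CongrInvariant (μ : Measure (Matrix (Fin m) (Fin m) ℝ)) : Prop :=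
  ∀ g : Matrix (Fin m) (Fin m) ℝ, g.det ≠ 0 → ∀ F : Matrix (Fin m) (Fin m) ℝ → ℝ≥0∞,
    Measurable F → ∫⁻ r, F (g * r * gᵀ) ∂μ = ∫⁻ r, F r ∂μ

lemma congrInvariant_coneMeasure : CongrInvariant (coneMeasure m) := fun g hg _ hF =>
  (measurePreserving_congr g hg).lintegral_comp hF

/-- The density of the Haar measure of the general linear group. -/
def groupDensity (m : ℕ) (g : MatSpace m m) : ℝ≥0∞ := ENNReal.ofReal (|(toMat g).det|⁻¹ ^ m)

/-- Integration of `φ(g g')` against the Haar measure of the general linear group. -/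
def groupIntegral (m : ℕ) (φ : Matrix (Fin m) (Fin m) ℝ → ℝ≥0∞) : ℝ≥0∞ :=
  ∫⁻ g : MatSpace m m, φ (toMat g * (toMat g)ᵀ) * groupDensity m g

lemma matAbs_eq_abs_det (g : MatSpace m m) : matAbs g = |(toMat g).det| := by
  rw [matAbs, gram, Matrix.det_mul, Matrix.det_transpose, Real.sqrt_mul_self_eq_abs]

lemma ae_det_ne_zero : ∀ᵐ g : MatSpace m m, (toMat g).det ≠ 0 := by
  filter_upwards [ae_matAbs_ne_zero (le_refl m)] with g hg
  simpa [matAbs_eq_abs_det] using hg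

lemma measurable_groupDensity : Measurable (groupDensity m) :=
  (((continuous_toMat.matrix_det).measurable.norm.inv).pow_const m).ennreal_ofReal

lemma groupDensity_mulRight {k : Matrix (Fin m) (Fin m) ℝ} (hk : k.det ≠ 0) (g : MatSpace m m) :
    groupDensity m g = ENNReal.ofReal (|k.det| ^ m) * groupDensity m (mulRight m k g) := by
  have : 0 < |k.det| := abs_pos.2 hk
  rw [groupDensity, groupDensity, ← ENNReal.ofReal_mul (by positivity), toMat_mulRight,
    Matrix.det_mul, abs_mul, ← mul_pow]
  congr 2
  field_simp

/-- The substitution h = g r^{1/2} preserves the Haar measure |det g|^{-m} dg, and it gives g r g' =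
hh' and gg' = h r⁻¹ h'. -/
lemma lintegral_group_swap {r : Matrix (Fin m) (Fin m) ℝ} (hr : r.PosDef)
    (φ H : Matrix (Fin m) (Fin m) ℝ → ℝ≥0∞) :
    ∫⁻ g : MatSpace m m, H (toMat g * (toMat g)ᵀ) * groupDensity m g *
      φ (toMat g * r * (toMat g)ᵀ) =
    ∫⁻ g : MatSpace m m, φ (toMat g * (toMat g)ᵀ) * groupDensity m g *
      H (toMat g * r⁻¹ * (toMat g)ᵀ) := by
  obtain ⟨k, hk, hkk, hkT⟩ : ∃ k : Matrix (Fin m) (Fin m) ℝ, k.det ≠ 0 ∧ k * k = r ∧ kᵀ = k :=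
    ⟨CFC.sqrt r, (sqrt_posDef hr).det_pos.ne', sqrt_mul_sqrt hr.posSemidef, sqrt_transpose r⟩
  have hku : IsUnit k.det := isUnit_iff_ne_zero.2 hk
  have h1 := lintegral_mulRight (n := m) k hk fun g =>
    φ (toMat g * (toMat g)ᵀ) * groupDensity m g * H (toMat g * r⁻¹ * (toMat g)ᵀ)
  have h2 : ∀ g : MatSpace m m, H (toMat g * (toMat g)ᵀ) * groupDensity m g *
      φ (toMat g * r * (toMat g)ᵀ) = ENNReal.ofReal (|k.det| ^ m) *
      (φ (toMat (mulRight m k g) * (toMat (mulRight m k g))ᵀ) * groupDensity m (mulRight m k g) *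
      H (toMat (mulRight m k g) * r⁻¹ * (toMat (mulRight m k g))ᵀ)) := by
    intro g
    have e1 : toMat g * k * (toMat g * k)ᵀ = toMat g * r * (toMat g)ᵀ := by
      rw [Matrix.transpose_mul, hkT, ← hkk]; simp only [Matrix.mul_assoc]
    have e2 : toMat g * k * r⁻¹ * (toMat g * k)ᵀ = toMat g * (toMat g)ᵀ := by
      rw [Matrix.transpose_mul, hkT, ← hkk, Matrix.mul_inv_rev]
      calc _ = toMat g * (k * k⁻¹) * (k⁻¹ * k) * (toMat g)ᵀ := by
            simp only [Matrix.mul_assoc]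
        _ = _ := by
            rw [Matrix.mul_nonsing_inv _ hku, Matrix.nonsing_inv_mul _ hku,
              Matrix.mul_one, Matrix.mul_one]
    rw [groupDensity_mulRight hk g, toMat_mulRight, e1, e2]
    ring
  rw [lintegral_congr h2, lintegral_const_mul' _ _ ENNReal.ofReal_ne_top, h1, ← mul_assoc,
    ← ENNReal.ofReal_mul (by positivity), ← mul_pow, mul_inv_cancel₀ (abs_pos.2 hk).ne', one_pow,
    ENNReal.ofReal_one, one_mul]

/-- Here g r⁻¹ g' is the inverse of the congruence of r by (g')⁻¹. -/
lemma CongrInvariant.lintegral_inv {μ : Measure (Matrix (Fin m) (Fin m) ℝ)}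
    (hinv : CongrInvariant μ) {g : Matrix (Fin m) (Fin m) ℝ} (hg : g.det ≠ 0)
    {H : Matrix (Fin m) (Fin m) ℝ → ℝ≥0∞} (hH : Measurable H) :
    ∫⁻ r, H (g * r⁻¹ * gᵀ) ∂μ = ∫⁻ r, H r⁻¹ ∂μ := by
  have hg' : (gᵀ)⁻¹.det ≠ 0 := by
    rw [Matrix.det_nonsing_inv, Matrix.det_transpose, Ring.inverse_eq_inv']
    exact inv_ne_zero hg
  rw [← hinv _ hg' (fun r => H r⁻¹) (hH.comp measurable_matrix_inv)]
  refine lintegral_congr fun r => ?_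
  congr 1
  have hT : (gᵀ)⁻¹ᵀ = g⁻¹ := by rw [Matrix.transpose_nonsing_inv, Matrix.transpose_transpose]
  rw [Matrix.mul_inv_rev, Matrix.mul_inv_rev, hT, Matrix.nonsing_inv_nonsing_inv _
    (isUnit_iff_ne_zero.2 hg), Matrix.nonsing_inv_nonsing_inv _
    (by rw [Matrix.det_transpose]; exact isUnit_iff_ne_zero.2 hg), Matrix.mul_assoc]

lemma measurable_groupIntegrand {φ H : Matrix (Fin m) (Fin m) ℝ → ℝ≥0∞} (hφ : Measurable φ)
    (hH : Measurable H)
    {G : MatSpace m m × Matrix (Fin m) (Fin m) ℝ → Matrix (Fin m) (Fin m) ℝ} (hG : Measurable G) :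
    Measurable fun p : MatSpace m m × Matrix (Fin m) (Fin m) ℝ =>
      φ (toMat p.1 * (toMat p.1)ᵀ) * groupDensity m p.1 * H (G p) := by
  have hgg : Measurable fun g : MatSpace m m => toMat g * (toMat g)ᵀ :=
    (continuous_toMat.matrix_mul continuous_toMat.matrix_transpose).measurable
  have h1 : Measurable fun p : MatSpace m m × Matrix (Fin m) (Fin m) ℝ =>
    φ (toMat p.1 * (toMat p.1)ᵀ) := hφ.comp (hgg.comp measurable_fst)
  have h2 : Measurable fun p : MatSpace m m × Matrix (Fin m) (Fin m) ℝ =>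
    groupDensity m p.1 := measurable_groupDensity.comp measurable_fst
  exact (h1.mul h2).mul (hH.comp hG)

lemma measurable_congr_uncurry : Measurable fun p : MatSpace m m × Matrix (Fin m) (Fin m) ℝ =>
    toMat p.1 * p.2 * (toMat p.1)ᵀ := by
  have h1 : Continuous fun p : MatSpace m m × Matrix (Fin m) (Fin m) ℝ => toMat p.1 :=
    continuous_toMat.comp continuous_fst
  have h2 : Continuous fun p : MatSpace m m × Matrix (Fin m) (Fin m) ℝ =>
    toMat p.1 * p.2 * (toMat p.1)ᵀ := (h1.matrix_mul continuous_snd).matrix_mul h1.matrix_transpose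
  exact h2.measurable

lemma measurable_congr (g : Matrix (Fin m) (Fin m) ℝ) :
    Measurable fun r : Matrix (Fin m) (Fin m) ℝ => g * r * gᵀ :=
  ((continuous_const.matrix_mul continuous_id).matrix_mul continuous_const).measurable

lemma measurable_congr_inv (g : Matrix (Fin m) (Fin m) ℝ) :
    Measurable fun r : Matrix (Fin m) (Fin m) ℝ => g * r⁻¹ * gᵀ := by
  have := (measurable_congr g).comp (measurable_matrix_inv (m := m))
  simpa only [Function.comp_def] using this

lemma measurable_congr_inv_uncurry : Measurable fun p : MatSpace m m × Matrix (Fin m) (Fin m) ℝ =>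
    toMat p.1 * p.2⁻¹ * (toMat p.1)ᵀ := by
  have h1 : Measurable fun p : MatSpace m m × Matrix (Fin m) (Fin m) ℝ => (p.1, p.2⁻¹) :=
    measurable_fst.prodMk (measurable_matrix_inv.comp measurable_snd)
  have h2 := (measurable_congr_uncurry (m := m)).comp h1
  simpa only [Function.comp_def] using h2

/-- Weil's uniqueness argument. Integrate H(gg') φ(g r g') over the group and the cone. Invariance
in r removes g from φ; if the substitution in g is made first, invariance removes g from H instead.
-/
lemma lintegral_mul_groupIntegral {μ : Measure (Matrix (Fin m) (Fin m) ℝ)} [SFinite μ]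
    (hμ : ∀ᵐ r ∂μ, r ∈ cone m) (hinv : CongrInvariant μ)
    {φ H : Matrix (Fin m) (Fin m) ℝ → ℝ≥0∞} (hφ : Measurable φ) (hH : Measurable H) :
    (∫⁻ r, φ r ∂μ) * groupIntegral m H = groupIntegral m φ * ∫⁻ r, H r⁻¹ ∂μ := by
  have hD := measurable_groupDensity (m := m)
  have hgg : Measurable fun g : MatSpace m m => toMat g * (toMat g)ᵀ :=
    (continuous_toMat.matrix_mul continuous_toMat.matrix_transpose).measurable
  have hcongr := measurable_congr_uncurry (m := m)
  have hcongr' := measurable_congr_inv_uncurry (m := m)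
  have m1 := measurable_groupIntegrand hH hφ (G := fun p => toMat p.1 * p.2 * (toMat p.1)ᵀ) hcongr
  have m2 := measurable_groupIntegrand hφ hH (G := fun p => toMat p.1 * p.2⁻¹ * (toMat p.1)ᵀ) hcongr'
  have e1 : (∫⁻ r, φ r ∂μ) * groupIntegral m H = ∫⁻ g : MatSpace m m, ∫⁻ r,
      H (toMat g * (toMat g)ᵀ) * groupDensity m g * φ (toMat g * r * (toMat g)ᵀ) ∂μ := by
    have h0 : Measurable fun g : MatSpace m m => H (toMat g * (toMat g)ᵀ) * groupDensity m g :=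
      (hH.comp hgg).mul hD
    rw [groupIntegral, mul_comm, ← lintegral_mul_const _ h0]
    refine lintegral_congr_ae ?_
    filter_upwards [ae_det_ne_zero] with g hg
    have h3 : Measurable fun r => φ (toMat g * r * (toMat g)ᵀ) :=
      hφ.comp (measurable_congr (toMat g))
    rw [lintegral_const_mul _ h3, hinv _ hg _ hφ]
  have e2 : groupIntegral m φ * ∫⁻ r, H r⁻¹ ∂μ = ∫⁻ g : MatSpace m m, ∫⁻ r,
      φ (toMat g * (toMat g)ᵀ) * groupDensity m g * H (toMat g * r⁻¹ * (toMat g)ᵀ) ∂μ := by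
    have h0 : Measurable fun g : MatSpace m m => φ (toMat g * (toMat g)ᵀ) * groupDensity m g :=
      (hφ.comp hgg).mul hD
    rw [groupIntegral, ← lintegral_mul_const _ h0]
    refine lintegral_congr_ae ?_
    filter_upwards [ae_det_ne_zero] with g hg
    have h3 : Measurable fun r => H (toMat g * r⁻¹ * (toMat g)ᵀ) :=
      hH.comp (measurable_congr_inv (toMat g))
    rw [lintegral_const_mul _ h3, hinv.lintegral_inv hg hH]
  rw [e1, e2]
  refine (lintegral_lintegral_swap m1.aemeasurable).trans
    (Eq.trans ?_ (lintegral_lintegral_swap m2.aemeasurable).symm)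
  exact lintegral_congr_ae (hμ.mono fun r hr => lintegral_group_swap hr φ H)

lemma lintegral_exp_neg_norm_sq (n m : ℕ) :
    ∫⁻ x : MatSpace n m, ENNReal.ofReal (Real.exp (-‖x‖ ^ 2)) =
      ENNReal.ofReal (Real.pi ^ ((n : ℝ) * m / 2)) := by
  have h := GaussianFourier.integral_rexp_neg_mul_sq_norm (V := MatSpace n m) one_pos
  simp only [neg_mul, one_mul, div_one] at h
  rw [← ofReal_integral_eq_lintegral_ofReal, h]
  · congr 2
    simp
  · by_contra hc
    rw [integral_undef hc] at h
    have : 0 < Real.pi ^ ((Module.finrank ℝ (MatSpace n m) : ℝ) / 2) := by positivity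
    exact this.ne h
  · exact Eventually.of_forall fun _ => (Real.exp_pos _).le

/-- The power |r|^{m/2} cancels the Haar density and leaves a Gaussian integral over square
matrices. This provides a test function whose integral is neither 0 nor ∞. -/
lemma groupIntegral_gaussian :
    groupIntegral m (fun r => ENNReal.ofReal (Real.exp (-r.trace) * r.det ^ ((m : ℝ) / 2))) =
      ENNReal.ofReal (Real.pi ^ ((m : ℝ) * m / 2)) := by
  rw [← lintegral_exp_neg_norm_sq, groupIntegral]
  refine lintegral_congr_ae ?_
  filter_upwards [ae_det_ne_zero] with g hg
  have h0 : 0 < |(toMat g).det| := abs_pos.2 hg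
  have h1 : (toMat g * (toMat g)ᵀ).det = |(toMat g).det| ^ (2 : ℝ) := by
    rw [Matrix.det_mul, Matrix.det_transpose, Real.rpow_two, sq_abs, sq]
  rw [groupDensity, h1, ← Real.rpow_mul h0.le, mul_div_cancel₀ _ two_ne_zero, Real.rpow_natCast,
    ← ENNReal.ofReal_mul (by positivity), mul_assoc, ← mul_pow, mul_inv_cancel₀ h0.ne', one_pow,
    mul_one, Matrix.trace_mul_comm, norm_sq_eq_trace_gram, gram]

lemma lintegral_eq_const_mul_groupIntegral {μ : Measure (Matrix (Fin m) (Fin m) ℝ)} [SFinite μ]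
    (hμ : ∀ᵐ r ∂μ, r ∈ cone m) (hinv : CongrInvariant μ) :
    ∃ c : ℝ≥0∞, ∀ φ : Matrix (Fin m) (Fin m) ℝ → ℝ≥0∞, Measurable φ →
      ∫⁻ r, φ r ∂μ = c * groupIntegral m φ := by
  have hpos : 0 < Real.pi ^ ((m : ℝ) * m / 2) := by positivity
  have h0 : ENNReal.ofReal (Real.pi ^ ((m : ℝ) * m / 2)) ≠ 0 := by simpa using hpos
  refine ⟨(∫⁻ r, ENNReal.ofReal (Real.exp (-(r⁻¹).trace) * (r⁻¹).det ^ ((m : ℝ) / 2)) ∂μ) /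
    ENNReal.ofReal (Real.pi ^ ((m : ℝ) * m / 2)), fun φ hφ => ?_⟩
  have h := lintegral_mul_groupIntegral hμ hinv hφ
    (measurable_exp_neg_trace_mul_det_rpow ((m : ℝ) / 2)).ennreal_ofReal
  rw [groupIntegral_gaussian] at h
  rw [mul_comm, ← mul_div_assoc, ← h, ENNReal.mul_div_cancel_right h0 ENNReal.ofReal_ne_top]

/-- Both measures are multiples of one functional. The symmetric form avoids division by a constant
that could be 0 or ∞. -/
lemma lintegral_mul_lintegral_comm {μ ν : Measure (Matrix (Fin m) (Fin m) ℝ)} [SFinite μ]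
    [SFinite ν] (hμ : ∀ᵐ r ∂μ, r ∈ cone m) (hinv : CongrInvariant μ)
    (hν : ∀ᵐ r ∂ν, r ∈ cone m) (hinvν : CongrInvariant ν)
    {φ ψ : Matrix (Fin m) (Fin m) ℝ → ℝ≥0∞} (hφ : Measurable φ) (hψ : Measurable ψ) :
    (∫⁻ r, φ r ∂μ) * ∫⁻ r, ψ r ∂ν = (∫⁻ r, φ r ∂ν) * ∫⁻ r, ψ r ∂μ := by
  obtain ⟨c, hc⟩ := lintegral_eq_const_mul_groupIntegral hμ hinv
  obtain ⟨d, hd⟩ := lintegral_eq_const_mul_groupIntegral hν hinvν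
  rw [hc φ hφ, hd ψ hψ, hd φ hφ, hc ψ hψ]
  ring

/-- The invariant measure on the cone is invariant under inversion. -/
lemma lintegral_coneMeasure_inv {H : Matrix (Fin m) (Fin m) ℝ → ℝ≥0∞} (hH : Measurable H) :
    ∫⁻ r, H r⁻¹ ∂(coneMeasure m) = ∫⁻ r, H r ∂(coneMeasure m) := by
  obtain ⟨c, hc⟩ := lintegral_eq_const_mul_groupIntegral (m := m) ae_mem_cone
    congrInvariant_coneMeasure
  -- The exponent m exceeds (m - 1)/2, so this test function has a finite nonzero integral, and the
  -- final identity may be divided by it.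
  have hφ := (measurable_exp_neg_trace_mul_det_rpow (m := m) (m : ℝ)).ennreal_ofReal
  have h := lintegral_mul_groupIntegral ae_mem_cone congrInvariant_coneMeasure hφ hH
  obtain ⟨h0, h1⟩ := coneGamma_pos_lt_top m m (by have : (0 : ℝ) ≤ m := by positivity
                                                  linarith)
  have h2 : coneGamma m m * ∫⁻ r, H r⁻¹ ∂(coneMeasure m) =
      coneGamma m m * ∫⁻ r, H r ∂(coneMeasure m) := by
    rw [hc H hH, mul_left_comm, coneGamma, h, ← mul_assoc, ← hc _ hφ]
  exact (ENNReal.mul_right_inj h0 h1).1 h2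

/-- The image of `|x|^{-n} dx` under `x ↦ x'x`. -/
def gramMeasure (n m : ℕ) : Measure (Matrix (Fin m) (Fin m) ℝ) :=
  Measure.map gram ((volume : Measure (MatSpace n m)).withDensity
    fun x => ENNReal.ofReal ((matAbs x)⁻¹ ^ n))

instance : SFinite (gramMeasure n m) := by unfold gramMeasure; infer_instance

lemma lintegral_gramMeasure {F : Matrix (Fin m) (Fin m) ℝ → ℝ≥0∞} (hF : Measurable F) :
    ∫⁻ r, F r ∂(gramMeasure n m) =
      ∫⁻ x : MatSpace n m, ENNReal.ofReal ((matAbs x)⁻¹ ^ n) * F (gram x) := by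
  rw [gramMeasure, lintegral_map hF continuous_gram.measurable]
  exact lintegral_withDensity_eq_lintegral_mul _
    ((continuous_matAbs.measurable.inv.pow_const n).ennreal_ofReal)
    (hF.comp continuous_gram.measurable)

lemma ae_gramMeasure_mem_cone (hnm : m ≤ n) : ∀ᵐ r ∂(gramMeasure n m), r ∈ cone m := by
  rw [gramMeasure]
  refine (ae_map_iff continuous_gram.measurable.aemeasurable measurableSet_cone).2 ?_
  refine (withDensity_absolutelyContinuous _ _).ae_le ?_
  filter_upwards [ae_matAbs_ne_zero hnm] with x hx
  exact (gram_posDef_iff x).2 hx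

/-- Replacing x by x g' turns x'x into g x'x g', and |x|_m^{-n} dx is invariant under invertible
right factors. -/
lemma congrInvariant_gramMeasure : CongrInvariant (gramMeasure n m) := by
  intro g hg F hF
  have hc : Measurable fun r : Matrix (Fin m) (Fin m) ℝ => g * r * gᵀ :=
    ((continuous_const.matrix_mul continuous_id).matrix_mul continuous_const).measurable
  have hgT : gᵀ.det ≠ 0 := by rwa [Matrix.det_transpose]
  rw [lintegral_gramMeasure (F := fun r => F (g * r * gᵀ)) (hF.comp hc), lintegral_gramMeasure hF]
  have h1 := lintegral_mulRight (n := n) gᵀ hgT fun x =>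
    ENNReal.ofReal ((matAbs x)⁻¹ ^ n) * F (gram x)
  have h0 : 0 < |g.det| := abs_pos.2 hg
  have h2 : ∀ x : MatSpace n m, ENNReal.ofReal ((matAbs x)⁻¹ ^ n) * F (g * gram x * gᵀ) =
      ENNReal.ofReal (|g.det| ^ n) * (ENNReal.ofReal ((matAbs (mulRight n gᵀ x))⁻¹ ^ n) *
        F (gram (mulRight n gᵀ x))) := by
    intro x
    rw [← mul_assoc, ← ENNReal.ofReal_mul (by positivity), gram_mulRight, Matrix.transpose_transpose,
      matAbs_mulRight, Matrix.det_transpose, ← mul_pow, mul_inv, mul_inv_cancel_left₀ h0.ne']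
  rw [lintegral_congr h2, lintegral_const_mul' _ _ ENNReal.ofReal_ne_top, h1,
    Matrix.det_transpose, ← mul_assoc, ← ENNReal.ofReal_mul (by positivity), ← mul_pow,
    mul_inv_cancel₀ h0.ne', one_pow, ENNReal.ofReal_one, one_mul]

/-- The constant of the polar coordinates `x ↦ x'x`. -/
def polarConst (n m : ℕ) : ℝ≥0∞ :=
  ENNReal.ofReal (Real.pi ^ ((n : ℝ) * m / 2)) / coneGamma m ((n : ℝ) / 2)

lemma half_gt_of_le (hnm : m ≤ n) : ((m : ℝ) - 1) / 2 < (n : ℝ) / 2 := by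
  have : (m : ℝ) ≤ n := by exact_mod_cast hnm
  linarith

lemma polarConst_ne_zero (hnm : m ≤ n) : polarConst n m ≠ 0 := by
  have hpos : 0 < Real.pi ^ ((n : ℝ) * m / 2) := by positivity
  exact ENNReal.div_ne_zero.2 ⟨by simpa using hpos,
    (coneGamma_pos_lt_top m _ (half_gt_of_le hnm)).2⟩

lemma polarConst_ne_top (hnm : m ≤ n) : polarConst n m ≠ ⊤ :=
  ENNReal.div_ne_top ENNReal.ofReal_ne_top (coneGamma_pos_lt_top m _ (half_gt_of_le hnm)).1

lemma matAbs_pow_eq (x : MatSpace n m) : (gram x).det ^ ((n : ℝ) / 2) = matAbs x ^ n := by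
  rw [← matAbs_sq, ← Real.rpow_natCast, ← Real.rpow_mul (matAbs_nonneg x), Nat.cast_two,
    mul_div_cancel₀ _ two_ne_zero, Real.rpow_natCast]

/-- Polar coordinates on matrix space. -/
lemma lintegral_gram (hnm : m ≤ n) {F : Matrix (Fin m) (Fin m) ℝ → ℝ≥0∞} (hF : Measurable F) :
    ∫⁻ x : MatSpace n m, F (gram x) = polarConst n m *
      ∫⁻ r, ENNReal.ofReal (r.det ^ ((n : ℝ) / 2)) * F r ∂(coneMeasure m) := by
  have key : ∀ F : Matrix (Fin m) (Fin m) ℝ → ℝ≥0∞, Measurable F →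
      ∫⁻ r, ENNReal.ofReal (r.det ^ ((n : ℝ) / 2)) * F r ∂(gramMeasure n m) =
        ∫⁻ x : MatSpace n m, F (gram x) := by
    intro F hF
    refine (lintegral_gramMeasure ((measurable_det.pow_const _).ennreal_ofReal.mul hF)).trans ?_
    refine lintegral_congr_ae ?_
    filter_upwards [ae_matAbs_ne_zero hnm] with x hx
    rw [Pi.mul_apply, ← mul_assoc, ← ENNReal.ofReal_mul (pow_nonneg (inv_nonneg.2 (matAbs_nonneg x)) n),
      matAbs_pow_eq, ← mul_pow, inv_mul_cancel₀ hx, one_pow, ENNReal.ofReal_one, one_mul]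
  -- The image of |x|_m^{-n} dx is proportional to d_*. The constant is found by testing on
  -- |r|^{n/2} e^{-tr r}, whose integrals are π^{nm/2} and Γ_m(n/2).
  have h := lintegral_mul_lintegral_comm (ae_gramMeasure_mem_cone hnm) congrInvariant_gramMeasure
    ae_mem_cone congrInvariant_coneMeasure ((measurable_det.pow_const ((n : ℝ) / 2)).ennreal_ofReal.mul hF)
    ((measurable_det.pow_const ((n : ℝ) / 2)).ennreal_ofReal.mul
      measurable_exp_neg_trace.ennreal_ofReal)
  simp only [Pi.mul_apply] at h
  rw [key F hF, key _ measurable_exp_neg_trace.ennreal_ofReal] at h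
  simp only [← norm_sq_eq_trace_gram] at h
  have hG : ∫⁻ r, ENNReal.ofReal (r.det ^ ((n : ℝ) / 2)) * ENNReal.ofReal (Real.exp (-r.trace))
      ∂(coneMeasure m) = coneGamma m ((n : ℝ) / 2) := by
    refine lintegral_congr fun r => ?_
    rw [mul_comm, ENNReal.ofReal_mul (Real.exp_pos _).le]
  rw [hG, lintegral_exp_neg_norm_sq] at h
  obtain ⟨h0, h1⟩ := coneGamma_pos_lt_top m _ (half_gt_of_le hnm)
  rw [polarConst, mul_comm (_ / _), ← mul_div_assoc, ← h, ENNReal.mul_div_cancel_right h0 h1]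

lemma map_gram_volume (hnm : m ≤ n) : Measure.map gram (volume : Measure (MatSpace n m)) =
    polarConst n m • (coneMeasure m).withDensity
      fun r => ENNReal.ofReal (r.det ^ ((n : ℝ) / 2)) := by
  refine Measure.ext_of_lintegral _ fun F hF => ?_
  rw [lintegral_map hF continuous_gram.measurable, lintegral_gram hnm hF, lintegral_smul_measure,
    lintegral_withDensity_eq_lintegral_mul _ (measurable_det.pow_const _).ennreal_ofReal hF]
  rfl

lemma integral_gram (hnm : m ≤ n) {F : Matrix (Fin m) (Fin m) ℝ → ℂ} (hF : Measurable F) :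
    ∫ x : MatSpace n m, F (gram x) = (polarConst n m).toReal *
      ∫ r, ((r.det ^ ((n : ℝ) / 2) : ℝ) : ℂ) * F r ∂(coneMeasure m) := by
  rw [← integral_map continuous_gram.measurable.aemeasurable hF.aestronglyMeasurable,
    map_gram_volume hnm, integral_smul_measure, Complex.real_smul,
    integral_withDensity_eq_integral_toReal_smul (measurable_det.pow_const _).ennreal_ofReal
      (Eventually.of_forall fun _ => ENNReal.ofReal_lt_top)]
  congr 1
  refine integral_congr_ae ?_
  filter_upwards [ae_mem_cone] with r hr
  rw [ENNReal.toReal_ofReal (Real.rpow_nonneg (Matrix.PosDef.det_pos hr).le _), Complex.real_smul]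

lemma map_inv_coneMeasure : Measure.map (fun r => r⁻¹) (coneMeasure m) = coneMeasure m :=
  Measure.ext_of_lintegral _ fun F hF => by
    rw [lintegral_map hF measurable_matrix_inv, lintegral_coneMeasure_inv hF]

lemma integral_coneMeasure_inv {F : Matrix (Fin m) (Fin m) ℝ → ℂ} (hF : Measurable F) :
    ∫ r, F r⁻¹ ∂(coneMeasure m) = ∫ r, F r ∂(coneMeasure m) := by
  conv_rhs => rw [← map_inv_coneMeasure]
  rw [integral_map measurable_matrix_inv.aemeasurable hF.aestronglyMeasurable]

end Polar

end

end MatrixWavelet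

namespace MatrixWavelet

noncomputable section

open scoped RealInnerProductSpace Matrix

/-! ### Gaussian measures on matrix space. -/

section Gauss

variable {n m l : ℕ}

/-! ### Gaussian measures on matrix space -/

lemma trace_gram_mul (x : MatSpace n m) {A : Matrix (Fin m) (Fin m) ℝ} (hA : A.PosSemidef) :
    (gram x * A).trace = ‖mulRight n (CFC.sqrt A) x‖ ^ 2 := by
  rw [norm_sq_eq_trace_gram, gram_mulRight, sqrt_transpose,
    Matrix.trace_mul_comm (CFC.sqrt A * gram x), ← Matrix.mul_assoc, sqrt_mul_sqrt hA,
    Matrix.trace_mul_comm]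

lemma lintegral_exp_neg_trace_gram_mul {A : Matrix (Fin m) (Fin m) ℝ} (hA : A.PosDef) :
    ∫⁻ x : MatSpace n m, ENNReal.ofReal (Real.exp (-(gram x * A).trace)) =
      ENNReal.ofReal (Real.pi ^ ((n : ℝ) * m / 2) * A.det ^ (-((n : ℝ) / 2))) := by
  have hs := (sqrt_posDef hA).det_pos
  simp only [trace_gram_mul _ hA.posSemidef]
  rw [lintegral_mulRight _ hs.ne' fun y => ENNReal.ofReal (Real.exp (-‖y‖ ^ 2)),
    lintegral_exp_neg_norm_sq, ← ENNReal.ofReal_mul (by positivity), mul_comm,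
    abs_of_pos hs, det_sqrt hA.posSemidef, Real.rpow_neg hA.det_pos.le, inv_pow,
    Real.sqrt_eq_rpow, ← Real.rpow_natCast, ← Real.rpow_mul hA.det_pos.le]
  congr 4
  ring

/-- The Gaussian probability measure `exp(-π |x|²) dx`. -/
def gaussMeasure (n m : ℕ) : Measure (MatSpace n m) :=
  volume.withDensity fun x => ENNReal.ofReal (Real.exp (-(Real.pi * ‖x‖ ^ 2)))

lemma measurable_gaussDensity :
    Measurable fun x : MatSpace n m => ENNReal.ofReal (Real.exp (-(Real.pi * ‖x‖ ^ 2))) := by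
  fun_prop

lemma lintegral_gaussMeasure {F : MatSpace n m → ℝ≥0∞} (hF : Measurable F) :
    ∫⁻ x, F x ∂(gaussMeasure n m) =
      ∫⁻ x, ENNReal.ofReal (Real.exp (-(Real.pi * ‖x‖ ^ 2))) * F x :=
  lintegral_withDensity_eq_lintegral_mul _ measurable_gaussDensity hF

lemma integral_gaussMeasure (F : MatSpace n m → ℂ) :
    ∫ x, F x ∂(gaussMeasure n m) = ∫ x, ((Real.exp (-(Real.pi * ‖x‖ ^ 2)) : ℝ) : ℂ) * F x := by
  rw [gaussMeasure, integral_withDensity_eq_integral_toReal_smul measurable_gaussDensity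
    (Eventually.of_forall fun _ => ENNReal.ofReal_lt_top)]
  refine integral_congr_ae (Eventually.of_forall fun x => ?_)
  simp only [ENNReal.toReal_ofReal (Real.exp_pos _).le, Complex.real_smul]

lemma pi_norm_sq (x : MatSpace n m) :
    Real.pi * ‖x‖ ^ 2 = (gram x * (Real.pi • (1 : Matrix (Fin m) (Fin m) ℝ))).trace := by
  simp [norm_sq_eq_trace_gram]

lemma posDef_pi_smul {A : Matrix (Fin m) (Fin m) ℝ} (hA : A.PosDef) :
    (Real.pi • A).PosDef := hA.smul Real.pi_pos

instance : IsProbabilityMeasure (gaussMeasure n m) := by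
  refine ⟨?_⟩
  rw [← setLIntegral_one, Measure.restrict_univ, lintegral_gaussMeasure measurable_const]
  simp only [mul_one, pi_norm_sq]
  rw [lintegral_exp_neg_trace_gram_mul (posDef_pi_smul Matrix.PosDef.one), Matrix.det_smul]
  simp only [Matrix.det_one, mul_one, Fintype.card_fin]
  rw [← Real.rpow_natCast, ← Real.rpow_mul Real.pi_pos.le, ← Real.rpow_add Real.pi_pos]
  ring_nf
  simp

/-- The function exp(-π|x|²) is its own Fourier transform for the kernel e^{2πi⟨x,w⟩}. -/
lemma integral_gaussMeasure_exp_inner (w : MatSpace n m) :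
    ∫ x, Complex.exp (2 * Real.pi * Complex.I * (⟪x, w⟫ : ℝ)) ∂(gaussMeasure n m) =
      ((Real.exp (-(Real.pi * ‖w‖ ^ 2)) : ℝ) : ℂ) := by
  rw [integral_gaussMeasure]
  have h := fourier_gaussian_innerProductSpace (V := MatSpace n m) (b := Real.pi)
    (by simpa using Real.pi_pos) (-w)
  rw [Real.fourier_eq'] at h
  have hpi : (Real.pi : ℂ) ≠ 0 := by exact_mod_cast Real.pi_ne_zero
  rw [div_self hpi, Complex.one_cpow, one_mul, norm_neg] at h
  convert h using 1
  · refine integral_congr_ae (Eventually.of_forall fun x => ?_)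
    simp only [smul_eq_mul, inner_neg_right]
    push_cast
    rw [mul_comm]
    ring_nf
  · push_cast
    congr 1
    field_simp

end Gauss

/-! ### The common form of all Riesz potentials: mixtures of Gaussian averages. -/

section Mixture

/-- A representation of the Riesz potential of order `α` as a mixture of Gaussian averages. -/
structure RieszMixture (n m : ℕ) (α : ℂ) where
  /-- the parameter space -/
  S : Type
  [meas : MeasurableSpace S]
  /-- the mixing measure -/
  Λ : Measure S
  [sfin : SFinite Λ]
  /-- the rank of the Gaussian matrices -/
  l : ℕ
  /-- the matrix that the standard Gaussian matrix is multiplied with -/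
  c : S → Matrix (Fin l) (Fin m) ℝ
  meas_c : Measurable c
  /-- the weight -/
  ω : S → ℂ
  meas_ω : Measurable ω
  -- This is used with b = n/(2p): averaging an L^p function over G c(s) costs a factor det(1 +
  -- c'c)^{-n/(2p)}.
  lintegral_det_lt_top : ∀ b : ℝ, (α.re + m - 1) / 2 < b →
    ∫⁻ s, ‖ω s‖ₑ * ENNReal.ofReal ((1 + (c s)ᵀ * c s).det ^ (-b)) ∂Λ < ⊤
  -- The average of e^{2πi⟨Gc,z⟩} over G is exp(-π|zc'|²), so this integral is the symbol of the
  -- potential. The right side is |2πz|_m^{-α}.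
  integral_exp : ∀ z : MatSpace n m, matAbs z ≠ 0 →
    ∫ s, ω s * ((Real.exp (-(Real.pi * ‖mulRight n (c s)ᵀ z‖ ^ 2)) : ℝ) : ℂ) ∂Λ =
      (((2 * Real.pi) ^ m * matAbs z : ℝ) : ℂ) ^ (-α)
  -- The same integral with absolute values; it licenses Fubini in the frequency variable.
  lintegral_exp_le : ∃ C : ℝ, ∀ z : MatSpace n m, matAbs z ≠ 0 →
    ∫⁻ s, ‖ω s‖ₑ * ENNReal.ofReal (Real.exp (-(Real.pi * ‖mulRight n (c s)ᵀ z‖ ^ 2))) ∂Λ ≤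
      ENNReal.ofReal (C * matAbs z ^ (-α.re))
  -- The potential converges and equals the mixture at every single point where the mixture
  -- converges absolutely.
  rep : ∀ f : MatSpace n m → ℂ, Measurable f → ∀ x : MatSpace n m,
    Integrable (fun q : S × MatSpace n l => f (x - mulRight n (c q.1) q.2) * ω q.1)
      (Λ.prod (gaussMeasure n l)) →
    RieszConverges n m α f x ∧ rieszPotential n m α f x =
      ∫ q : S × MatSpace n l, f (x - mulRight n (c q.1) q.2) * ω q.1 ∂(Λ.prod (gaussMeasure n l))

attribute [instance] RieszMixture.meas RieszMixture.sfin

end Mixture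

/-! ### The Gaussian mixture for Re α > m - 1. -/

section AbsolutelyContinuousCase

variable {n m : ℕ}

/-! ### The absolutely continuous Riesz potentials -/

/-- The weight of the Gaussian mixture of the absolutely continuous Riesz potential. -/
def rieszWeight (m : ℕ) (α : ℂ) : ℂ :=
  (Real.pi : ℂ) ^ (-((m : ℂ) * α / 2)) * 2 ^ (-(α * m)) / siegelGamma m (α / 2)

lemma det_one_add_posSemidef_pos {A : Matrix (Fin m) (Fin m) ℝ} (hA : A.PosSemidef) :
    0 < (1 + A).det := (Matrix.PosDef.one.add_posSemidef hA).det_pos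

lemma norm_det_cpow {q : Matrix (Fin m) (Fin m) ℝ} (hq : q ∈ cone m) (β : ℂ) :
    ‖(q.det : ℂ) ^ β‖ = q.det ^ β.re :=
  Complex.norm_cpow_eq_rpow_re_of_pos (Matrix.PosDef.det_pos hq) β

lemma measurable_ofReal_det_cpow (β : ℂ) :
    Measurable fun q : Matrix (Fin m) (Fin m) ℝ => (q.det : ℂ) ^ β :=
  (measurable_ofReal_cpow β).comp measurable_det

lemma enorm_det_cpow {q : Matrix (Fin m) (Fin m) ℝ} (hq : q ∈ cone m) (β : ℂ) :
    ‖(q.det : ℂ) ^ β‖ₑ = ENNReal.ofReal (q.det ^ β.re) := by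
  rw [← ofReal_norm, norm_det_cpow hq]

lemma det_pi_smul_gram (z : MatSpace n m) :
    (Real.pi • gram z).det = Real.pi ^ m * matAbs z ^ 2 := by
  rw [Matrix.det_smul, Fintype.card_fin, matAbs_sq]

lemma pi_norm_sq_sqrt (z : MatSpace n m) {q : Matrix (Fin m) (Fin m) ℝ} (hq : q.PosSemidef) :
    Real.pi * ‖mulRight n (CFC.sqrt q) z‖ ^ 2 = (q * (Real.pi • gram z)).trace := by
  rw [← trace_gram_mul _ hq, Matrix.trace_mul_comm]
  simp

lemma ofReal_cpow_eq_exp {x : ℝ} (hx : 0 < x) (s : ℂ) :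
    (x : ℂ) ^ s = Complex.exp (s * (Real.log x : ℝ)) := by
  rw [Complex.cpow_def_of_ne_zero (by exact_mod_cast hx.ne'), Complex.ofReal_log hx.le, mul_comm]

lemma two_cpow_eq_exp (s : ℂ) : (2 : ℂ) ^ s = Complex.exp (s * (Real.log 2 : ℝ)) := by
  simpa using ofReal_cpow_eq_exp two_pos s

lemma log_pi_pow_mul_sq {t : ℝ} (ht : 0 < t) :
    Real.log (Real.pi ^ m * t ^ 2) = m * Real.log Real.pi + 2 * Real.log t := by
  rw [Real.log_mul (by positivity) (by positivity), Real.log_pow, Real.log_pow]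
  norm_num

lemma log_two_pi_pow_mul {t : ℝ} (ht : 0 < t) :
    Real.log ((2 * Real.pi) ^ m * t) = m * (Real.log 2 + Real.log Real.pi) + Real.log t := by
  rw [Real.log_mul (by positivity) (by positivity), Real.log_pow,
    Real.log_mul two_ne_zero Real.pi_ne_zero]

lemma half_re (α : ℂ) : (α / 2).re = α.re / 2 := by simp

/-- The weight is normalised so that the gamma integral Γ_m(α/2)|πz'z|^{-α/2} becomes |2πz|_m^{-α}.
All bases are positive, so powers are compared as exponentials of real logarithms. -/
lemma rieszWeight_mul {α : ℂ} (hα : (m : ℝ) - 1 < α.re) {t : ℝ} (ht : 0 < t) :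
    rieszWeight m α * (siegelGamma m (α / 2) * ((Real.pi ^ m * t ^ 2 : ℝ) : ℂ) ^ (-(α / 2))) =
      (((2 * Real.pi) ^ m * t : ℝ) : ℂ) ^ (-α) := by
  have h : siegelGamma m (α / 2) ≠ 0 := siegelGamma_ne_zero m _ (by rw [half_re]; linarith)
  have key : ∀ A X g : ℂ, g ≠ 0 → A / g * (g * X) = A * X := fun A X g hg => by field_simp
  have h1 : 0 < Real.pi ^ m * t ^ 2 := by positivity
  have h2 : 0 < (2 * Real.pi) ^ m * t := by positivity
  rw [rieszWeight, key _ _ _ h, ofReal_cpow_eq_exp h1, ofReal_cpow_eq_exp h2,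
    ofReal_cpow_eq_exp Real.pi_pos, two_cpow_eq_exp,
    ← Complex.exp_add, ← Complex.exp_add, log_pi_pow_mul_sq ht, log_two_pi_pow_mul ht]
  congr 1
  push_cast
  ring

/-- The same weight seen in space: a gamma integral at (n - α)/2 with parameter πy'y produces the
Riesz kernel together with its constant. -/
lemma rieszWeight_mul' {α : ℂ} {t : ℝ} (ht : 0 < t) (n : ℕ) :
    rieszWeight m α * (siegelGamma m ((n - α) / 2) *
      ((Real.pi ^ m * t ^ 2 : ℝ) : ℂ) ^ (-((n - α) / 2))) =
      (rieszConst n m α)⁻¹ * (t : ℂ) ^ (α - n) := by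
  have key : ∀ A B g h X Y : ℂ, A * X = B⁻¹ * Y → A / g * (h * X) = (B * g / h)⁻¹ * Y := by
    intro A B g h X Y hX
    rw [div_mul_eq_mul_div, mul_left_comm, hX, inv_div, div_eq_mul_inv, div_eq_mul_inv,
      mul_inv]
    ring
  rw [rieszWeight, rieszConst]
  refine key _ _ _ _ _ _ ?_
  have h1 : 0 < Real.pi ^ m * t ^ 2 := by positivity
  rw [ofReal_cpow_eq_exp h1, ofReal_cpow_eq_exp ht, ofReal_cpow_eq_exp Real.pi_pos,
    ofReal_cpow_eq_exp Real.pi_pos, two_cpow_eq_exp, two_cpow_eq_exp,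
    ← Complex.exp_add, ← Complex.exp_add, ← Complex.exp_add, ← Complex.exp_neg,
    ← Complex.exp_add, log_pi_pow_mul_sq ht]
  congr 1
  push_cast
  ring

/-- The density of `G q^{1/2}`, for a standard Gaussian matrix `G`. -/
def gaussKernel (n : ℕ) {m : ℕ} (q : Matrix (Fin m) (Fin m) ℝ) (y : MatSpace n m) : ℝ :=
  |(CFC.sqrt q).det|⁻¹ ^ n * Real.exp (-(q⁻¹ * (Real.pi • gram y)).trace)

lemma gaussKernel_nonneg (q : Matrix (Fin m) (Fin m) ℝ) (y : MatSpace n m) :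
    0 ≤ gaussKernel n q y := by
  unfold gaussKernel
  positivity

lemma measurable_gaussKernel :
    Measurable fun p : Matrix (Fin m) (Fin m) ℝ × MatSpace n m => gaussKernel n p.1 p.2 := by
  have h1 : Measurable fun q : Matrix (Fin m) (Fin m) ℝ => |(CFC.sqrt q).det|⁻¹ ^ n := by
    have := continuous_abs.measurable.comp (measurable_det.comp (measurable_sqrt (m := m)))
    simp only [Function.comp_def] at this
    exact this.inv.pow_const n
  have h2 : Continuous fun p : Matrix (Fin m) (Fin m) ℝ × MatSpace n m =>
      Real.exp (-(p.1 * (Real.pi • gram p.2)).trace) := by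
    have h0 : Continuous fun p : Matrix (Fin m) (Fin m) ℝ × MatSpace n m => Real.pi • gram p.2 := by
      have h00 : Continuous fun A : Matrix (Fin m) (Fin m) ℝ => Real.pi • A :=
        continuous_const_smul _
      have := h00.comp (continuous_gram.comp (continuous_snd (X := Matrix (Fin m) (Fin m) ℝ)
        (Y := MatSpace n m)))
      simpa only [Function.comp_def] using this
    exact Real.continuous_exp.comp (continuous_fst.matrix_mul h0).matrix_trace.neg
  have h3 : Measurable fun p : Matrix (Fin m) (Fin m) ℝ × MatSpace n m => (p.1⁻¹, p.2) :=
    (measurable_matrix_inv.comp measurable_fst).prodMk measurable_snd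
  have h4 : Measurable fun p : Matrix (Fin m) (Fin m) ℝ × MatSpace n m =>
      Real.exp (-(p.1⁻¹ * (Real.pi • gram p.2)).trace) := by
    have := h2.measurable.comp h3
    simpa only [Function.comp_def] using this
  have h5 : Measurable fun p : Matrix (Fin m) (Fin m) ℝ × MatSpace n m =>
      |(CFC.sqrt p.1).det|⁻¹ ^ n := by
    have h0 : Measurable fun p : Matrix (Fin m) (Fin m) ℝ × MatSpace n m => p.1 :=
      measurable_fst
    have := h1.comp h0
    simpa only [Function.comp_def] using this
  unfold gaussKernel
  exact h5.mul h4

lemma gaussKernel_mulRight {q : Matrix (Fin m) (Fin m) ℝ} (hq : q.PosDef) (x : MatSpace n m) :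
    Real.exp (-(q⁻¹ * (Real.pi • gram (mulRight n (CFC.sqrt q) x))).trace) =
      Real.exp (-(Real.pi * ‖x‖ ^ 2)) := by
  have hu : IsUnit (CFC.sqrt q).det := isUnit_iff_ne_zero.2 (sqrt_posDef hq).det_pos.ne'
  have hinv : CFC.sqrt q * q⁻¹ * CFC.sqrt q = 1 := by
    have : q⁻¹ = (CFC.sqrt q)⁻¹ * (CFC.sqrt q)⁻¹ := by
      rw [← Matrix.mul_inv_rev, sqrt_mul_sqrt hq.posSemidef]
    rw [this, ← Matrix.mul_assoc, Matrix.mul_nonsing_inv _ hu, Matrix.one_mul,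
      Matrix.nonsing_inv_mul _ hu]
  rw [gram_mulRight, sqrt_transpose, Matrix.mul_smul, Matrix.trace_smul, smul_eq_mul,
    norm_sq_eq_trace_gram, ← Matrix.mul_assoc, ← Matrix.mul_assoc, Matrix.trace_mul_comm,
    ← Matrix.mul_assoc, ← Matrix.mul_assoc, hinv, Matrix.one_mul]

lemma lintegral_gauss_mulRight_sqrt {q : Matrix (Fin m) (Fin m) ℝ} (hq : q.PosDef)
    {F : MatSpace n m → ℝ≥0∞} (hF : Measurable F) :
    ∫⁻ x, F (mulRight n (CFC.sqrt q) x) ∂(gaussMeasure n m) =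
      ∫⁻ y, ENNReal.ofReal (gaussKernel n q y) * F y := by
  have hc : Measurable fun x => F (mulRight n (CFC.sqrt q) x) :=
    hF.comp (mulRight n (CFC.sqrt q)).continuous_of_finiteDimensional.measurable
  rw [lintegral_gaussMeasure hc]
  simp only [gaussKernel]
  simp_rw [ENNReal.ofReal_mul (show 0 ≤ |(CFC.sqrt q).det|⁻¹ ^ n by positivity), mul_assoc]
  rw [lintegral_const_mul' _ _ ENNReal.ofReal_ne_top, ← lintegral_mulRight _
    (sqrt_posDef hq).det_pos.ne' (fun y =>
      ENNReal.ofReal (Real.exp (-(q⁻¹ * (Real.pi • gram y)).trace)) * F y)]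
  simp only [gaussKernel_mulRight hq]

lemma integral_gauss_mulRight_sqrt {q : Matrix (Fin m) (Fin m) ℝ} (hq : q.PosDef)
    (F : MatSpace n m → ℂ) :
    ∫ x, F (mulRight n (CFC.sqrt q) x) ∂(gaussMeasure n m) =
      ∫ y, (gaussKernel n q y : ℂ) * F y := by
  rw [integral_gaussMeasure]
  simp only [gaussKernel]
  simp_rw [Complex.ofReal_mul, mul_assoc]
  rw [integral_const_mul, ← integral_mulRight _
    (sqrt_posDef hq).det_pos.ne' (fun y =>
      (Real.exp (-(q⁻¹ * (Real.pi • gram y)).trace) : ℂ) * F y)]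
  simp only [gaussKernel_mulRight hq]

/-- The inversion q ↦ q⁻¹ preserves d_* and turns the Gaussian density into |r|^{n/2} e^{-tr(r
πy'y)}, so that a gamma integral at (n - α)/2 remains. -/
lemma integral_rieszWeight_mul_gaussKernel (α : ℂ) {y : MatSpace n m} (hy : matAbs y ≠ 0) :
    ∫ q, (gaussKernel n q y : ℂ) * (rieszWeight m α * (q.det : ℂ) ^ (α / 2)) ∂(coneMeasure m) =
      (rieszConst n m α)⁻¹ * (matAbs y : ℂ) ^ (α - n) := by
  have hy' : 0 < matAbs y := lt_of_le_of_ne (matAbs_nonneg y) hy.symm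
  have hmeas : Measurable fun q : Matrix (Fin m) (Fin m) ℝ =>
      (gaussKernel n q y : ℂ) * (rieszWeight m α * (q.det : ℂ) ^ (α / 2)) :=
    (Complex.measurable_ofReal.comp (measurable_gaussKernel.comp measurable_prodMk_right)).mul
      ((measurable_ofReal_det_cpow _).const_mul _)
  rw [← integral_coneMeasure_inv hmeas, ← rieszWeight_mul' hy' n, ← det_pi_smul_gram,
    ← integral_exp_neg_trace_mul (posDef_pi_smul ((gram_posDef_iff y).2 hy)), ← integral_const_mul]
  refine integral_congr_ae ?_
  filter_upwards [ae_mem_cone] with r (hr : r.PosDef)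
  have hd := hr.det_pos
  have hs : (CFC.sqrt r⁻¹).det = Real.sqrt (r.det⁻¹) := by
    rw [det_sqrt hr.inv.posSemidef, Matrix.det_nonsing_inv, Ring.inverse_eq_inv']
  have hn : |(CFC.sqrt r⁻¹).det|⁻¹ ^ n = r.det ^ ((n : ℝ) / 2) := by
    rw [hs, abs_of_nonneg (Real.sqrt_nonneg _), Real.sqrt_inv, inv_inv, Real.sqrt_eq_rpow,
      ← Real.rpow_natCast, ← Real.rpow_mul hd.le]
    ring_nf
  rw [gaussKernel, hn, Matrix.nonsing_inv_nonsing_inv _ (isUnit_iff_ne_zero.2 hd.ne'),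
    Matrix.det_nonsing_inv, Ring.inverse_eq_inv', ofReal_cpow_eq_exp (inv_pos.2 hd),
    ofReal_cpow_eq_exp hd, Complex.ofReal_mul, Complex.ofReal_cpow hd.le, ofReal_cpow_eq_exp hd,
    Real.log_inv]
  have : Complex.exp ((((n : ℝ) / 2 : ℝ) : ℂ) * (Real.log r.det : ℝ)) *
      Complex.exp (α / 2 * ((-Real.log r.det : ℝ) : ℂ)) =
      Complex.exp ((n - α) / 2 * (Real.log r.det : ℝ)) := by
    rw [← Complex.exp_add]
    congr 1
    push_cast
    ring
  rw [← this]
  ring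

/-- The Gaussian mixture of the absolutely continuous Riesz potentials. -/
def rieszMixtureOfLt (hm : 1 ≤ m) (hnm : m ≤ n) {α : ℂ} (hα : (m : ℝ) - 1 < α.re)
    (hα' : α.re < (n : ℝ) - m + 1) : RieszMixture n m α where
  S := Matrix (Fin m) (Fin m) ℝ
  Λ := coneMeasure m
  l := m
  c := CFC.sqrt
  meas_c := measurable_sqrt
  ω q := rieszWeight m α * (q.det : ℂ) ^ (α / 2)
  meas_ω := (measurable_ofReal_det_cpow _).const_mul _
  -- This is the beta integral with exponents Re α/2 and b; it converges because Re α > m - 1 and b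
  -- - Re α/2 > (m - 1)/2.
  lintegral_det_lt_top b hb := by
    have h := lintegral_det_rpow_mul_one_add_lt_top (m := m) (b := α.re / 2) (c := b) hm
      (by linarith) (by linarith)
    refine lt_of_eq_of_lt ?_ (ENNReal.mul_lt_top (enorm_lt_top (x := rieszWeight m α)) h)
    rw [← lintegral_const_mul' _ _ enorm_ne_top]
    refine lintegral_congr_ae ?_
    filter_upwards [ae_mem_cone] with q (hq : q.PosDef)
    rw [sqrt_transpose, sqrt_mul_sqrt hq.posSemidef, enorm_mul, enorm_det_cpow hq, half_re,
      ENNReal.ofReal_mul (Real.rpow_nonneg hq.det_pos.le _), mul_assoc]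
  integral_exp z hz := by
    have hz' : 0 < matAbs z := lt_of_le_of_ne (matAbs_nonneg z) hz.symm
    rw [← rieszWeight_mul hα hz', ← det_pi_smul_gram,
      ← integral_exp_neg_trace_mul (posDef_pi_smul ((gram_posDef_iff z).2 hz)),
      ← integral_const_mul]
    refine integral_congr_ae ?_
    filter_upwards [ae_mem_cone] with q (hq : q.PosDef)
    rw [sqrt_transpose, pi_norm_sq_sqrt z hq.posSemidef]
    ring
  lintegral_exp_le := by
    refine ⟨‖rieszWeight m α‖ * (coneGamma m (α.re / 2)).toReal * (Real.pi ^ m) ^ (-(α.re / 2)),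
      fun z hz => le_of_eq ?_⟩
    have hz' : 0 < matAbs z := lt_of_le_of_ne (matAbs_nonneg z) hz.symm
    have hG := coneGamma_pos_lt_top m (α.re / 2) (by linarith)
    have h := lintegral_exp_neg_trace_mul (posDef_pi_smul ((gram_posDef_iff z).2 hz)) (α.re / 2)
    rw [det_pi_smul_gram, Real.mul_rpow (by positivity) (by positivity), ← Real.rpow_natCast
      (matAbs z) 2, ← Real.rpow_mul hz'.le] at h
    rw [ENNReal.ofReal_mul (by positivity), ENNReal.ofReal_mul (by positivity),
      ENNReal.ofReal_mul (by positivity), ENNReal.ofReal_toReal hG.2, ofReal_norm, mul_assoc,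
      mul_assoc, ← ENNReal.ofReal_mul (by positivity), show -α.re = ((2 : ℕ) : ℝ) * -(α.re / 2) by
        push_cast; ring, ← h, ← lintegral_const_mul' _ _ enorm_ne_top]
    refine lintegral_congr_ae ?_
    filter_upwards [ae_mem_cone] with q (hq : q.PosDef)
    rw [sqrt_transpose, pi_norm_sq_sqrt z hq.posSemidef, enorm_mul, enorm_det_cpow hq, half_re,
      mul_assoc, mul_comm (Real.exp _),
      ENNReal.ofReal_mul (Real.rpow_nonneg hq.det_pos.le _)]
  rep f hf x hint := by
    set J : Matrix (Fin m) (Fin m) ℝ × MatSpace n m → ℂ := fun p =>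
      (gaussKernel n p.1 p.2 : ℂ) * (f (x - p.2) * (rieszWeight m α * (p.1.det : ℂ) ^ (α / 2)))
      with hJ
    have hω : Measurable fun q : Matrix (Fin m) (Fin m) ℝ =>
        rieszWeight m α * (q.det : ℂ) ^ (α / 2) := (measurable_ofReal_det_cpow _).const_mul _
    have hfx : Measurable fun y => f (x - y) := hf.comp (measurable_const.sub measurable_id)
    have hJm : Measurable J := (Complex.measurable_ofReal.comp measurable_gaussKernel).mul
      ((hfx.comp measurable_snd).mul (hω.comp measurable_fst))
    have hJi : Integrable J ((coneMeasure m).prod volume) := by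
      refine ⟨hJm.aestronglyMeasurable, ?_⟩
      refine lt_of_eq_of_lt ?_ hint.2
      rw [lintegral_prod _ hJm.enorm.aemeasurable, lintegral_prod _ hint.1.enorm]
      refine lintegral_congr_ae ?_
      filter_upwards [ae_mem_cone] with q (hq : q.PosDef)
      have := lintegral_gauss_mulRight_sqrt (n := n) hq
        (F := fun y => ‖f (x - y) * (rieszWeight m α * (q.det : ℂ) ^ (α / 2))‖ₑ)
        (hfx.mul_const _).enorm
      rw [this]
      refine lintegral_congr fun y => ?_
      rw [hJ, enorm_mul, ← ofReal_norm (gaussKernel n q y : ℂ), Complex.norm_real,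
        Real.norm_of_nonneg (gaussKernel_nonneg q y)]
    -- Integrating out q first merges the Gaussian densities into the Riesz kernel, for every
    -- nonsingular y.
    have hinner : (fun y => ∫ q, J (q, y) ∂(coneMeasure m)) =ᵐ[volume]
        fun y => (rieszConst n m α)⁻¹ * (f (x - y) * (matAbs y : ℂ) ^ (α - n)) := by
      filter_upwards [ae_matAbs_ne_zero hnm] with y hy
      rw [mul_left_comm, ← integral_rieszWeight_mul_gaussKernel α hy, ← integral_const_mul]
      exact integral_congr_ae (Eventually.of_forall fun q => by simp only [hJ]; ring)
    -- The bound Re α < n - m + 1 keeps Γ_m((n - α)/2) in its range of convergence. A vanishing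
    -- constant would hide whether the kernel integral itself converges.
    have hC : (rieszConst n m α)⁻¹ ≠ 0 := by
      rw [rieszConst]
      refine inv_ne_zero ?_
      have h1 : siegelGamma m (α / 2) ≠ 0 := siegelGamma_ne_zero m _ (by rw [half_re]; linarith)
      have h2 : siegelGamma m ((n - α) / 2) ≠ 0 := siegelGamma_ne_zero m _ (by
        rw [half_re]; simp; linarith)
      have h3 : (2 : ℂ) ^ (α * m) ≠ 0 := by rw [two_cpow_eq_exp]; exact Complex.exp_ne_zero _
      have h4 : (Real.pi : ℂ) ^ ((n : ℂ) * m / 2) ≠ 0 := by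
        rw [ofReal_cpow_eq_exp Real.pi_pos]; exact Complex.exp_ne_zero _
      exact div_ne_zero (mul_ne_zero (mul_ne_zero h3 h4) h1) h2
    constructor
    · rw [RieszConverges, if_pos hα]
      have := (hJi.integral_prod_right).congr hinner
      exact (integrable_const_mul_iff (isUnit_iff_ne_zero.2 hC) _).1 this
    · rw [rieszPotential, if_pos hα, ← integral_const_mul, ← integral_congr_ae hinner,
        ← integral_integral_swap (f := fun q y => J (q, y)) hJi, integral_prod _ hint]
      refine integral_congr_ae ?_
      filter_upwards [ae_mem_cone] with q (hq : q.PosDef)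
      exact (integral_gauss_mulRight_sqrt (n := n) hq
        (fun y => f (x - y) * (rieszWeight m α * (q.det : ℂ) ^ (α / 2)))).symm

end AbsolutelyContinuousCase

end

end MatrixWavelet

namespace MatrixWavelet

noncomputable section

open scoped RealInnerProductSpace Matrix

/-! ### The Gaussian mixture for α = k, carried by matrices of low rank. -/

section RankCase

variable {n m k : ℕ}

/-! ### Transposition -/

/-- Transposition of matrices, as an isometry. -/
def transposeIsometry (n m : ℕ) : MatSpace n m ≃ₗᵢ[ℝ] MatSpace m n :=
  LinearIsometryEquiv.piLpCongrLeft 2 ℝ ℝ (Equiv.prodComm (Fin n) (Fin m))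

lemma toMat_transposeIsometry (x : MatSpace n m) :
    toMat (transposeIsometry n m x) = (toMat x)ᵀ := by
  ext i j
  simp [toMat, transposeIsometry, LinearIsometryEquiv.piLpCongrLeft_apply,
    Equiv.piCongrLeft'_apply]

lemma lintegral_transposeIsometry (F : MatSpace m n → ℝ≥0∞) :
    ∫⁻ x, F (transposeIsometry n m x) = ∫⁻ y, F y :=
  (transposeIsometry n m).measurePreserving.lintegral_comp_emb
    (transposeIsometry n m).toHomeomorph.measurableEmbedding F

lemma lintegral_mulLeft (T : Matrix (Fin k) (Fin k) ℝ) (hT : T.det ≠ 0)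
    (F : MatSpace k m → ℝ≥0∞) :
    ∫⁻ y : MatSpace k m, F (ofMat (T * toMat y)) =
      ENNReal.ofReal (|T.det|⁻¹ ^ m) * ∫⁻ y, F y := by
  have h := lintegral_mulRight (n := m) Tᵀ (by rwa [Matrix.det_transpose])
    fun y => F (transposeIsometry m k y)
  rw [Matrix.det_transpose, lintegral_transposeIsometry] at h
  rw [← h, ← lintegral_transposeIsometry]
  refine lintegral_congr fun x => congrArg F (toMat_injective ?_)
  rw [toMat_ofMat, toMat_transposeIsometry, toMat_transposeIsometry, toMat_mulRight,
    Matrix.transpose_mul, Matrix.transpose_transpose]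

/-! ### Integrals of powers of `|1 + y'y|` -/

lemma measurable_one_add_gram_det_rpow (b : ℝ) :
    Measurable fun y : MatSpace k m => ENNReal.ofReal ((1 + gram y).det ^ (-b)) :=
  ((continuous_const.add continuous_gram).matrix_det.measurable.pow_const _).ennreal_ofReal

/-- Write |1 + y'y|^{-b} as a gamma integral; the integral over y is then Gaussian and lowers the
argument by k/2. -/
lemma coneGamma_mul_lintegral_one_add_gram (b : ℝ) :
    coneGamma m b * ∫⁻ y : MatSpace k m, ENNReal.ofReal ((1 + gram y).det ^ (-b)) =
      ENNReal.ofReal (Real.pi ^ ((k : ℝ) * m / 2)) * coneGamma m (b - k / 2) := by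
  have hmeas : Measurable fun p : MatSpace k m × Matrix (Fin m) (Fin m) ℝ =>
      ENNReal.ofReal (Real.exp (-(p.2 * (1 + gram p.1)).trace) * p.2.det ^ b) := by
    have h0 : Continuous fun p : MatSpace k m × Matrix (Fin m) (Fin m) ℝ => 1 + gram p.1 :=
      continuous_const.add (continuous_gram.comp continuous_fst)
    have h1 : Continuous fun p : MatSpace k m × Matrix (Fin m) (Fin m) ℝ =>
        Real.exp (-(p.2 * (1 + gram p.1)).trace) :=
      Real.continuous_exp.comp (continuous_snd.matrix_mul h0).matrix_trace.neg
    exact (h1.measurable.mul ((measurable_det.comp measurable_snd).pow_const b)).ennreal_ofReal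
  rw [← lintegral_const_mul _ (measurable_one_add_gram_det_rpow b)]
  have hpd : ∀ y : MatSpace k m, (1 + gram y).PosDef := fun y =>
    Matrix.PosDef.one.add_posSemidef (gram_posSemidef y)
  simp_rw [← fun y => lintegral_exp_neg_trace_mul (hpd y) b]
  rw [lintegral_lintegral_swap hmeas.aemeasurable, coneGamma,
    ← lintegral_const_mul' _ _ ENNReal.ofReal_ne_top]
  refine lintegral_congr_ae ?_
  filter_upwards [ae_mem_cone] with r (hr : r.PosDef)
  have hd := hr.det_pos
  have h : ∀ y : MatSpace k m, ENNReal.ofReal (Real.exp (-(r * (1 + gram y)).trace) * r.det ^ b) =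
      ENNReal.ofReal (Real.exp (-r.trace) * r.det ^ b) *
        ENNReal.ofReal (Real.exp (-(gram y * r).trace)) := by
    intro y
    rw [← ENNReal.ofReal_mul (by positivity), Matrix.mul_add, Matrix.mul_one, Matrix.trace_add,
      neg_add, Real.exp_add, Matrix.trace_mul_comm (gram y)]
    ring_nf
  simp_rw [h]
  rw [lintegral_const_mul' _ _ ENNReal.ofReal_ne_top, lintegral_exp_neg_trace_gram_mul hr,
    ← ENNReal.ofReal_mul (by positivity), ← ENNReal.ofReal_mul (by positivity)]
  congr 1
  rw [sub_eq_add_neg, Real.rpow_add hd]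
  ring

/-- Transposition preserves the volume, and |1 + y'y| = |1 + yy'|. -/
lemma lintegral_one_add_gram_comm (b : ℝ) :
    ∫⁻ y : MatSpace k m, ENNReal.ofReal ((1 + gram y).det ^ (-b)) =
      ∫⁻ y : MatSpace m k, ENNReal.ofReal ((1 + gram y).det ^ (-b)) := by
  rw [← lintegral_transposeIsometry]
  refine lintegral_congr fun y => ?_
  rw [gram, gram, toMat_transposeIsometry, Matrix.transpose_transpose,
    Matrix.det_one_add_mul_comm]

lemma lintegral_one_add_gram_lt_top {b : ℝ} (hb : ((k : ℝ) + m - 1) / 2 < b) :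
    ∫⁻ y : MatSpace k m, ENNReal.ofReal ((1 + gram y).det ^ (-b)) < ⊤ := by
  have hk : (0 : ℝ) ≤ k := k.cast_nonneg
  have h1 := coneGamma_pos_lt_top m b (by linarith)
  have h2 := coneGamma_pos_lt_top m (b - k / 2) (by linarith)
  refine lt_top_iff_ne_top.2 fun h => ?_
  have := coneGamma_mul_lintegral_one_add_gram (k := k) (m := m) b
  rw [h, ENNReal.mul_top h1.1] at this
  exact ENNReal.mul_ne_top ENNReal.ofReal_ne_top h2.2 this.symm

/-! ### Moments of Gaussian determinants -/

/-- The expectation of `|G|^{-m}` for a standard Gaussian `n × k` matrix. -/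
def gaussMoment (n m k : ℕ) : ℝ≥0∞ :=
  ∫⁻ x : MatSpace n k, ENNReal.ofReal ((matAbs x)⁻¹ ^ m) ∂(gaussMeasure n k)

lemma gaussMoment_eq' (hkn : k ≤ n) : gaussMoment n m k =
    polarConst n k * (coneGamma k (((n : ℝ) - m) / 2) *
      ENNReal.ofReal ((Real.pi ^ k) ^ (-(((n : ℝ) - m) / 2)))) := by
  have hm : Measurable fun x : MatSpace n k => ENNReal.ofReal ((matAbs x)⁻¹ ^ m) :=
    (continuous_matAbs.measurable.inv.pow_const m).ennreal_ofReal
  have hmF : Measurable fun r : Matrix (Fin k) (Fin k) ℝ => ENNReal.ofReal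
      (Real.exp (-(r * (Real.pi • (1 : Matrix (Fin k) (Fin k) ℝ))).trace) *
        (Real.sqrt r.det)⁻¹ ^ m) := by
    have h1 : Continuous fun r : Matrix (Fin k) (Fin k) ℝ =>
        Real.exp (-(r * (Real.pi • (1 : Matrix (Fin k) (Fin k) ℝ))).trace) :=
      Real.continuous_exp.comp (continuous_id.matrix_mul continuous_const).matrix_trace.neg
    exact (h1.measurable.mul
      ((Real.continuous_sqrt.measurable.comp measurable_det).inv.pow_const m)).ennreal_ofReal
  have h := lintegral_exp_neg_trace_mul (posDef_pi_smul (Matrix.PosDef.one (n := Fin k) (R := ℝ)))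
    (((n : ℝ) - m) / 2)
  rw [Matrix.det_smul, Matrix.det_one, mul_one, Fintype.card_fin] at h
  rw [← h, gaussMoment, lintegral_gaussMeasure hm]
  have h2 := lintegral_gram (n := n) hkn hmF
  refine Eq.trans (lintegral_congr fun x => ?_) (h2.trans ?_)
  · rw [← ENNReal.ofReal_mul (by positivity), pi_norm_sq, matAbs]
  · congr 1
    refine lintegral_congr_ae ?_
    filter_upwards [ae_mem_cone] with r (hr : r.PosDef)
    have hd := hr.det_pos
    rw [← ENNReal.ofReal_mul (by positivity)]
    congr 1
    have : (Real.sqrt r.det)⁻¹ ^ m = r.det ^ (-((m : ℝ) / 2)) := by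
      rw [inv_pow, Real.sqrt_eq_rpow, ← Real.rpow_natCast, ← Real.rpow_mul hd.le,
        Real.rpow_neg hd.le]
      ring_nf
    rw [this, sub_div, sub_eq_add_neg ((n : ℝ) / 2), Real.rpow_add hd]
    ring

/-- Polar coordinates give the moment in terms of Γ_k. Evaluating ∫ |1 + y'y|^{-n/2} dy for y and
for y' yields Γ_k((n-m)/2)/Γ_k(n/2) = Γ_m((n-k)/2)/Γ_m(n/2), the ratio that occurs in c_k. -/
lemma gaussMoment_eq (hkn : k ≤ n) (hmn : m ≤ n) : gaussMoment n m k =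
    ENNReal.ofReal (Real.pi ^ ((k : ℝ) * m / 2)) * coneGamma m (((n : ℝ) - k) / 2) /
      coneGamma m ((n : ℝ) / 2) := by
  have h1 := coneGamma_pos_lt_top k _ (half_gt_of_le hkn)
  have h2 := coneGamma_pos_lt_top m _ (half_gt_of_le hmn)
  have e1 := coneGamma_mul_lintegral_one_add_gram (k := k) (m := m) ((n : ℝ) / 2)
  have e2 := coneGamma_mul_lintegral_one_add_gram (k := m) (m := k) ((n : ℝ) / 2)
  rw [lintegral_one_add_gram_comm] at e2
  rw [← sub_div] at e1 e2
  rw [← e1, mul_comm (coneGamma m _), ENNReal.mul_div_cancel_right h2.1 h2.2,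
    ← ENNReal.mul_right_inj h1.1 h1.2, e2, gaussMoment_eq' hkn, polarConst, ← mul_assoc,
    ENNReal.mul_div_cancel h1.1 h1.2, mul_left_comm, ← ENNReal.ofReal_mul (by positivity), mul_comm]
  congr 2
  rw [← Real.rpow_natCast, ← Real.rpow_mul Real.pi_pos.le, ← Real.rpow_add Real.pi_pos]
  ring_nf

lemma gaussMoment_pos_lt_top (hmn : m ≤ n) (hk : k ≤ n - m) :
    gaussMoment n m k ≠ 0 ∧ gaussMoment n m k ≠ ⊤ := by
  have hkn : k ≤ n := by omega
  have h2 := coneGamma_pos_lt_top m _ (half_gt_of_le hmn)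
  have h3 := coneGamma_pos_lt_top m (((n : ℝ) - k) / 2) (by
    have : (k : ℝ) + m ≤ n := by exact_mod_cast (by omega : k + m ≤ n)
    linarith)
  rw [gaussMoment_eq hkn hmn]
  have hp : ENNReal.ofReal (Real.pi ^ ((k : ℝ) * m / 2)) ≠ 0 := by
    have : 0 < Real.pi ^ ((k : ℝ) * m / 2) := by positivity
    simpa using this
  exact ⟨(ENNReal.div_pos (mul_ne_zero hp h3.1) h2.2).ne',
    ENNReal.div_ne_top (ENNReal.mul_ne_top ENNReal.ofReal_ne_top h3.2) h2.1⟩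

/-! ### The orthogonal group -/

instance : IsProbabilityMeasure (orthogonalHaar n) := by
  refine ⟨?_⟩
  have := Measure.haarMeasure_self
    (K₀ := (⊤ : TopologicalSpace.PositiveCompacts (Matrix.orthogonalGroup (Fin n) ℝ)))
  simpa [orthogonalHaar] using this

instance : (orthogonalHaar n).IsHaarMeasure := by
  unfold orthogonalHaar
  infer_instance

/-- A right translate of Haar measure is again a Haar probability measure, and there is only one. -/
lemma map_mul_right_orthogonalHaar (U : Matrix.orthogonalGroup (Fin n) ℝ) :
    Measure.map (fun V => V * U) (orthogonalHaar n) = orthogonalHaar n := by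
  have : IsProbabilityMeasure (Measure.map (fun V => V * U) (orthogonalHaar n)) :=
    Measure.isProbabilityMeasure_map (measurable_mul_const U).aemeasurable
  exact Measure.isHaarMeasure_eq_of_isProbabilityMeasure _ _

lemma lintegral_mul_right_orthogonalHaar (U : Matrix.orthogonalGroup (Fin n) ℝ)
    {F : Matrix.orthogonalGroup (Fin n) ℝ → ℝ≥0∞} (hF : Measurable F) :
    ∫⁻ V, F (V * U) ∂(orthogonalHaar n) = ∫⁻ V, F V ∂(orthogonalHaar n) := by
  conv_rhs => rw [← map_mul_right_orthogonalHaar U, lintegral_map hF (measurable_mul_const U)]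

lemma exists_orthogonal_extension (hkn : k ≤ n) {Q : Matrix (Fin n) (Fin k) ℝ}
    (hQ : Qᵀ * Q = 1) : ∃ U : Matrix.orthogonalGroup (Fin n) ℝ,
      ∀ (i : Fin n) (j : Fin k), (U : Matrix (Fin n) (Fin n) ℝ) i (Fin.castLE hkn j) = Q i j := by
  let v : Fin n → EuclideanSpace ℝ (Fin n) := fun j =>
    WithLp.toLp 2 fun i => if h : j.val < k then Q i ⟨j.val, h⟩ else 0
  have hv : Orthonormal ℝ (({j : Fin n | j.val < k} : Set (Fin n)).domRestrict v) := by
    rw [orthonormal_iff_ite]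
    rintro ⟨a, ha : a.val < k⟩ ⟨b, hb : b.val < k⟩
    have h := congrFun (congrFun hQ ⟨a.val, ha⟩) ⟨b.val, hb⟩
    rw [Matrix.mul_apply, Matrix.one_apply] at h
    have h2 : ((⟨a, ha⟩ : {j : Fin n | j.val < k}) = ⟨b, hb⟩) ↔
        ((⟨a.val, ha⟩ : Fin k) = ⟨b.val, hb⟩) := by
      simp [Fin.ext_iff]
    rw [if_congr h2 rfl rfl, ← h]
    simp [v, PiLp.inner_apply, ha, hb, mul_comm]
  obtain ⟨b, hb⟩ := hv.exists_orthonormalBasis_extension_of_card_eq (by simp)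
  have hU : (Matrix.of fun i j => b j i : Matrix (Fin n) (Fin n) ℝ) ∈
      Matrix.orthogonalGroup (Fin n) ℝ := by
    rw [Matrix.mem_orthogonalGroup_iff']
    ext i j
    rw [Matrix.mul_apply, Matrix.one_apply, ← orthonormal_iff_ite.1 b.orthonormal i j,
      PiLp.inner_apply]
    simp [mul_comm]
  refine ⟨⟨_, hU⟩, fun i j => ?_⟩
  have := hb (Fin.castLE hkn j) (by simp)
  simp [this, v]

/-- Polar decomposition: x(x'x)^{-1/2} has orthonormal columns, and U is an orthogonal matrix that
begins with them. -/
lemma exists_orthogonal_mul_padRows (hkn : k ≤ n) {x : MatSpace n k} (hx : (gram x).PosDef) :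
    ∃ U : Matrix.orthogonalGroup (Fin n) ℝ, ∀ y : MatSpace k m,
      toMat x * toMat y = (U : Matrix (Fin n) (Fin n) ℝ) *
        padRows n (ofMat (CFC.sqrt (gram x) * toMat y)) := by
  set T := CFC.sqrt (gram x) with hT
  have hu : IsUnit T.det := isUnit_iff_ne_zero.2 (sqrt_posDef hx).det_pos.ne'
  have hTT : T * T = gram x := sqrt_mul_sqrt hx.posSemidef
  have hTt : Tᵀ = T := sqrt_transpose _
  obtain ⟨U, hU⟩ := exists_orthogonal_extension (Q := toMat x * T⁻¹) hkn (by
    rw [Matrix.transpose_mul, Matrix.transpose_nonsing_inv, hTt, Matrix.mul_assoc,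
      ← Matrix.mul_assoc (toMat x)ᵀ, ← gram, ← hTT, Matrix.mul_assoc T,
      Matrix.mul_nonsing_inv _ hu, Matrix.mul_one, Matrix.nonsing_inv_mul _ hu])
  refine ⟨U, fun y => ?_⟩
  have h1 : ∀ z : MatSpace k m, (U : Matrix (Fin n) (Fin n) ℝ) * padRows n z =
      toMat x * T⁻¹ * toMat z := by
    intro z
    ext i j
    rw [Matrix.mul_apply, Matrix.mul_apply]
    have h2 : ∀ s : Fin n, s ∉ Set.range (Fin.castLE hkn) →
        (U : Matrix (Fin n) (Fin n) ℝ) i s * padRows n z s j = 0 := by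
      intro s hs
      have : ¬ s.val < k := fun h => hs ⟨⟨s.val, h⟩, rfl⟩
      simp [padRows, this]
    rw [← Fintype.sum_of_injective (Fin.castLE hkn) (Fin.castLE_injective hkn) _ _ h2 fun s => rfl]
    refine Finset.sum_congr rfl fun s _ => ?_
    rw [hU]
    congr 1
    simp [padRows, toMat]
  rw [h1, toMat_ofMat, Matrix.mul_assoc, ← Matrix.mul_assoc T⁻¹, Matrix.nonsing_inv_mul _ hu,
    Matrix.one_mul]

lemma continuous_ofMat_mul_padRows : Continuous
    fun q : MatSpace k m × Matrix.orthogonalGroup (Fin n) ℝ =>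
      (ofMat ((q.2 : Matrix (Fin n) (Fin n) ℝ) * padRows n q.1) : MatSpace n m) := by
  refine continuous_ofMat.comp ((continuous_subtype_val.comp continuous_snd).matrix_mul ?_)
  refine continuous_pi fun i => continuous_pi fun j => ?_
  simp only [padRows, Matrix.of_apply]
  split_ifs with h
  · fun_prop
  · exact continuous_const

lemma lintegral_rankMeasure {F : MatSpace n m → ℝ≥0∞} (hF : Measurable F) :
    ∫⁻ x, F x ∂(rankMeasure n m k) = ∫⁻ y : MatSpace k m, ∫⁻ V,
      F (ofMat ((V : Matrix (Fin n) (Fin n) ℝ) * padRows n y)) ∂(orthogonalHaar n) := by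
  have hm := continuous_ofMat_mul_padRows (n := n) (k := k) (m := m)
  rw [rankMeasure, lintegral_map hF hm.measurable, lintegral_prod]
  exact (hF.comp hm.measurable).aemeasurable

lemma lintegral_gauss_mulLeftIsometry (V : Matrix.orthogonalGroup (Fin n) ℝ)
    {F : MatSpace n k → ℝ≥0∞} (hF : Measurable F) :
    ∫⁻ x, F (mulLeftIsometry k V x) ∂(gaussMeasure n k) = ∫⁻ x, F x ∂(gaussMeasure n k) := by
  have hV : Measurable fun x => F (mulLeftIsometry k V x) :=
    hF.comp (mulLeftIsometry k V).continuous.measurable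
  rw [lintegral_gaussMeasure hF, lintegral_gaussMeasure hV]
  have h := (measurePreserving_mulLeftIsometry V).lintegral_comp_emb
    (measurableEmbedding_mulLeftIsometry V)
    fun x => ENNReal.ofReal (Real.exp (-(Real.pi * ‖x‖ ^ 2))) * F x
  simpa only [LinearIsometry.norm_map] using h

lemma ae_gaussMeasure_posDef (hkn : k ≤ n) : ∀ᵐ x ∂(gaussMeasure n k), (gram x).PosDef := by
  have := (withDensity_absolutelyContinuous volume fun x : MatSpace n k =>
    ENNReal.ofReal (Real.exp (-(Real.pi * ‖x‖ ^ 2)))).ae_le (ae_matAbs_ne_zero hkn)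
  filter_upwards [this] with x hx
  exact (gram_posDef_iff x).2 hx

/-- The law of the product of a standard Gaussian `n × k` matrix with a Lebesgue distributed
`k × m` matrix is a multiple of the measure of rank `k` matrices. -/
lemma lintegral_gauss_mul_eq (hkn : k ≤ n) {F : MatSpace n m → ℝ≥0∞} (hF : Measurable F) :
    ∫⁻ y : MatSpace k m, ∫⁻ x, F (mulRight n (toMat y) x) ∂(gaussMeasure n k) =
      gaussMoment n m k * ∫⁻ x, F x ∂(rankMeasure n m k) := by
  have hc : Continuous fun p : MatSpace k m × MatSpace n k => mulRight n (toMat p.1) p.2 :=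
    continuous_mulRight_uncurry.comp ((continuous_toMat.comp continuous_fst).prodMk continuous_snd)
  have hcF : Measurable fun p : MatSpace k m × MatSpace n k => F (mulRight n (toMat p.1) p.2) :=
    hF.comp hc.measurable
  set R := ∫⁻ x, F x ∂(rankMeasure n m k) with hR
  have hFV : Measurable fun p : (MatSpace k m × MatSpace n k) ×
      Matrix.orthogonalGroup (Fin n) ℝ => F (mulRight n (toMat p.1.1) (mulLeftIsometry k p.2 p.1.2))
      := by
    refine hF.comp (Continuous.measurable ?_)
    refine continuous_mulRight_uncurry.comp
      ((continuous_toMat.comp (continuous_fst.comp continuous_fst)).prodMk ?_)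
    exact continuous_ofMat.comp ((continuous_subtype_val.comp continuous_snd).matrix_mul
      (continuous_toMat.comp (continuous_snd.comp continuous_fst)))
  -- Here x = U[(x'x)^{1/2}; 0]. Haar measure absorbs U, and the substitution y ↦ (x'x)^{1/2} y
  -- contributes |x|_m^{-m}, so x enters only through this factor.
  have step : ∀ x : MatSpace n k, (gram x).PosDef →
      ∫⁻ y : MatSpace k m, ∫⁻ V, F (mulRight n (toMat y) (mulLeftIsometry k V x))
        ∂(orthogonalHaar n) = ENNReal.ofReal ((matAbs x)⁻¹ ^ m) * R := by
    intro x hx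
    obtain ⟨U, hU⟩ := exists_orthogonal_mul_padRows (m := m) hkn hx
    have hT := (sqrt_posDef hx).det_pos
    have h1 : ∀ y : MatSpace k m, ∫⁻ V, F (mulRight n (toMat y) (mulLeftIsometry k V x))
        ∂(orthogonalHaar n) = ∫⁻ V, F (ofMat ((V : Matrix (Fin n) (Fin n) ℝ) *
          padRows n (ofMat (CFC.sqrt (gram x) * toMat y)))) ∂(orthogonalHaar n) := by
      intro y
      have hm : Measurable fun V : Matrix.orthogonalGroup (Fin n) ℝ =>
          F (ofMat ((V : Matrix (Fin n) (Fin n) ℝ) *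
            padRows n (ofMat (CFC.sqrt (gram x) * toMat y)))) :=
        hF.comp ((continuous_ofMat_mul_padRows (n := n) (k := k) (m := m)).measurable.comp
          (measurable_prodMk_left (x := ofMat (CFC.sqrt (gram x) * toMat y))))
      rw [← lintegral_mul_right_orthogonalHaar U hm]
      refine lintegral_congr fun V => congrArg F (toMat_injective ?_)
      rw [toMat_mulRight, toMat_mulLeftIsometry, toMat_ofMat, Matrix.mul_assoc, hU,
        ← Matrix.mul_assoc]
      rfl
    simp_rw [h1]
    rw [lintegral_mulLeft _ hT.ne' fun y : MatSpace k m => ∫⁻ V,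
      F (ofMat ((V : Matrix (Fin n) (Fin n) ℝ) * padRows n y)) ∂(orthogonalHaar n),
      ← lintegral_rankMeasure hF, abs_of_pos hT, det_sqrt hx.posSemidef, matAbs]
  -- The Gaussian law is invariant under orthogonal factors on the left, so an average over O(n) can
  -- be inserted.
  calc ∫⁻ y : MatSpace k m, ∫⁻ x, F (mulRight n (toMat y) x) ∂(gaussMeasure n k)
      = ∫⁻ y : MatSpace k m, ∫⁻ V, ∫⁻ x, F (mulRight n (toMat y) (mulLeftIsometry k V x))
          ∂(gaussMeasure n k) ∂(orthogonalHaar n) := by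
        refine lintegral_congr fun y => ?_
        have h := fun V => lintegral_gauss_mulLeftIsometry V
          (hcF.comp (measurable_prodMk_left (x := y)))
        simp only [Function.comp_def] at h
        simp [h]
    _ = ∫⁻ y : MatSpace k m, ∫⁻ x, ∫⁻ V, F (mulRight n (toMat y) (mulLeftIsometry k V x))
          ∂(orthogonalHaar n) ∂(gaussMeasure n k) := by
        refine lintegral_congr fun y => lintegral_lintegral_swap ?_
        have : Measurable fun p : Matrix.orthogonalGroup (Fin n) ℝ × MatSpace n k =>
            ((y, p.2), p.1) :=
          (measurable_const.prodMk measurable_snd).prodMk measurable_fst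
        exact (hFV.comp this).aemeasurable
    _ = ∫⁻ x, ∫⁻ y : MatSpace k m, ∫⁻ V, F (mulRight n (toMat y) (mulLeftIsometry k V x))
          ∂(orthogonalHaar n) ∂volume ∂(gaussMeasure n k) :=
        lintegral_lintegral_swap hFV.lintegral_prod_right'.aemeasurable
    _ = ∫⁻ x, ENNReal.ofReal ((matAbs x)⁻¹ ^ m) * R ∂(gaussMeasure n k) := by
        refine lintegral_congr_ae ?_
        filter_upwards [ae_gaussMeasure_posDef hkn] with x hx
        exact step x hx
    _ = gaussMoment n m k * R :=
        lintegral_mul_const _ (continuous_matAbs.measurable.inv.pow_const m).ennreal_ofReal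

lemma continuous_mulRight_toMat :
    Continuous fun p : MatSpace k m × MatSpace n k => mulRight n (toMat p.1) p.2 :=
  continuous_mulRight_uncurry.comp ((continuous_toMat.comp continuous_fst).prodMk continuous_snd)

lemma map_gauss_mul (hkn : k ≤ n) :
    Measure.map (fun p : MatSpace k m × MatSpace n k => mulRight n (toMat p.1) p.2)
      (volume.prod (gaussMeasure n k)) = gaussMoment n m k • rankMeasure n m k := by
  refine Measure.ext_of_lintegral _ fun F hF => ?_
  rw [lintegral_map hF continuous_mulRight_toMat.measurable, lintegral_smul_measure, smul_eq_mul,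
    ← lintegral_gauss_mul_eq hkn hF]
  exact lintegral_prod _ (hF.comp continuous_mulRight_toMat.measurable).aemeasurable

/-- Hence c_k times the rank measure is (2π)^{-km} times the law of G y, which fixes the weight of
the mixture. -/
lemma rankConst_eq (hmn : m ≤ n) (hk : k ≤ n - m) :
    rankConst n m k = (((2 * Real.pi) ^ (k * m))⁻¹ : ℝ) * ((gaussMoment n m k).toReal : ℂ) := by
  have hkn : k ≤ n := by omega
  rw [gaussMoment_eq hkn hmn, ENNReal.toReal_div, ENNReal.toReal_mul,
    ENNReal.toReal_ofReal (by positivity), rankConst]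
  have h1 := siegelGamma_ofReal (m := m) (((n : ℝ) - k) / 2)
  have h2 := siegelGamma_ofReal (m := m) ((n : ℝ) / 2)
  push_cast at h1 h2
  rw [h1, h2, two_cpow_eq_exp, ofReal_cpow_eq_exp Real.pi_pos]
  have h3 : (2 * Real.pi) ^ (k * m) = Real.exp ((k * m) * (Real.log 2 + Real.log Real.pi)) := by
    rw [← Real.log_mul two_ne_zero Real.pi_ne_zero, mul_comm ((k : ℝ) * m), Real.exp_mul,
      Real.exp_log (by positivity), ← Nat.cast_mul, Real.rpow_natCast]
  have h4 : Real.pi ^ ((k : ℝ) * m / 2) = Real.exp ((k : ℝ) * m / 2 * Real.log Real.pi) := by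
    rw [Real.rpow_def_of_pos Real.pi_pos, mul_comm]
  rw [h3, h4, ← Real.exp_neg]
  have h5 : Complex.exp (-((k : ℂ) * m) * (Real.log 2 : ℝ)) *
      Complex.exp (-((k : ℂ) * m / 2) * (Real.log Real.pi : ℝ)) =
      ((Real.exp (-((k * m) * (Real.log 2 + Real.log Real.pi))) : ℝ) : ℂ) *
        ((Real.exp ((k : ℝ) * m / 2 * Real.log Real.pi) : ℝ) : ℂ) := by
    rw [Complex.ofReal_exp, Complex.ofReal_exp, ← Complex.exp_add, ← Complex.exp_add]
    congr 1
    push_cast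
    ring
  rw [h5]
  push_cast
  ring

lemma pi_norm_sq_mulRight_transpose (z : MatSpace n m) (y : MatSpace k m) :
    Real.pi * ‖mulRight n (toMat y)ᵀ z‖ ^ 2 = (gram y * (Real.pi • gram z)).trace := by
  rw [norm_sq_eq_trace_gram, gram_mulRight, Matrix.transpose_transpose, Matrix.mul_smul,
    Matrix.trace_smul, smul_eq_mul, Matrix.trace_mul_comm, ← Matrix.mul_assoc, gram, gram]

lemma lintegral_exp_neg_norm_sq_mulRight {z : MatSpace n m} (hz : matAbs z ≠ 0) :
    ∫⁻ y : MatSpace k m, ENNReal.ofReal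
      (Real.exp (-(Real.pi * ‖mulRight n (toMat y)ᵀ z‖ ^ 2))) =
      ENNReal.ofReal (matAbs z ^ (-(k : ℝ))) := by
  have hz' : 0 < matAbs z := lt_of_le_of_ne (matAbs_nonneg z) hz.symm
  simp only [pi_norm_sq_mulRight_transpose]
  rw [lintegral_exp_neg_trace_gram_mul (posDef_pi_smul ((gram_posDef_iff z).2 hz)),
    det_pi_smul_gram, Real.mul_rpow (by positivity) (by positivity), ← mul_assoc,
    ← Real.rpow_natCast, ← Real.rpow_mul Real.pi_pos.le, ← Real.rpow_add Real.pi_pos,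
    ← Real.rpow_natCast (matAbs z), ← Real.rpow_mul hz'.le]
  ring_nf
  simp

/-- The Gaussian mixture of the Riesz potentials carried by matrices of low rank. -/
def rieszMixtureOfNat (hm : 1 ≤ m) (hmn : m ≤ n) (hk : k ≤ n - m) (hkm : k ≤ m - 1) :
    RieszMixture n m (k : ℂ) where
  S := MatSpace k m
  Λ := volume
  l := k
  c := toMat
  meas_c := continuous_toMat.measurable
  ω _ := (((2 * Real.pi) ^ (k * m))⁻¹ : ℝ)
  meas_ω := measurable_const
  lintegral_det_lt_top b hb := by
    rw [lintegral_const_mul' _ _ enorm_ne_top]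
    refine ENNReal.mul_lt_top enorm_lt_top (lintegral_one_add_gram_lt_top ?_)
    simpa using hb
  integral_exp z hz := by
    have hz' : 0 < matAbs z := lt_of_le_of_ne (matAbs_nonneg z) hz.symm
    rw [integral_const_mul, integral_complex_ofReal, integral_eq_lintegral_of_nonneg_ae
      (Eventually.of_forall fun y => (Real.exp_pos _).le)
      (by
        simp only [pi_norm_sq_mulRight_transpose]
        have h1 : Continuous fun y : MatSpace k m =>
            Real.exp (-(gram y * (Real.pi • gram z)).trace) :=
          Real.continuous_exp.comp (continuous_gram.matrix_mul continuous_const).matrix_trace.neg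
        exact h1.aestronglyMeasurable),
      lintegral_exp_neg_norm_sq_mulRight hz, ENNReal.toReal_ofReal (by positivity),
      ← Complex.ofReal_mul, ← Complex.ofReal_natCast, ← Complex.ofReal_neg,
      ← Complex.ofReal_cpow (by positivity)]
    rw [Real.mul_rpow (by positivity) hz'.le, ← Real.rpow_natCast _ m,
      ← Real.rpow_mul (by positivity), mul_neg, ← Nat.cast_mul,
      Real.rpow_neg (by positivity) ((m * k : ℕ) : ℝ), Real.rpow_natCast, mul_comm m k]
  lintegral_exp_le := by
    refine ⟨((2 * Real.pi) ^ (k * m))⁻¹, fun z hz => le_of_eq ?_⟩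
    rw [lintegral_const_mul' _ _ enorm_ne_top, lintegral_exp_neg_norm_sq_mulRight hz,
      ENNReal.ofReal_mul (by positivity), ← ofReal_norm, Complex.norm_real,
      Real.norm_of_nonneg (by positivity), Complex.natCast_re]
  rep f hf x hint := by
    have hkn : k ≤ n := by omega
    have hc : (((((2 * Real.pi) ^ (k * m))⁻¹ : ℝ)) : ℂ) ≠ 0 := by
      have : (((2 * Real.pi) ^ (k * m))⁻¹ : ℝ) ≠ 0 := by positivity
      exact_mod_cast this
    -- The definition recovers the rank as ⌊Re α⌋₊, and k ≤ m - 1 selects its second branch.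
    have hfl : ⌊(k : ℂ).re⌋₊ = k := by simp
    have hlt : ¬ (m : ℝ) - 1 < (k : ℂ).re := by
      have : (k : ℝ) + 1 ≤ m := by exact_mod_cast (by omega : k + 1 ≤ m)
      simp only [Complex.natCast_re]
      linarith
    have hM := gaussMoment_pos_lt_top hmn hk
    have hfx : Measurable fun y => f (x - y) := hf.comp (measurable_const.sub measurable_id)
    have hmap := map_gauss_mul (m := m) hkn
    have hint' : Integrable (fun y => f (x - y)) (rankMeasure n m k) := by
      have h1 := (integrable_mul_const_iff (isUnit_iff_ne_zero.2 hc) _).1 hint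
      rw [← integrable_smul_measure hM.1 hM.2, ← hmap, integrable_map_measure
        hfx.aestronglyMeasurable continuous_mulRight_toMat.measurable.aemeasurable]
      exact h1
    constructor
    · rw [RieszConverges, if_neg hlt, hfl]
      exact hint'
    · rw [rieszPotential, if_neg hlt, hfl, rankConst_eq hmn hk, mul_assoc, ← Complex.real_smul
        (x := (gaussMoment n m k).toReal), ← integral_smul_measure, ← hmap, integral_map
        continuous_mulRight_toMat.measurable.aemeasurable hfx.aestronglyMeasurable,
        integral_mul_const, mul_comm]

lemma exists_rieszMixture (hm : 1 ≤ m) (hmn : m ≤ n) {α : ℂ} (hα : α ∈ wallachSet n m)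
    (hα' : α.re < (n : ℝ) - m + 1) : Nonempty (RieszMixture n m α) := by
  rcases hα with ⟨k, hk, rfl⟩ | ⟨h, -⟩
  · exact ⟨rieszMixtureOfNat hm hmn (hk.trans (min_le_right _ _)) (hk.trans (min_le_left _ _))⟩
  · exact ⟨rieszMixtureOfLt hm hmn h hα'⟩

end RankCase

end

end MatrixWavelet

namespace MatrixWavelet

noncomputable section

open scoped RealInnerProductSpace Matrix

/-! ### Uniform L^p bounds for Gaussian averages. -/

section LpBound

variable {n m l : ℕ}

/-! ### Uniform bounds for Gaussian averages of `L^p` functions -/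

/-- The point g₀ minimises |g|² + |u - gc|². The normal equation g₀ = (u - g₀c)c' cancels the cross
terms, and the minimum value, being nonnegative, is dropped. -/
lemma exists_center (c : Matrix (Fin l) (Fin m) ℝ) (u : MatSpace n m) :
    ∃ g₀ : MatSpace n l, ∀ g : MatSpace n l,
      ‖g - g₀‖ ^ 2 + ‖mulRight n c (g - g₀)‖ ^ 2 ≤ ‖g‖ ^ 2 + ‖u - mulRight n c g‖ ^ 2 := by
  have hpd : (1 + c * cᵀ).PosDef := Matrix.PosDef.one.add_posSemidef (by
    simpa [Matrix.conjTranspose_eq_transpose_of_trivial] using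
      Matrix.posSemidef_self_mul_conjTranspose c)
  have hu : IsUnit (1 + c * cᵀ).det := isUnit_iff_ne_zero.2 hpd.det_pos.ne'
  set g₀ := mulRight n (cᵀ * (1 + c * cᵀ)⁻¹) u with hg₀
  have h0 : g₀ = mulRight n cᵀ (u - mulRight n c g₀) := by
    apply toMat_injective
    have h1 : toMat g₀ * (1 + c * cᵀ) = toMat u * cᵀ := by
      rw [hg₀, toMat_mulRight, ← Matrix.mul_assoc, Matrix.mul_assoc,
        Matrix.nonsing_inv_mul _ hu, Matrix.mul_one]
    rw [map_sub, sub_eq_add_neg, toMat_add, toMat_neg, toMat_mulRight cᵀ,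
      toMat_mulRight cᵀ, toMat_mulRight c, ← h1, Matrix.mul_add, Matrix.mul_one, Matrix.mul_assoc]
    abel
  refine ⟨g₀, fun g => ?_⟩
  obtain ⟨h, rfl⟩ : ∃ h, g = h + g₀ := ⟨g - g₀, by abel⟩
  have h2 : ⟪h, g₀⟫ = ⟪mulRight n c h, u - mulRight n c g₀⟫ := by
    conv_lhs => rw [h0]
    rw [inner_mulRight]
  rw [add_sub_cancel_right, norm_add_sq_real, h2,
    show u - mulRight n c (h + g₀) = (u - mulRight n c g₀) - mulRight n c h by
      rw [map_add]; abel,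
    norm_sub_sq_real, real_inner_comm]
  nlinarith [sq_nonneg ‖g₀‖, sq_nonneg ‖u - mulRight n c g₀‖]

/-- This is the Gaussian integral with matrix πθ(1 + cc'), and |1 + cc'| = |1 + c'c|. -/
lemma lintegral_exp_neg_norm_sq_add (c : Matrix (Fin l) (Fin m) ℝ) {θ : ℝ} (hθ : 0 < θ) :
    ∫⁻ g : MatSpace n l,
      ENNReal.ofReal (Real.exp (-(Real.pi * θ * (‖g‖ ^ 2 + ‖mulRight n c g‖ ^ 2)))) =
      ENNReal.ofReal (θ ^ (-((n : ℝ) * l / 2)) * (1 + cᵀ * c).det ^ (-((n : ℝ) / 2))) := by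
  have hpd : (1 + c * cᵀ).PosDef := Matrix.PosDef.one.add_posSemidef (by
    simpa [Matrix.conjTranspose_eq_transpose_of_trivial] using
      Matrix.posSemidef_self_mul_conjTranspose c)
  have hpt : 0 < Real.pi * θ := by positivity
  have h := lintegral_exp_neg_trace_gram_mul (n := n) (hpd.smul hpt)
  have hd := hpd.det_pos
  rw [Matrix.det_smul, Fintype.card_fin, Real.mul_rpow (by positivity) hd.le,
    ← Matrix.det_one_add_mul_comm, ← Real.rpow_natCast, ← Real.rpow_mul hpt.le,
    Real.mul_rpow Real.pi_pos.le hθ.le] at h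
  refine Eq.trans (lintegral_congr fun g => ?_) (h.trans ?_)
  · congr 3
    rw [Matrix.mul_smul, Matrix.trace_smul, smul_eq_mul, Matrix.mul_add, Matrix.mul_one,
      Matrix.trace_add, norm_sq_eq_trace_gram, norm_sq_eq_trace_gram, gram_mulRight,
      ← Matrix.mul_assoc, Matrix.trace_mul_comm (gram g * c), ← Matrix.mul_assoc]
  · congr 1
    rw [← mul_assoc, ← mul_assoc, ← Real.rpow_add Real.pi_pos]
    ring_nf
    simp

/-- In the variable u = y + Gc, g(x - u) is integrated against a density that has to be bounded
uniformly. Since θ ≤ 1, exp(-π|G|²) ≤ exp(-πθ|G|²), and completing the square at `exists_center`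
bounds the density by the preceding integral. -/
lemma lintegral_gauss_shift_le (c : Matrix (Fin l) (Fin m) ℝ) {θ : ℝ} (hθ : 0 < θ) (hθ1 : θ ≤ 1)
    {g : MatSpace n m → ℝ≥0∞} (hg : Measurable g) (x : MatSpace n m) :
    ∫⁻ G, ∫⁻ y, ENNReal.ofReal (Real.exp (-(Real.pi * θ * ‖y‖ ^ 2))) *
        g (x - y - mulRight n c G) ∂volume ∂(gaussMeasure n l) ≤
      ENNReal.ofReal (θ ^ (-((n : ℝ) * l / 2)) * (1 + cᵀ * c).det ^ (-((n : ℝ) / 2))) *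
        ∫⁻ y, g y := by
  have hcont : Continuous (mulRight n c) := (mulRight n c).continuous_of_finiteDimensional
  have h1 : ∀ G : MatSpace n l, ∫⁻ y, ENNReal.ofReal (Real.exp (-(Real.pi * θ * ‖y‖ ^ 2))) *
      g (x - y - mulRight n c G) = ∫⁻ u, ENNReal.ofReal
        (Real.exp (-(Real.pi * θ * ‖u - mulRight n c G‖ ^ 2))) * g (x - u) := by
    intro G
    refine (lintegral_sub_right_eq_self (fun y => ENNReal.ofReal
      (Real.exp (-(Real.pi * θ * ‖y‖ ^ 2))) * g (x - y - mulRight n c G))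
      (mulRight n c G)).symm.trans (lintegral_congr fun u => ?_)
    congr 2
    abel
  simp_rw [h1]
  have hm1 : Measurable fun p : MatSpace n l × MatSpace n m => ENNReal.ofReal
      (Real.exp (-(Real.pi * θ * ‖p.2 - mulRight n c p.1‖ ^ 2))) := by
    fun_prop
  have hm2 : Measurable fun p : MatSpace n l × MatSpace n m => g (x - p.2) :=
    hg.comp (measurable_const.sub measurable_snd)
  rw [lintegral_lintegral_swap (hm1.mul hm2).aemeasurable]
  have hx : ∫⁻ y, g y = ∫⁻ u, g (x - u) := (lintegral_sub_left_eq_self g x).symm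
  have hgm : Measurable fun u => g (x - u) := hg.comp (measurable_const.sub measurable_id)
  rw [hx, ← lintegral_const_mul _ hgm]
  refine lintegral_mono fun u => ?_
  have hm3 : Measurable fun G : MatSpace n l => ENNReal.ofReal
      (Real.exp (-(Real.pi * θ * ‖u - mulRight n c G‖ ^ 2))) := by
    fun_prop
  rw [lintegral_mul_const _ hm3]
  refine mul_le_mul_left ?_ _
  rw [lintegral_gaussMeasure hm3]
  obtain ⟨g₀, hg₀⟩ := exists_center c u
  rw [← lintegral_exp_neg_norm_sq_add c hθ, ← lintegral_sub_right_eq_self (fun g : MatSpace n l =>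
    ENNReal.ofReal (Real.exp (-(Real.pi * θ * (‖g‖ ^ 2 + ‖mulRight n c g‖ ^ 2))))) g₀]
  refine lintegral_mono fun G => ?_
  rw [← ENNReal.ofReal_mul (Real.exp_pos _).le, ← Real.exp_add]
  refine ENNReal.ofReal_le_ofReal (Real.exp_le_exp.2 ?_)
  have h2 := mul_le_mul_of_nonneg_left (hg₀ G) (mul_pos Real.pi_pos hθ).le
  have h3 : Real.pi * θ * ‖G‖ ^ 2 ≤ Real.pi * ‖G‖ ^ 2 :=
    mul_le_mul_of_nonneg_right (mul_le_of_le_one_right Real.pi_pos.le hθ1) (sq_nonneg _)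
  linarith

lemma lintegral_exp_neg_mul_norm_sq {θ : ℝ} (hθ : 0 < θ) :
    ∫⁻ y : MatSpace n m, ENNReal.ofReal (Real.exp (-(Real.pi * θ * ‖y‖ ^ 2))) =
      ENNReal.ofReal (θ ^ (-((n : ℝ) * m / 2))) := by
  -- With no columns, the second norm vanishes and the determinant is 1.
  have h := lintegral_exp_neg_norm_sq_add (n := n) (0 : Matrix (Fin m) (Fin 0) ℝ) hθ
  have h0 : ∀ g : MatSpace n m, mulRight n (0 : Matrix (Fin m) (Fin 0) ℝ) g = 0 := fun g =>
    toMat_injective (by ext i j; exact j.elim0)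
  simpa [h0] using h

/-- Hölder's inequality on a finite measure passes from |f| to |f|^p, to which the density bound
applies. The power of θ is not sharp; θ ≤ 1 permits a cruder one that does not depend on p. -/
lemma lintegral_gauss_shift_enorm_le (c : Matrix (Fin l) (Fin m) ℝ) {θ : ℝ} (hθ : 0 < θ)
    (hθ1 : θ ≤ 1) {p : ℝ} (hp : 1 ≤ p) {f : MatSpace n m → ℂ} (hf : Measurable f)
    (x : MatSpace n m) :
    ∫⁻ G, ∫⁻ y, ENNReal.ofReal (Real.exp (-(Real.pi * θ * ‖y‖ ^ 2))) *
        ‖f (x - y - mulRight n c G)‖ₑ ∂volume ∂(gaussMeasure n l) ≤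
      ENNReal.ofReal (θ ^ (-((n : ℝ) * l / 2 + (n : ℝ) * m / 2))) *
        (ENNReal.ofReal ((1 + cᵀ * c).det ^ (-((n : ℝ) / (2 * p)))) *
          eLpNorm f (ENNReal.ofReal p) volume) := by
  have hp0 : 0 < p := by linarith
  have hD : 0 < (1 + cᵀ * c).det := det_one_add_posSemidef_pos (by
    simpa [Matrix.conjTranspose_eq_transpose_of_trivial] using
      Matrix.posSemidef_conjTranspose_mul_self c)
  set δ : MatSpace n m → ℝ≥0∞ := fun y => ENNReal.ofReal (Real.exp (-(Real.pi * θ * ‖y‖ ^ 2)))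
    with hδ
  have hδm : Measurable δ := by fun_prop
  set ν : Measure (MatSpace n m) := volume.withDensity δ with hν
  have hcont : Continuous (mulRight n c) := (mulRight n c).continuous_of_finiteDimensional
  have hsh : Measurable fun q : MatSpace n l × MatSpace n m => x - q.2 - mulRight n c q.1 := by
    fun_prop
  have hν1 : ν Set.univ = ENNReal.ofReal (θ ^ (-((n : ℝ) * m / 2))) := by
    rw [hν, withDensity_apply _ MeasurableSet.univ, Measure.restrict_univ,
      lintegral_exp_neg_mul_norm_sq hθ]
  have hνf : IsFiniteMeasure ν := ⟨by rw [hν1]; exact ENNReal.ofReal_lt_top⟩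
  have hP : ((gaussMeasure n l).prod ν) Set.univ = ENNReal.ofReal (θ ^ (-((n : ℝ) * m / 2))) := by
    rw [← Set.univ_prod_univ, Measure.prod_prod, measure_univ, one_mul, hν1]
  have key : ∀ g : MatSpace n m → ℝ≥0∞, Measurable g →
      ∫⁻ q, g (x - q.2 - mulRight n c q.1) ∂((gaussMeasure n l).prod ν) =
        ∫⁻ G, ∫⁻ y, δ y * g (x - y - mulRight n c G) ∂volume ∂(gaussMeasure n l) := by
    intro g hg
    refine (lintegral_prod _ (hg.comp hsh).aemeasurable).trans (lintegral_congr fun G => ?_)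
    exact lintegral_withDensity_eq_lintegral_mul _ hδm
      ((hg.comp hsh).comp (measurable_prodMk_left (x := G)))
  have hfs : AEStronglyMeasurable (fun q : MatSpace n l × MatSpace n m =>
      f (x - q.2 - mulRight n c q.1)) ((gaussMeasure n l).prod ν) :=
    (hf.comp hsh).aestronglyMeasurable
  have hle := eLpNorm_le_eLpNorm_mul_rpow_measure_univ (p := 1) (q := ENNReal.ofReal p)
    (by rw [← ENNReal.ofReal_one]; exact ENNReal.ofReal_le_ofReal hp) hfs
  rw [eLpNorm_one_eq_lintegral_enorm, key _ hf.enorm, hP,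
    eLpNorm_eq_lintegral_rpow_enorm_toReal (by simpa using hp0) ENNReal.ofReal_ne_top,
    ENNReal.toReal_ofReal hp0.le, key (fun y => ‖f y‖ₑ ^ p) (hf.enorm.pow_const p)] at hle
  refine hle.trans ?_
  have h4 := lintegral_gauss_shift_le (n := n) c hθ hθ1 (hf.enorm.pow_const p) x
  have h5 := ENNReal.rpow_le_rpow h4 (show 0 ≤ 1 / p by positivity)
  rw [ENNReal.mul_rpow_of_nonneg _ _ (by positivity)] at h5
  refine (mul_le_mul_left h5 _).trans ?_
  rw [eLpNorm_eq_lintegral_rpow_enorm_toReal (by simpa using hp0) ENNReal.ofReal_ne_top,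
    ENNReal.toReal_ofReal hp0.le, mul_right_comm, ← mul_assoc]
  refine mul_le_mul_left ?_ _
  rw [ENNReal.ofReal_rpow_of_nonneg (by positivity) (by positivity),
    ENNReal.ofReal_rpow_of_nonneg (by positivity) (by
      simp only [ENNReal.toReal_one, div_one]
      rw [sub_nonneg]
      exact (div_le_one hp0).2 hp), ← ENNReal.ofReal_mul (by positivity),
    ← ENNReal.ofReal_mul (by positivity)]
  refine ENNReal.ofReal_le_ofReal ?_
  rw [Real.mul_rpow (by positivity) (by positivity), ← Real.rpow_mul hθ.le, ← Real.rpow_mul hθ.le,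
    ← Real.rpow_mul hD.le, mul_right_comm, ← Real.rpow_add hθ]
  have hn : (0 : ℝ) ≤ n * l := by positivity
  have hn' : (0 : ℝ) ≤ n * m := by positivity
  have hq : 1 / p ≤ 1 := (div_le_one hp0).2 hp
  have hq0 : 0 ≤ 1 / p := by positivity
  have hexp : -((n : ℝ) / 2) * (1 / p) = -((n : ℝ) / (2 * p)) := by field_simp
  rw [hexp]
  refine mul_le_mul_of_nonneg_right (Real.rpow_le_rpow_of_exponent_ge hθ hθ1 ?_) (by positivity)
  simp only [ENNReal.toReal_one, div_one]
  nlinarith [mul_nonneg hn (sub_nonneg.2 hq), mul_nonneg hn' hq0]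

/-- A polynomial weight is dominated by a superposition of Gaussians: for θ ≤ 1/(1 + r) one has θr ≤
1, so the exponential is at least e^{-π}, and the integral of θ^N over this range is (1 +
r)^{-N-1}/(N + 1). -/
lemma one_add_inv_pow_le (N : ℕ) {r : ℝ} (hr : 0 ≤ r) :
    ENNReal.ofReal ((1 + r)⁻¹ ^ (N + 1)) ≤ ENNReal.ofReal ((N + 1) * Real.exp Real.pi) *
      ∫⁻ θ in Set.Ioc (0 : ℝ) 1, ENNReal.ofReal (θ ^ N * Real.exp (-(Real.pi * θ * r))) := by
  have h1r : 0 < 1 + r := by linarith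
  have hi : (1 + r)⁻¹ ≤ 1 := inv_le_one_of_one_le₀ (by linarith)
  have hi0 : 0 < (1 + r)⁻¹ := by positivity
  have hlow : ∫⁻ θ in Set.Ioc (0 : ℝ) (1 + r)⁻¹, ENNReal.ofReal (θ ^ N * Real.exp (-Real.pi)) ≤
      ∫⁻ θ in Set.Ioc (0 : ℝ) 1, ENNReal.ofReal (θ ^ N * Real.exp (-(Real.pi * θ * r))) := by
    refine le_trans (setLIntegral_mono (by fun_prop) fun θ hθ => ?_)
      (lintegral_mono_set (Set.Ioc_subset_Ioc_right hi))
    refine ENNReal.ofReal_le_ofReal (mul_le_mul_of_nonneg_left (Real.exp_le_exp.2 ?_)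
      (pow_nonneg hθ.1.le N))
    have : θ * r ≤ 1 := by
      calc θ * r ≤ (1 + r)⁻¹ * (1 + r) :=
            mul_le_mul hθ.2 (by linarith) hr hi0.le
        _ = 1 := inv_mul_cancel₀ h1r.ne'
    have := mul_le_mul_of_nonneg_left this Real.pi_pos.le
    linarith
  have hval : ∫⁻ θ in Set.Ioc (0 : ℝ) (1 + r)⁻¹, ENNReal.ofReal (θ ^ N * Real.exp (-Real.pi)) =
      ENNReal.ofReal ((1 + r)⁻¹ ^ (N + 1) / (N + 1) * Real.exp (-Real.pi)) := by
    rw [← ofReal_integral_eq_lintegral_ofReal]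
    · rw [← intervalIntegral.integral_of_le hi0.le, intervalIntegral.integral_mul_const,
        integral_pow]
      simp
    · have : Continuous fun θ : ℝ => θ ^ N * Real.exp (-Real.pi) := by fun_prop
      exact (this.integrableOn_Icc).mono_set Set.Ioc_subset_Icc_self
    · refine (ae_restrict_iff' measurableSet_Ioc).2 (Eventually.of_forall fun θ hθ => ?_)
      exact mul_nonneg (pow_nonneg hθ.1.le N) (Real.exp_pos _).le
  rw [hval] at hlow
  refine le_trans ?_ (mul_le_mul_right hlow _)
  rw [← ENNReal.ofReal_mul (by positivity)]
  refine ENNReal.ofReal_le_ofReal (le_of_eq ?_)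
  rw [Real.exp_neg]
  field_simp

/-- The order of decay at which all averages of `L^p` functions over a Gaussian mixture converge. -/
def RieszMixture.order {α : ℂ} (R : RieszMixture n m α) : ℕ := n * R.l + n * m + 1

lemma RieszMixture.measurable_shift {α : ℂ} (R : RieszMixture n m α) :
    Measurable fun q : R.S × MatSpace n R.l => mulRight n (R.c q.1) q.2 :=
  continuous_mulRight_uncurry.measurable.comp
    ((R.meas_c.comp measurable_fst).prodMk measurable_snd)

/-- The Gaussian bounds are superposed over θ ∈ (0, 1]. Their blow-up θ^{-N/2} is absorbed by θ^N,
where N = nl + nm. The hypothesis on p makes the remaining integral over the mixture finite. -/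
theorem RieszMixture.exists_lintegral_le {α : ℂ} (R : RieszMixture n m α) {p : ℝ} (hp : 1 ≤ p)
    (hp' : (α.re + m - 1) / 2 < n / (2 * p)) {f : MatSpace n m → ℂ} (hf : Measurable f)
    (hfp : MemLp f (ENNReal.ofReal p) volume) : ∃ C : ℝ≥0∞, C ≠ ⊤ ∧ ∀ x : MatSpace n m,
      ∫⁻ y, ENNReal.ofReal ((1 + ‖y‖ ^ 2)⁻¹ ^ R.order) *
        ∫⁻ q, ‖f (x - y - mulRight n (R.c q.1) q.2) * R.ω q.1‖ₑ
          ∂(R.Λ.prod (gaussMeasure n R.l)) ∂volume ≤ C := by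
  set N := n * R.l + n * m with hN
  set K := ∫⁻ s, ‖R.ω s‖ₑ * ENNReal.ofReal ((1 + (R.c s)ᵀ * R.c s).det ^ (-((n : ℝ) / (2 * p))))
    ∂(R.Λ) with hK
  refine ⟨ENNReal.ofReal ((N + 1) * Real.exp Real.pi) *
    (K * eLpNorm f (ENNReal.ofReal p) volume), ENNReal.mul_ne_top ENNReal.ofReal_ne_top
      (ENNReal.mul_ne_top (R.lintegral_det_lt_top _ hp').ne hfp.2.ne), fun x => ?_⟩
  set δ : ℝ → MatSpace n m → ℝ≥0∞ := fun θ y =>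
    ENNReal.ofReal (Real.exp (-(Real.pi * θ * ‖y‖ ^ 2))) with hδ
  have hδm : Measurable fun r : ℝ × MatSpace n m => δ r.1 r.2 := by
    simp only [hδ]
    fun_prop
  set F : MatSpace n m → R.S × MatSpace n R.l → ℝ≥0∞ := fun y q =>
    ‖f (x - y - mulRight n (R.c q.1) q.2) * R.ω q.1‖ₑ with hF
  have hFm : Measurable fun r : MatSpace n m × (R.S × MatSpace n R.l) => F r.1 r.2 := by
    refine Measurable.enorm (Measurable.mul (hf.comp ?_) (R.meas_ω.comp ?_))
    · exact (measurable_const.sub measurable_fst).sub (R.measurable_shift.comp measurable_snd)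
    · exact measurable_fst.comp measurable_snd
  set B : MatSpace n m → ℝ≥0∞ := fun y => ∫⁻ q, F y q ∂(R.Λ.prod (gaussMeasure n R.l)) with hB
  have hBm : Measurable B := hFm.lintegral_prod_right'
  have step : ∀ θ ∈ Set.Ioc (0 : ℝ) 1, ENNReal.ofReal (θ ^ N) * ∫⁻ y, δ θ y * B y ≤
      K * eLpNorm f (ENNReal.ofReal p) volume := by
    intro θ hθ
    have h1 : ∫⁻ y, δ θ y * B y = ∫⁻ s, ∫⁻ G, ∫⁻ y, δ θ y * F y (s, G) ∂volume
        ∂(gaussMeasure n R.l) ∂(R.Λ) := by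
      have hm : Measurable fun r : MatSpace n m × (R.S × MatSpace n R.l) =>
          δ θ r.1 * F r.1 r.2 :=
        (hδm.comp (measurable_const.prodMk measurable_fst)).mul hFm
      calc ∫⁻ y, δ θ y * B y
          = ∫⁻ y, ∫⁻ q, δ θ y * F y q ∂(R.Λ.prod (gaussMeasure n R.l)) :=
            lintegral_congr fun y =>
              (lintegral_const_mul' _ _ ENNReal.ofReal_ne_top).symm
        _ = ∫⁻ q, ∫⁻ y, δ θ y * F y q ∂volume ∂(R.Λ.prod (gaussMeasure n R.l)) :=
            lintegral_lintegral_swap hm.aemeasurable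
        _ = _ := lintegral_prod _ hm.lintegral_prod_left'.aemeasurable
    have h2 : ∀ s, ∫⁻ G, ∫⁻ y, δ θ y * F y (s, G) ∂volume ∂(gaussMeasure n R.l) ≤
        ENNReal.ofReal (θ ^ (-((n : ℝ) * R.l / 2 + (n : ℝ) * m / 2))) *
          (‖R.ω s‖ₑ * ENNReal.ofReal ((1 + (R.c s)ᵀ * R.c s).det ^ (-((n : ℝ) / (2 * p)))) *
            eLpNorm f (ENNReal.ofReal p) volume) := by
      intro s
      have h3 := mul_le_mul_right
        (lintegral_gauss_shift_enorm_le (n := n) (R.c s) hθ.1 hθ.2 hp hf x) ‖R.ω s‖ₑ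
      rw [← lintegral_const_mul' _ _ enorm_ne_top] at h3
      refine le_of_eq_of_le (lintegral_congr fun G => ?_) (h3.trans (le_of_eq ?_))
      · rw [← lintegral_const_mul' _ _ enorm_ne_top]
        refine lintegral_congr fun y => ?_
        simp only [hF, hδ, enorm_mul]
        ring
      · ring
    rw [h1]
    refine (mul_le_mul_right (lintegral_mono h2) _).trans ?_
    rw [lintegral_const_mul' _ _ ENNReal.ofReal_ne_top, lintegral_mul_const' _ _ hfp.2.ne,
      ← mul_assoc, ← ENNReal.ofReal_mul (pow_nonneg hθ.1.le _)]
    refine mul_le_of_le_one_left zero_le ?_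
    rw [← ENNReal.ofReal_one]
    refine ENNReal.ofReal_le_ofReal ?_
    rw [← Real.rpow_natCast, ← Real.rpow_add hθ.1]
    refine Real.rpow_le_one hθ.1.le hθ.2 ?_
    rw [hN]
    push_cast
    have hn : (0 : ℝ) ≤ n * R.l := by positivity
    have hn' : (0 : ℝ) ≤ n * m := by positivity
    linarith
  calc ∫⁻ y, ENNReal.ofReal ((1 + ‖y‖ ^ 2)⁻¹ ^ (N + 1)) * B y
      ≤ ∫⁻ y, ENNReal.ofReal ((N + 1) * Real.exp Real.pi) *
          ∫⁻ θ in Set.Ioc (0 : ℝ) 1, ENNReal.ofReal (θ ^ N) * (δ θ y * B y) := by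
        refine lintegral_mono fun y => ?_
        refine (mul_le_mul_left (one_add_inv_pow_le N (sq_nonneg ‖y‖)) _).trans ?_
        rw [mul_assoc]
        refine mul_le_mul_right (le_of_eq ?_) _
        rw [← lintegral_mul_const _ (by fun_prop)]
        refine setLIntegral_congr_fun measurableSet_Ioc fun θ hθ => ?_
        rw [ENNReal.ofReal_mul (pow_nonneg hθ.1.le _), mul_assoc]
    _ = ENNReal.ofReal ((N + 1) * Real.exp Real.pi) *
          ∫⁻ θ in Set.Ioc (0 : ℝ) 1, ENNReal.ofReal (θ ^ N) * ∫⁻ y, δ θ y * B y := by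
        rw [lintegral_const_mul' _ _ ENNReal.ofReal_ne_top, lintegral_lintegral_swap]
        · congr 1
          refine lintegral_congr fun θ => ?_
          rw [lintegral_const_mul' _ _ ENNReal.ofReal_ne_top]
        · refine Measurable.aemeasurable ?_
          refine Measurable.mul ?_ ((hδm.comp measurable_swap).mul (hBm.comp measurable_fst))
          fun_prop
    _ ≤ ENNReal.ofReal ((N + 1) * Real.exp Real.pi) *
          ∫⁻ θ in Set.Ioc (0 : ℝ) 1, K * eLpNorm f (ENNReal.ofReal p) volume :=
        mul_le_mul_right (setLIntegral_mono measurable_const step) _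
    _ = _ := by simp

end LpBound

end

end MatrixWavelet

namespace MatrixWavelet

noncomputable section

open scoped RealInnerProductSpace Matrix

/-! ### Fourier multipliers on L², characterised by pairings with Schwartz functions. -/

section Multiplier

open scoped SchwartzMap FourierTransform ContDiff

variable {V : Type*} [NormedAddCommGroup V] [InnerProductSpace ℝ V] [FiniteDimensional ℝ V]
  [MeasurableSpace V] [BorelSpace V]

/-! ### Fourier multipliers on `L²` -/

lemma ae_eq_of_integral_schwartz_smul_eq {T T' : V → ℂ} (hT : LocallyIntegrable T)
    (hT' : LocallyIntegrable T')
    (h : ∀ φ : 𝓢(V, ℂ), ∫ x, φ x • T x = ∫ x, φ x • T' x) : T =ᵐ[volume] T' := by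
  refine ae_eq_of_integral_contDiff_smul_eq hT hT' fun g hg hgs => ?_
  have hs : HasCompactSupport fun x => (g x : ℂ) := hgs.comp_left (g := Complex.ofReal) rfl
  have hd : ContDiff ℝ ∞ fun x => (g x : ℂ) := Complex.ofRealCLM.contDiff.comp hg
  have := h (hs.toSchwartzMap hd)
  simpa using this

lemma integral_schwartz_smul_fourier (u : Lp ℂ 2 (volume : Measure V)) (φ : 𝓢(V, ℂ)) :
    ∫ x, φ x • (𝓕 u : Lp ℂ 2 (volume : Measure V)) x = ∫ x, (𝓕 φ) x • u x := by
  have h := DFunLike.congr_fun (Lp.fourier_toTemperedDistribution_eq u) φ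
  rw [TemperedDistribution.fourier_apply, Lp.toTemperedDistribution_apply,
    Lp.toTemperedDistribution_apply] at h
  exact h.symm

lemma integral_schwartz_smul_fourierInv (u : Lp ℂ 2 (volume : Measure V)) (φ : 𝓢(V, ℂ)) :
    ∫ x, φ x • (𝓕⁻ u : Lp ℂ 2 (volume : Measure V)) x = ∫ x, (𝓕⁻ φ) x • u x := by
  have h := DFunLike.congr_fun (Lp.fourierInv_toTemperedDistribution_eq u) φ
  rw [TemperedDistribution.fourierInv_apply, Lp.toTemperedDistribution_apply,
    Lp.toTemperedDistribution_apply] at h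
  exact h.symm

lemma integral_fourierInv_smul_eq {f g : V → ℂ} (hf : Integrable f) (hg : Integrable g) :
    ∫ x, 𝓕⁻ f x • g x = ∫ x, f x • 𝓕⁻ g x := by
  have h := VectorFourier.integral_fourierIntegral_smul_eq_flip (L := -innerₗ V)
    (μ := volume) (ν := volume) Real.continuous_fourierChar
    (by
      have : Continuous fun p : V × V => -⟪p.1, p.2⟫ := continuous_inner.neg
      simpa using this) hf hg
  have hflip : (-innerₗ V).flip = -innerₗ V := by
    ext x y
    simp [real_inner_comm]
  rw [hflip] at h
  exact h

/-- The L² extension and the integral are both locally integrable and pair equally with every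
Schwartz function. -/
lemma fourierInv_toLp_ae_eq {g : V → ℂ} (hg : Integrable g) (hg2 : MemLp g 2) :
    ((𝓕⁻ (hg2.toLp g) : Lp ℂ 2 (volume : Measure V)) : V → ℂ) =ᵐ[volume] 𝓕⁻ g := by
  have hcont : Continuous (𝓕⁻ g) := by
    rw [Real.fourierInv_eq_fourier_comp_neg]
    exact VectorFourier.fourierIntegral_continuous Real.continuous_fourierChar
      (by exact continuous_inner) hg.comp_neg
  refine ae_eq_of_integral_schwartz_smul_eq
    ((Lp.memLp _).locallyIntegrable (by norm_num)) hcont.locallyIntegrable fun φ => ?_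
  rw [integral_schwartz_smul_fourierInv, ← integral_fourierInv_smul_eq φ.integrable hg,
    SchwartzMap.fourierInv_coe]
  refine integral_congr_ae ?_
  filter_upwards [hg2.coeFn_toLp] with x hx
  rw [hx]

/-- For Schwartz v this is the duality defining the transform of distributions. Both sides are
continuous in v, and Schwartz functions are dense. -/
lemma integral_fourierInv_smul_eq_lp (u v : Lp ℂ 2 (volume : Measure V)) :
    ∫ x, (𝓕⁻ u : Lp ℂ 2 (volume : Measure V)) x • v x = ∫ x, u x • (𝓕⁻ v : Lp ℂ 2 (volume : Measure V)) x := by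
  let B := (ContinuousLinearMap.lsmul ℂ ℂ (E := ℂ)).lpPairing (volume : Measure V) 2 2
  have hB : ∀ u v : Lp ℂ 2 (volume : Measure V), B u v = ∫ x, u x • v x := fun u v =>
    ContinuousLinearMap.lpPairing_eq_integral _ u v
  rw [← hB, ← hB]
  refine DenseRange.induction_on (p := fun v => B (𝓕⁻ u) v = B u (𝓕⁻ v))
    (SchwartzMap.denseRange_toLpCLM (p := 2) ENNReal.ofNat_ne_top) v ?_ fun φ => ?_
  · exact isClosed_eq (B (𝓕⁻ u)).continuous
      ((B u).continuous.comp ((Lp.fourierTransformₗᵢ V ℂ).symm.continuous))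
  · rw [SchwartzMap.toLpCLM_apply, SchwartzMap.toLp_fourierInv_eq, hB, hB]
    have h := integral_schwartz_smul_fourierInv u φ
    refine Eq.trans (integral_congr_ae ?_) (h.trans (integral_congr_ae ?_))
    · filter_upwards [φ.coeFn_toLp 2 volume] with x hx
      rw [hx, smul_eq_mul, smul_eq_mul, mul_comm]
    · filter_upwards [(𝓕⁻ φ).coeFn_toLp 2 volume] with x hx
      rw [hx, smul_eq_mul, smul_eq_mul, mul_comm]

lemma memLp_bounded_mul {M F : V → ℂ} (hM : AEStronglyMeasurable M) {D : ℝ}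
    (hD : ∀ᵐ z, ‖M z‖ ≤ D) {p : ℝ≥0∞} (hF : MemLp F p) : MemLp (fun z => M z * F z) p :=
  hF.of_le_mul (c := D) (hM.mul hF.1) (by
    filter_upwards [hD] with z hz
    rw [norm_mul]
    exact mul_le_mul_of_nonneg_right hz (norm_nonneg _))

/-- A function whose pairings with Schwartz functions are those of a Fourier multiplier applied to
`f ∈ L²` is that multiplier applied to `f`. -/
theorem ae_eq_fourier_mul {f : V → ℂ} (hf : MemLp f 2) {M : V → ℂ}
    (hM : AEStronglyMeasurable M) {D : ℝ} (hD : ∀ᵐ z, ‖M z‖ ≤ D) {T : V → ℂ}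
    (hT : LocallyIntegrable T)
    (h : ∀ φ : 𝓢(V, ℂ), ∫ x, φ x • T x = ∫ x, f x • 𝓕⁻ (fun z => M z * 𝓕 φ z) x) :
    T =ᵐ[volume] ((𝓕 ((memLp_bounded_mul hM hD (Lp.memLp (𝓕⁻ (hf.toLp f) :
      Lp ℂ 2 (volume : Measure V)))).toLp _) : Lp ℂ 2 (volume : Measure V)) : V → ℂ) := by
  refine ae_eq_of_integral_schwartz_smul_eq hT ((Lp.memLp _).locallyIntegrable (by norm_num))
    fun φ => ?_
  have h1 : Integrable fun z => M z * 𝓕 φ z := memLp_one_iff_integrable.1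
    (memLp_bounded_mul hM hD (memLp_one_iff_integrable.2 (𝓕 φ).integrable))
  have h2 : MemLp (fun z => M z * 𝓕 φ z) 2 := memLp_bounded_mul hM hD ((𝓕 φ).memLp 2)
  rw [h φ, integral_schwartz_smul_fourier]
  have h3 := integral_fourierInv_smul_eq_lp (hf.toLp f) (h2.toLp _)
  refine Eq.trans (integral_congr_ae ?_) (h3.symm.trans (integral_congr_ae ?_))
  · filter_upwards [hf.coeFn_toLp, fourierInv_toLp_ae_eq h1 h2] with x hx hx'
    rw [hx, hx']
  · filter_upwards [h2.coeFn_toLp, (memLp_bounded_mul hM hD (Lp.memLp (𝓕⁻ (hf.toLp f) :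
      Lp ℂ 2 (volume : Measure V)))).coeFn_toLp] with x hx hx'
    rw [hx, hx', smul_eq_mul, smul_eq_mul]
    ring

/-- The `L²` distance between a Fourier multiplier applied to `f` and a multiple of `f`. -/
theorem memLp_and_eLpNorm_sub_of_pairing {f : V → ℂ} (hf : MemLp f 2) {M : V → ℂ}
    (hM : AEStronglyMeasurable M) {D : ℝ} (hD : ∀ᵐ z, ‖M z‖ ≤ D) {T : V → ℂ}
    (hT : LocallyIntegrable T)
    (h : ∀ φ : 𝓢(V, ℂ), ∫ x, φ x • T x = ∫ x, f x • 𝓕⁻ (fun z => M z * 𝓕 φ z) x) :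
    MemLp T 2 ∧ ∀ d : ℂ, eLpNorm (fun x => T x - d * f x) 2 volume =
      eLpNorm (fun z => (M z - d) * (𝓕⁻ (hf.toLp f) : Lp ℂ 2 (volume : Measure V)) z) 2 volume := by
  have hae := ae_eq_fourier_mul hf hM hD hT h
  refine ⟨(memLp_congr_ae hae).2 (Lp.memLp _), fun d => ?_⟩
  set F : Lp ℂ 2 (volume : Measure V) := 𝓕⁻ (hf.toLp f) with hF
  have hMF := memLp_bounded_mul hM hD (Lp.memLp F)
  have hFF : (𝓕 F : Lp ℂ 2 (volume : Measure V)) = hf.toLp f := FourierTransform.fourier_fourierInv_eq _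
  have h1 : (fun x => T x - d * f x) =ᵐ[volume]
      (((𝓕 (hMF.toLp _) : Lp ℂ 2 (volume : Measure V)) - d • 𝓕 F : Lp ℂ 2 (volume : Measure V)) : V → ℂ) := by
    filter_upwards [hae, Lp.coeFn_sub (𝓕 (hMF.toLp _) : Lp ℂ 2 (volume : Measure V)) (d • 𝓕 F),
      Lp.coeFn_smul d (𝓕 F : Lp ℂ 2 (volume : Measure V)), hf.coeFn_toLp] with x h1 h2 h3 h4
    rw [h2, Pi.sub_apply, h3, Pi.smul_apply, hFF, h4, h1, smul_eq_mul]
  have h2 : (fun z => (M z - d) * F z) =ᵐ[volume]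
      ((hMF.toLp _ - d • F : Lp ℂ 2 (volume : Measure V)) : V → ℂ) := by
    filter_upwards [Lp.coeFn_sub (hMF.toLp _) (d • F), Lp.coeFn_smul d F, hMF.coeFn_toLp]
      with x h2 h3 h4
    rw [h2, Pi.sub_apply, h3, Pi.smul_apply, h4, smul_eq_mul]
    ring
  rw [eLpNorm_congr_ae h1, eLpNorm_congr_ae h2, ← Lp.enorm_def, ← Lp.enorm_def]
  -- T - d f is the transform of (M - d) 𝓕⁻f, and Plancherel preserves the norm.
  have h3 : (𝓕 (hMF.toLp _) : Lp ℂ 2 (volume : Measure V)) - d • 𝓕 F = 𝓕 (hMF.toLp _ - d • F) := by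
    change (Lp.fourierTransformₗᵢ V ℂ) _ - d • (Lp.fourierTransformₗᵢ V ℂ) F =
      (Lp.fourierTransformₗᵢ V ℂ) _
    rw [map_sub, map_smul]
  rw [h3, ← ofReal_norm, ← ofReal_norm, Lp.norm_fourier_eq]

end Multiplier

end

end MatrixWavelet

namespace MatrixWavelet

noncomputable section

open scoped RealInnerProductSpace Matrix

/-! ### The multiplier of a mixture of shifted Gaussian averages. -/

section GaussianAverages

open scoped SchwartzMap FourierTransform

variable {n m l : ℕ} {E : Type*} [MeasurableSpace E]

/-! ### Gaussian averages as Fourier multipliers -/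

lemma schwartz_eq_integral_exp (φ : 𝓢(MatSpace n m, ℂ)) (u : MatSpace n m) :
    φ u = ∫ z, Complex.exp (2 * Real.pi * Complex.I * (⟪u, z⟫ : ℝ)) * 𝓕 φ z := by
  have h : φ = 𝓕⁻ (𝓕 φ) := by simp
  conv_lhs => rw [h, SchwartzMap.fourierInv_coe, Real.fourierInv_eq']
  refine integral_congr_ae (Eventually.of_forall fun z => ?_)
  simp only [smul_eq_mul]
  rw [real_inner_comm]
  push_cast
  ring_nf

lemma norm_exp_two_pi_I (t : ℝ) : ‖Complex.exp (2 * Real.pi * Complex.I * (t : ℝ))‖ = 1 := by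
  rw [show 2 * Real.pi * Complex.I * (t : ℝ) = ((2 * Real.pi * t : ℝ) : ℂ) * Complex.I by
    push_cast; ring]
  exact Complex.norm_exp_ofReal_mul_I _

/-- Expand φ by Fourier inversion and integrate the characters against the Gaussian; 𝓕φ is
integrable and the Gaussian has mass 1, so Fubini applies. -/
lemma integral_gauss_schwartz (φ : 𝓢(MatSpace n m, ℂ)) (c : Matrix (Fin l) (Fin m) ℝ)
    (u : MatSpace n m) :
    ∫ G, φ (u + mulRight n c G) ∂(gaussMeasure n l) =
      ∫ z, Complex.exp (2 * Real.pi * Complex.I * (⟪u, z⟫ : ℝ)) * 𝓕 φ z *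
        ((Real.exp (-(Real.pi * ‖mulRight n cᵀ z‖ ^ 2)) : ℝ) : ℂ) := by
  have hc : Continuous (mulRight n c) := (mulRight n c).continuous_of_finiteDimensional
  simp_rw [schwartz_eq_integral_exp φ (u + mulRight n c _)]
  rw [integral_integral_swap]
  · refine integral_congr_ae (Eventually.of_forall fun z => ?_)
    simp only
    rw [← integral_gaussMeasure_exp_inner, ← integral_const_mul]
    refine integral_congr_ae (Eventually.of_forall fun G => ?_)
    simp only
    rw [inner_add_left, inner_mulRight, Complex.ofReal_add, mul_add, Complex.exp_add]
    ring
  · have hm : Continuous fun q : MatSpace n l × MatSpace n m =>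
        Complex.exp (2 * Real.pi * Complex.I * (⟪u + mulRight n c q.1, q.2⟫ : ℝ)) * 𝓕 φ q.2 := by
      have h1 : Continuous fun q : MatSpace n l × MatSpace n m => ⟪u + mulRight n c q.1, q.2⟫ :=
        (continuous_const.add (hc.comp continuous_fst)).inner continuous_snd
      exact (Complex.continuous_exp.comp (continuous_const.mul
        (Complex.continuous_ofReal.comp h1))).mul ((𝓕 φ).continuous.comp continuous_snd)
    have hi : Integrable (fun q : MatSpace n l × MatSpace n m => (1 : ℂ) * 𝓕 φ q.2)
        ((gaussMeasure n l).prod volume) :=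
      (integrable_const (1 : ℂ)).mul_prod (𝓕 φ).integrable
    refine hi.mono hm.aestronglyMeasurable (Eventually.of_forall fun q => ?_)
    simp only [Function.uncurry]
    rw [norm_mul, norm_mul, norm_exp_two_pi_I, norm_one]

/-- The Fourier multiplier of a mixture of shifted Gaussian averages. -/
def mixtureMultiplier (P : Measure E) (sh : E → MatSpace n m) (c : E → Matrix (Fin l) (Fin m) ℝ)
    (W : E → ℂ) (z : MatSpace n m) : ℂ :=
  ∫ e, W e * (Complex.exp (2 * Real.pi * Complex.I * (⟪sh e, z⟫ : ℝ)) *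
    ((Real.exp (-(Real.pi * ‖mulRight n (c e)ᵀ z‖ ^ 2)) : ℝ) : ℂ)) ∂P

/-- A mixture of shifted Gaussian averages. -/
def mixtureAverage (P : Measure E) (sh : E → MatSpace n m) (c : E → Matrix (Fin l) (Fin m) ℝ)
    (W : E → ℂ) (f : MatSpace n m → ℂ) (x : MatSpace n m) : ℂ :=
  ∫ q, f (x - sh q.1 - mulRight n (c q.1) q.2) * W q.1 ∂(P.prod (gaussMeasure n l))

variable {P : Measure E} [SFinite P] {sh : E → MatSpace n m} {c : E → Matrix (Fin l) (Fin m) ℝ}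
  {W : E → ℂ}

lemma measurable_mixture_kernel (hsh : Measurable sh) (hc : Measurable c) (hW : Measurable W) :
    Measurable fun p : MatSpace n m × E => W p.2 *
      (Complex.exp (2 * Real.pi * Complex.I * (⟪sh p.2, p.1⟫ : ℝ)) *
        ((Real.exp (-(Real.pi * ‖mulRight n (c p.2)ᵀ p.1‖ ^ 2)) : ℝ) : ℂ)) := by
  have h1 : Measurable fun p : MatSpace n m × E => ⟪sh p.2, p.1⟫ :=
    (hsh.comp measurable_snd).inner measurable_fst
  have hT : Continuous fun p : Matrix (Fin l) (Fin m) ℝ × MatSpace n m => mulRight n p.1ᵀ p.2 :=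
    continuous_mulRight_uncurry.comp (continuous_fst.matrix_transpose.prodMk continuous_snd)
  have h2 : Measurable fun p : MatSpace n m × E => mulRight n (c p.2)ᵀ p.1 :=
    hT.measurable.comp ((hc.comp measurable_snd).prodMk measurable_fst)
  have h3 : Measurable fun p : MatSpace n m × E =>
      Real.exp (-(Real.pi * ‖mulRight n (c p.2)ᵀ p.1‖ ^ 2)) :=
    Real.measurable_exp.comp ((h2.norm.pow_const 2).const_mul _).neg
  refine (hW.comp measurable_snd).mul (Measurable.mul ?_ (Complex.measurable_ofReal.comp h3))
  exact Complex.measurable_exp.comp ((Complex.measurable_ofReal.comp h1).const_mul _)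

lemma aestronglyMeasurable_mixtureMultiplier (hsh : Measurable sh) (hc : Measurable c)
    (hW : Measurable W) : AEStronglyMeasurable (mixtureMultiplier P sh c W) :=
  (measurable_mixture_kernel hsh hc hW).stronglyMeasurable.integral_prod_right'.aestronglyMeasurable

lemma measurable_mixture_shift (hsh : Measurable sh) (hc : Measurable c) :
    Measurable fun q : E × MatSpace n l => sh q.1 + mulRight n (c q.1) q.2 :=
  (hsh.comp measurable_fst).add (continuous_mulRight_uncurry.measurable.comp
    ((hc.comp measurable_fst).prodMk measurable_snd))

lemma measurable_mixture_integrand (hsh : Measurable sh) (hc : Measurable c) (hW : Measurable W)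
    {f : MatSpace n m → ℂ} (hf : Measurable f) :
    Measurable fun p : MatSpace n m × (E × MatSpace n l) =>
      f (p.1 - sh p.2.1 - mulRight n (c p.2.1) p.2.2) * W p.2.1 := by
  refine (hf.comp ?_).mul (hW.comp (measurable_fst.comp measurable_snd))
  have h : Measurable fun p : MatSpace n m × (E × MatSpace n l) =>
      p.1 - (sh p.2.1 + mulRight n (c p.2.1) p.2.2) :=
    measurable_fst.sub ((measurable_mixture_shift hsh hc).comp measurable_snd)
  simpa only [sub_sub] using h

/-- The pointwise bound makes the average a bounded function. -/
lemma locallyIntegrable_mixtureAverage (hsh : Measurable sh) (hc : Measurable c)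
    (hW : Measurable W) {f : MatSpace n m → ℂ} (hf : Measurable f) {C : ℝ≥0∞} (hC : C ≠ ⊤)
    (hbd : ∀ x, ∫⁻ q, ‖f (x - sh q.1 - mulRight n (c q.1) q.2) * W q.1‖ₑ
      ∂(P.prod (gaussMeasure n l)) ≤ C) : LocallyIntegrable (mixtureAverage P sh c W f) := by
  have hm : AEStronglyMeasurable (mixtureAverage P sh c W f) :=
    (measurable_mixture_integrand hsh hc hW
      hf).stronglyMeasurable.integral_prod_right'.aestronglyMeasurable
  refine MemLp.locallyIntegrable (p := ⊤) ?_ le_top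
  refine memLp_top_of_bound hm C.toReal (Eventually.of_forall fun x => ?_)
  rw [← toReal_enorm]
  exact ENNReal.toReal_mono hC ((enorm_integral_le_lintegral_enorm _).trans (hbd x))

/-- The translation is moved from f to φ, and φ is then expanded by Fourier inversion; f is never
transformed. `hbd` licenses the exchange in space, `hh` and `hφ` the exchange in frequency. -/
theorem integral_schwartz_smul_mixtureAverage (hsh : Measurable sh) (hc : Measurable c)
    (hW : Measurable W) {f : MatSpace n m → ℂ} (hf : Measurable f) {C : ℝ≥0∞} (hC : C ≠ ⊤)
    (hbd : ∀ x, ∫⁻ q, ‖f (x - sh q.1 - mulRight n (c q.1) q.2) * W q.1‖ₑ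
      ∂(P.prod (gaussMeasure n l)) ≤ C) {h : MatSpace n m → ℝ≥0∞}
    (hh : ∀ᵐ z, ∫⁻ e, ‖W e‖ₑ *
      ENNReal.ofReal (Real.exp (-(Real.pi * ‖mulRight n (c e)ᵀ z‖ ^ 2))) ∂P ≤ h z)
    (φ : 𝓢(MatSpace n m, ℂ)) (hφ : ∫⁻ z, ‖𝓕 φ z‖ₑ * h z < ⊤) :
    ∫ x, φ x • mixtureAverage P sh c W f x =
      ∫ x, f x • 𝓕⁻ (fun z => mixtureMultiplier P sh c W z * 𝓕 φ z) x := by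
  have hσ := measurable_mixture_shift (n := n) hsh hc
  set Q := P.prod (gaussMeasure n l) with hQ
  set σ : E × MatSpace n l → MatSpace n m := fun q => sh q.1 + mulRight n (c q.1) q.2 with hσd
  have hbd' : ∀ x, ∫⁻ q, ‖f (x - σ q) * W q.1‖ₑ ∂Q ≤ C := by
    simpa only [hσd, ← sub_sub] using hbd
  have hm1 : Measurable fun p : MatSpace n m × (E × MatSpace n l) =>
      φ p.1 * (f (p.1 - σ p.2) * W p.2.1) :=
    (φ.continuous.measurable.comp measurable_fst).mul
      ((hf.comp (measurable_fst.sub (hσ.comp measurable_snd))).mul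
        (hW.comp (measurable_fst.comp measurable_snd)))
  have hm2 : Measurable fun p : MatSpace n m × (E × MatSpace n l) =>
      φ (p.1 + σ p.2) * (f p.1 * W p.2.1) :=
    (φ.continuous.measurable.comp (measurable_fst.add (hσ.comp measurable_snd))).mul
      ((hf.comp measurable_fst).mul (hW.comp (measurable_fst.comp measurable_snd)))
  have hfin : ∫⁻ x, ∫⁻ q, ‖φ x * (f (x - σ q) * W q.1)‖ₑ ∂Q ∂volume < ⊤ := by
    have h1 : ∀ x, ∫⁻ q, ‖φ x * (f (x - σ q) * W q.1)‖ₑ ∂Q ≤ ‖φ x‖ₑ * C := by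
      intro x
      simp_rw [enorm_mul (φ x)]
      rw [lintegral_const_mul' _ _ enorm_ne_top]
      exact mul_le_mul_right (hbd' x) _
    refine (lintegral_mono h1).trans_lt ?_
    rw [lintegral_mul_const' _ _ hC]
    exact ENNReal.mul_lt_top φ.integrable.2 hC.lt_top
  have hi1 : Integrable (fun p : MatSpace n m × (E × MatSpace n l) =>
      φ p.1 * (f (p.1 - σ p.2) * W p.2.1)) (volume.prod Q) := by
    refine ⟨hm1.aestronglyMeasurable, ?_⟩
    rw [hasFiniteIntegral_iff_enorm, lintegral_prod _ hm1.enorm.aemeasurable]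
    exact hfin
  have hi2 : Integrable (fun p : MatSpace n m × (E × MatSpace n l) =>
      φ (p.1 + σ p.2) * (f p.1 * W p.2.1)) (volume.prod Q) := by
    refine ⟨hm2.aestronglyMeasurable, ?_⟩
    rw [hasFiniteIntegral_iff_enorm, lintegral_prod_symm _ hm2.enorm.aemeasurable]
    refine lt_of_eq_of_lt ?_ hfin
    refine Eq.trans (lintegral_congr fun q => ?_) (lintegral_lintegral_swap
      (f := fun x q => ‖φ x * (f (x - σ q) * W q.1)‖ₑ) hm1.enorm.aemeasurable).symm
    rw [← lintegral_add_right_eq_self (fun x => ‖φ x * (f (x - σ q) * W q.1)‖ₑ) (σ q)]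
    simp only [add_sub_cancel_right]
  have hswap : ∫ x, φ x • mixtureAverage P sh c W f x =
      ∫ x, ∫ q, φ (x + σ q) * (f x * W q.1) ∂Q := by
    calc ∫ x, φ x • mixtureAverage P sh c W f x
        = ∫ x, ∫ q, φ x * (f (x - σ q) * W q.1) ∂Q := by
          refine integral_congr_ae (Eventually.of_forall fun x => ?_)
          simp only [mixtureAverage, smul_eq_mul, hσd, ← sub_sub]
          rw [integral_const_mul]
      _ = ∫ q, ∫ x, φ x * (f (x - σ q) * W q.1) ∂volume ∂Q := integral_integral_swap hi1
      _ = ∫ q, ∫ x, φ (x + σ q) * (f x * W q.1) ∂volume ∂Q := by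
          refine integral_congr_ae (Eventually.of_forall fun q => ?_)
          simp only
          rw [← integral_add_right_eq_self (fun x => φ x * (f (x - σ q) * W q.1)) (σ q)]
          simp only [add_sub_cancel_right]
      _ = _ := (integral_integral_swap hi2).symm
  rw [hswap]
  refine integral_congr_ae ?_
  filter_upwards [hi2.prod_right_ae] with x hx
  -- Both sides vanish where f does. Elsewhere f(x) can be divided out, which gives integrability of
  -- φ(x + σ)W alone.
  by_cases hfx : f x = 0
  · simp [hfx]
  have hx' : Integrable (fun q => φ (x + σ q) * W q.1) Q := by
    have := hx.const_mul (f x)⁻¹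
    refine this.congr (Eventually.of_forall fun q => ?_)
    simp only
    field_simp
  rw [smul_eq_mul, show (fun q => φ (x + σ q) * (f x * W q.1)) = fun q =>
    f x * (φ (x + σ q) * W q.1) by ext q; ring, integral_const_mul]
  congr 1
  rw [hQ, integral_prod _ hx', Real.fourierInv_eq']
  have hK := measurable_mixture_kernel (n := n) hsh hc hW
  have hi3 : Integrable (fun p : E × MatSpace n m =>
      Complex.exp (2 * Real.pi * Complex.I * (⟪x, p.2⟫ : ℝ)) * (W p.1 *
        (Complex.exp (2 * Real.pi * Complex.I * (⟪sh p.1, p.2⟫ : ℝ)) *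
        ((Real.exp (-(Real.pi * ‖mulRight n (c p.1)ᵀ p.2‖ ^ 2)) : ℝ) : ℂ)) * 𝓕 φ p.2))
      (P.prod volume) := by
    have hmE : Measurable fun p : E × MatSpace n m =>
        Complex.exp (2 * Real.pi * Complex.I * (⟪x, p.2⟫ : ℝ)) * (W p.1 *
        (Complex.exp (2 * Real.pi * Complex.I * (⟪sh p.1, p.2⟫ : ℝ)) *
        ((Real.exp (-(Real.pi * ‖mulRight n (c p.1)ᵀ p.2‖ ^ 2)) : ℝ) : ℂ)) * 𝓕 φ p.2) := by
      have h1 : Continuous fun z : MatSpace n m =>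
          Complex.exp (2 * Real.pi * Complex.I * (⟪x, z⟫ : ℝ)) := by fun_prop
      exact (h1.measurable.comp measurable_snd).mul ((hK.comp measurable_swap).mul
        ((𝓕 φ).continuous.measurable.comp measurable_snd))
    refine ⟨hmE.aestronglyMeasurable, ?_⟩
    rw [hasFiniteIntegral_iff_enorm, lintegral_prod_symm _ hmE.enorm.aemeasurable]
    refine lt_of_le_of_lt (lintegral_mono_ae ?_) hφ
    filter_upwards [hh] with z hz
    refine le_trans (le_of_eq ?_) (mul_le_mul_right hz _)
    rw [← lintegral_const_mul' _ _ enorm_ne_top]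
    refine lintegral_congr fun e => ?_
    have hexp : ∀ t : ℝ, ‖Complex.exp (2 * Real.pi * Complex.I * (t : ℝ))‖ₑ = 1 := fun t => by
      rw [← ofReal_norm, norm_exp_two_pi_I, ENNReal.ofReal_one]
    rw [enorm_mul, enorm_mul, enorm_mul, enorm_mul, hexp, hexp, ← ofReal_norm (Complex.ofReal _),
      Complex.norm_real, Real.norm_of_nonneg (Real.exp_pos _).le]
    ring
  calc ∫ e, ∫ G, φ (x + σ (e, G)) * W e ∂(gaussMeasure n l) ∂P
      = ∫ e, ∫ z, Complex.exp (2 * Real.pi * Complex.I * (⟪x, z⟫ : ℝ)) * (W e *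
        (Complex.exp (2 * Real.pi * Complex.I * (⟪sh e, z⟫ : ℝ)) *
        ((Real.exp (-(Real.pi * ‖mulRight n (c e)ᵀ z‖ ^ 2)) : ℝ) : ℂ)) * 𝓕 φ z) ∂volume ∂P := by
        refine integral_congr_ae (Eventually.of_forall fun e => ?_)
        simp only [hσd, ← add_assoc]
        rw [integral_mul_const, integral_gauss_schwartz, ← integral_mul_const]
        refine integral_congr_ae (Eventually.of_forall fun z => ?_)
        simp only
        rw [inner_add_left, Complex.ofReal_add, mul_add, Complex.exp_add]
        ring
    _ = _ := integral_integral_swap hi3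
    _ = _ := by
        refine integral_congr_ae (Eventually.of_forall fun z => ?_)
        simp only [smul_eq_mul]
        rw [integral_const_mul, integral_mul_const, ← mixtureMultiplier, real_inner_comm]
        push_cast
        ring_nf

end GaussianAverages

end

end MatrixWavelet

namespace MatrixWavelet

noncomputable section

open scoped RealInnerProductSpace Matrix

/-! ### Order, determinants and finiteness on the cone. -/

section ConeBounds

variable {n m : ℕ}

/-! ### Bounds on the cone -/

lemma dotProduct_mulVec_le (t : Matrix (Fin m) (Fin m) ℝ) (v : Fin m → ℝ) :
    v ⬝ᵥ (t *ᵥ v) ≤ (∑ i, ∑ j, |t i j|) * (v ⬝ᵥ v) := by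
  have h1 : ∀ i j, v i * (t i j * v j) ≤ |t i j| * (v ⬝ᵥ v) := by
    intro i j
    have hi : v i ^ 2 ≤ v ⬝ᵥ v := by
      simp only [dotProduct, ← sq]
      exact Finset.single_le_sum (f := fun i => v i ^ 2) (fun i _ => sq_nonneg _)
        (Finset.mem_univ i)
    have hj : v j ^ 2 ≤ v ⬝ᵥ v := by
      simp only [dotProduct, ← sq]
      exact Finset.single_le_sum (f := fun i => v i ^ 2) (fun i _ => sq_nonneg _)
        (Finset.mem_univ j)
    have h2 : |v i * v j| ≤ v ⬝ᵥ v := by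
      rw [abs_le]
      constructor <;> nlinarith [sq_nonneg (v i - v j), sq_nonneg (v i + v j)]
    calc v i * (t i j * v j) = t i j * (v i * v j) := by ring
      _ ≤ |t i j * (v i * v j)| := le_abs_self _
      _ = |t i j| * |v i * v j| := abs_mul _ _
      _ ≤ _ := mul_le_mul_of_nonneg_left h2 (abs_nonneg _)
  calc v ⬝ᵥ (t *ᵥ v) = ∑ i, ∑ j, v i * (t i j * v j) := by
        simp only [dotProduct, Matrix.mulVec, Finset.mul_sum]
    _ ≤ ∑ i, ∑ j, |t i j| * (v ⬝ᵥ v) :=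
        Finset.sum_le_sum fun i _ => Finset.sum_le_sum fun j _ => h1 i j
    _ = _ := by simp only [Finset.sum_mul]

lemma eventually_posDef_smul_one_sub {t : Matrix (Fin m) (Fin m) ℝ} (ht : t.IsHermitian) :
    ∀ᶠ ρ : ℝ in atTop, (ρ • (1 : Matrix (Fin m) (Fin m) ℝ) - t).PosDef := by
  filter_upwards [eventually_gt_atTop (∑ i, ∑ j, |t i j|)] with ρ hρ
  refine Matrix.PosDef.of_dotProduct_mulVec_pos ?_ fun v hv => ?_
  · exact (Matrix.isHermitian_one.smul (IsSelfAdjoint.all ρ)).sub ht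
  · have hv' : 0 < v ⬝ᵥ v := by
      have := Matrix.dotProduct_star_self_pos_iff.2 hv
      simpa using this
    rw [star_trivial, Matrix.sub_mulVec, dotProduct_sub, Matrix.smul_mulVec, Matrix.one_mulVec,
      dotProduct_smul, smul_eq_mul]
    have := dotProduct_mulVec_le t v
    nlinarith

/-- For small ε the matrix ε⁻¹I - t⁻¹ is positive definite; congruence by t^{1/2} and the factor ε
turn it into t - εI. -/
lemma eventually_posDef_sub_smul_one {t : Matrix (Fin m) (Fin m) ℝ} (ht : t.PosDef) :
    ∀ᶠ ε : ℝ in 𝓝[>] 0, (t - ε • (1 : Matrix (Fin m) (Fin m) ℝ)).PosDef := by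
  have h := tendsto_inv_nhdsGT_zero.eventually (eventually_posDef_smul_one_sub ht.inv.isHermitian)
  filter_upwards [h, self_mem_nhdsWithin] with ε hε (hε0 : 0 < ε)
  have hs := sqrt_posDef ht
  have hu : IsUnit (CFC.sqrt t).det := isUnit_iff_ne_zero.2 hs.det_pos.ne'
  have hinv : CFC.sqrt t * t⁻¹ * CFC.sqrt t = 1 := by
    have : t⁻¹ = (CFC.sqrt t)⁻¹ * (CFC.sqrt t)⁻¹ := by
      rw [← Matrix.mul_inv_rev, sqrt_mul_sqrt ht.posSemidef]
    rw [this, ← Matrix.mul_assoc, Matrix.mul_nonsing_inv _ hu, Matrix.one_mul,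
      Matrix.nonsing_inv_mul _ hu]
  have h2 := (congr_posDef_iff hs.det_pos.ne').2 (hε.smul hε0)
  convert h2 using 1
  rw [sqrt_transpose, smul_sub, smul_smul, mul_inv_cancel₀ hε0.ne', one_smul, Matrix.mul_sub,
    Matrix.sub_mul, Matrix.mul_one, sqrt_mul_sqrt ht.posSemidef, Matrix.mul_smul, Matrix.smul_mul,
    hinv]

lemma eventually_mem_coneInterval {t : Matrix (Fin m) (Fin m) ℝ} (ht : t.PosDef) :
    ∀ᶠ q : ℝ × ℝ in 𝓝[>] (0 : ℝ) ×ˢ atTop,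
      t ∈ coneInterval (q.1 • (1 : Matrix (Fin m) (Fin m) ℝ)) (q.2 • 1) :=
  (eventually_posDef_sub_smul_one ht).prod_mk (eventually_posDef_smul_one_sub ht.isHermitian)

lemma trace_gram_mul_mono (x : MatSpace n m) {a b : Matrix (Fin m) (Fin m) ℝ}
    (h : (b - a).PosSemidef) : (gram x * a).trace ≤ (gram x * b).trace := by
  have h1 : 0 ≤ (gram x * (b - a)).trace := by
    rw [trace_gram_mul x h]
    positivity
  rw [Matrix.mul_sub, Matrix.trace_sub] at h1
  linarith

/-- For matrices with two rows the integral of exp(-tr(x'x a)) is a constant multiple of |a|⁻¹, and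
it decreases in a. -/
lemma det_le_det {a b : Matrix (Fin m) (Fin m) ℝ} (ha : a.PosDef) (h : (b - a).PosSemidef) :
    a.det ≤ b.det := by
  have hb : b.PosDef := by
    have := ha.add_posSemidef h
    rwa [add_sub_cancel] at this
  have h1 : ∫⁻ x : MatSpace 2 m, ENNReal.ofReal (Real.exp (-(gram x * b).trace)) ≤
      ∫⁻ x : MatSpace 2 m, ENNReal.ofReal (Real.exp (-(gram x * a).trace)) :=
    lintegral_mono fun x => ENNReal.ofReal_le_ofReal
      (Real.exp_le_exp.2 (neg_le_neg (trace_gram_mul_mono x h)))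
  have hda := ha.det_pos
  have hdb := hb.det_pos
  rw [lintegral_exp_neg_trace_gram_mul ha, lintegral_exp_neg_trace_gram_mul hb,
    ENNReal.ofReal_le_ofReal_iff (by positivity)] at h1
  have h2 := le_of_mul_le_mul_left h1 (by positivity)
  norm_num [Real.rpow_neg_one] at h2
  exact (inv_le_inv₀ hdb hda).1 h2

lemma posDef_of_mem_coneInterval {ε ρ : ℝ} (hε : 0 < ε) {a : Matrix (Fin m) (Fin m) ℝ}
    (ha : a ∈ coneInterval (ε • (1 : Matrix (Fin m) (Fin m) ℝ)) (ρ • 1)) : a.PosDef := by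
  have := ha.1.add (Matrix.PosDef.one.smul hε)
  rwa [sub_add_cancel] at this

lemma pow_le_det_of_mem_coneInterval {ε ρ : ℝ} (hε : 0 < ε) {a : Matrix (Fin m) (Fin m) ℝ}
    (ha : a ∈ coneInterval (ε • (1 : Matrix (Fin m) (Fin m) ℝ)) (ρ • 1)) : ε ^ m ≤ a.det := by
  have := det_le_det (Matrix.PosDef.one.smul hε) ha.1.posSemidef
  simpa [Matrix.det_smul] using this

lemma trace_le_of_mem_coneInterval {ε ρ : ℝ} {a : Matrix (Fin m) (Fin m) ℝ}
    (ha : a ∈ coneInterval (ε • (1 : Matrix (Fin m) (Fin m) ℝ)) (ρ • 1)) : a.trace ≤ m * ρ := by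
  have h := ha.2.posSemidef.trace_nonneg
  rw [Matrix.trace_sub, Matrix.trace_smul, Matrix.trace_one, Fintype.card_fin, smul_eq_mul] at h
  linarith

/-- On the interval tr a ≤ mρ and |a| ≥ ε^m, so 1 is dominated by a multiple of the gamma integrand
e^{-tr a}|a|^m. -/
lemma coneMeasure_coneInterval_lt_top {ε : ℝ} (hε : 0 < ε) (ρ : ℝ) :
    coneMeasure m (coneInterval (ε • (1 : Matrix (Fin m) (Fin m) ℝ)) (ρ • 1)) < ⊤ := by
  have hb := coneGamma_pos_lt_top m m (by have : (0 : ℝ) ≤ m := m.cast_nonneg; linarith)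
  set I := coneInterval (ε • (1 : Matrix (Fin m) (Fin m) ℝ)) (ρ • 1) with hI
  set K : ℝ := Real.exp (m * ρ) * ((ε ^ m) ^ (m : ℝ))⁻¹ with hK
  have hK0 : 0 ≤ K := by positivity
  have h1 : ∀ a ∈ I, (1 : ℝ≥0∞) ≤
      ENNReal.ofReal K * ENNReal.ofReal (Real.exp (-a.trace) * a.det ^ (m : ℝ)) := by
    intro a ha
    rw [← ENNReal.ofReal_mul hK0, ← ENNReal.ofReal_one]
    refine ENNReal.ofReal_le_ofReal ?_
    have h2 : 1 ≤ Real.exp (m * ρ) * Real.exp (-a.trace) := by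
      rw [← Real.exp_add]
      exact Real.one_le_exp (by linarith [trace_le_of_mem_coneInterval ha])
    have h3 : 1 ≤ ((ε ^ m) ^ (m : ℝ))⁻¹ * a.det ^ (m : ℝ) := by
      rw [← div_eq_inv_mul, one_le_div (by positivity)]
      exact Real.rpow_le_rpow (by positivity) (pow_le_det_of_mem_coneInterval hε ha)
        (by positivity)
    calc (1 : ℝ) = 1 * 1 := (one_mul 1).symm
      _ ≤ (Real.exp (m * ρ) * Real.exp (-a.trace)) * (((ε ^ m) ^ (m : ℝ))⁻¹ * a.det ^ (m : ℝ)) :=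
        mul_le_mul h2 h3 zero_le_one (by positivity)
      _ = _ := by rw [hK]; ring
  calc coneMeasure m I = ∫⁻ _ in I, 1 ∂(coneMeasure m) := (setLIntegral_one _).symm
    _ ≤ ∫⁻ a in I, ENNReal.ofReal K * ENNReal.ofReal (Real.exp (-a.trace) * a.det ^ (m : ℝ))
        ∂(coneMeasure m) := setLIntegral_mono' (measurableSet_coneInterval _ _) h1
    _ ≤ ∫⁻ a, ENNReal.ofReal K * ENNReal.ofReal (Real.exp (-a.trace) * a.det ^ (m : ℝ))
        ∂(coneMeasure m) := setLIntegral_le_lintegral _ _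
    _ = ENNReal.ofReal K * coneGamma m m := by
      rw [lintegral_const_mul' _ _ ENNReal.ofReal_ne_top, coneGamma]
    _ < ⊤ := ENNReal.mul_lt_top ENNReal.ofReal_lt_top hb.2.lt_top

lemma lintegral_exp_mul_matAbs_rpow (hnm : m ≤ n) {a : ℝ} {θ : ℝ} (hθ : 0 < θ) :
    ∫⁻ z : MatSpace n m, ENNReal.ofReal (Real.exp (-(Real.pi * θ * ‖z‖ ^ 2)) * matAbs z ^ (-a)) =
      polarConst n m * (coneGamma m (((n : ℝ) - a) / 2) *
        ENNReal.ofReal (((Real.pi * θ) ^ m) ^ (-(((n : ℝ) - a) / 2)))) := by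
  have hpt : 0 < Real.pi * θ := by positivity
  have hmF : Measurable fun r : Matrix (Fin m) (Fin m) ℝ => ENNReal.ofReal
      (Real.exp (-(r * ((Real.pi * θ) • (1 : Matrix (Fin m) (Fin m) ℝ))).trace) *
        (Real.sqrt r.det) ^ (-a)) := by
    have h1 : Continuous fun r : Matrix (Fin m) (Fin m) ℝ =>
        Real.exp (-(r * ((Real.pi * θ) • (1 : Matrix (Fin m) (Fin m) ℝ))).trace) :=
      Real.continuous_exp.comp (continuous_id.matrix_mul continuous_const).matrix_trace.neg
    exact (h1.measurable.mul
      ((Real.continuous_sqrt.measurable.comp measurable_det).pow_const _)).ennreal_ofReal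
  have h := lintegral_exp_neg_trace_mul
    ((Matrix.PosDef.one (n := Fin m) (R := ℝ)).smul hpt) (((n : ℝ) - a) / 2)
  rw [Matrix.det_smul, Matrix.det_one, mul_one, Fintype.card_fin] at h
  rw [← h]
  have h2 := lintegral_gram (n := n) hnm hmF
  refine Eq.trans (lintegral_congr fun x => ?_) (h2.trans ?_)
  · rw [norm_sq_eq_trace_gram, matAbs]
    simp [mul_assoc]
  · congr 1
    refine lintegral_congr_ae ?_
    filter_upwards [ae_mem_cone] with r (hr : r.PosDef)
    have hd := hr.det_pos
    rw [← ENNReal.ofReal_mul (by positivity)]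
    congr 1
    have : (Real.sqrt r.det) ^ (-a) = r.det ^ (-(a / 2)) := by
      rw [Real.sqrt_eq_rpow, ← Real.rpow_mul hd.le]
      ring_nf
    rw [this, sub_div, sub_eq_add_neg ((n : ℝ) / 2), Real.rpow_add hd]
    ring

/-- Again the weight is a superposition of Gaussians. Against each of them |z|_m^{-a} is a gamma
integral at (n - a)/2, which is finite for a < n - m + 1. -/
lemma lintegral_one_add_pow_mul_matAbs_rpow_lt_top (hnm : m ≤ n) {a : ℝ} (ha : 0 ≤ a)
    (ha' : a < (n : ℝ) - m + 1) :
    ∫⁻ z : MatSpace n m, ENNReal.ofReal ((1 + ‖z‖ ^ 2)⁻¹ ^ (n * m + 1)) *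
      ENNReal.ofReal (matAbs z ^ (-a)) < ⊤ := by
  set N := n * m with hN
  have hG := coneGamma_pos_lt_top m (((n : ℝ) - a) / 2) (by linarith)
  set K := polarConst n m * (coneGamma m (((n : ℝ) - a) / 2) *
        ENNReal.ofReal ((Real.pi ^ m) ^ (-(((n : ℝ) - a) / 2)))) with hK
  have hKt : K < ⊤ := ENNReal.mul_lt_top (polarConst_ne_top hnm).lt_top
    (ENNReal.mul_lt_top hG.2.lt_top ENNReal.ofReal_lt_top)
  have hmz : Measurable fun z : MatSpace n m => ENNReal.ofReal (matAbs z ^ (-a)) :=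
    (continuous_matAbs.measurable.pow_const _).ennreal_ofReal
  have step : ∀ θ ∈ Set.Ioc (0 : ℝ) 1, ∫⁻ z : MatSpace n m,
      ENNReal.ofReal (θ ^ N * Real.exp (-(Real.pi * θ * ‖z‖ ^ 2))) *
        ENNReal.ofReal (matAbs z ^ (-a)) ≤ K := by
    intro θ hθ
    have h1 : ∀ z : MatSpace n m, ENNReal.ofReal (θ ^ N * Real.exp (-(Real.pi * θ * ‖z‖ ^ 2))) *
        ENNReal.ofReal (matAbs z ^ (-a)) = ENNReal.ofReal (θ ^ N) *
          ENNReal.ofReal (Real.exp (-(Real.pi * θ * ‖z‖ ^ 2)) * matAbs z ^ (-a)) := by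
      intro z
      have := hθ.1
      have hz := matAbs_nonneg z
      rw [← ENNReal.ofReal_mul (by positivity), ← ENNReal.ofReal_mul (by positivity), mul_assoc]
    simp_rw [h1]
    rw [lintegral_const_mul' _ _ ENNReal.ofReal_ne_top, lintegral_exp_mul_matAbs_rpow hnm hθ.1,
      mul_left_comm, mul_left_comm (ENNReal.ofReal (θ ^ N)),
      ← ENNReal.ofReal_mul (pow_nonneg hθ.1.le _)]
    refine mul_le_mul_right (mul_le_mul_right (ENNReal.ofReal_le_ofReal ?_) _) _
    rw [mul_pow, Real.mul_rpow (by positivity) (pow_nonneg hθ.1.le _), mul_left_comm]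
    refine mul_le_of_le_one_right (by positivity) ?_
    rw [← Real.rpow_natCast, ← Real.rpow_natCast, ← Real.rpow_mul hθ.1.le, ← Real.rpow_add hθ.1]
    refine Real.rpow_le_one hθ.1.le hθ.2 ?_
    rw [hN]
    push_cast
    have hn : (0 : ℝ) ≤ n * m := by positivity
    have hma : (0 : ℝ) ≤ m * a := by positivity
    nlinarith
  have hmθ : Measurable fun p : MatSpace n m × ℝ =>
      ENNReal.ofReal (p.2 ^ N * Real.exp (-(Real.pi * p.2 * ‖p.1‖ ^ 2))) := by fun_prop
  calc ∫⁻ z : MatSpace n m, ENNReal.ofReal ((1 + ‖z‖ ^ 2)⁻¹ ^ (N + 1)) *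
        ENNReal.ofReal (matAbs z ^ (-a))
      ≤ ∫⁻ z : MatSpace n m, ENNReal.ofReal ((N + 1) * Real.exp Real.pi) *
          ∫⁻ θ in Set.Ioc (0 : ℝ) 1, ENNReal.ofReal (θ ^ N * Real.exp (-(Real.pi * θ * ‖z‖ ^ 2))) *
            ENNReal.ofReal (matAbs z ^ (-a)) := by
        refine lintegral_mono fun z => ?_
        refine (mul_le_mul_left (one_add_inv_pow_le N (sq_nonneg ‖z‖)) _).trans ?_
        rw [mul_assoc, lintegral_mul_const _ (by fun_prop)]
    _ = ENNReal.ofReal ((N + 1) * Real.exp Real.pi) * ∫⁻ θ in Set.Ioc (0 : ℝ) 1,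
          ∫⁻ z : MatSpace n m, ENNReal.ofReal (θ ^ N * Real.exp (-(Real.pi * θ * ‖z‖ ^ 2))) *
            ENNReal.ofReal (matAbs z ^ (-a)) := by
        rw [lintegral_const_mul' _ _ ENNReal.ofReal_ne_top, lintegral_lintegral_swap]
        exact (hmθ.mul (hmz.comp measurable_fst)).aemeasurable
    _ ≤ ENNReal.ofReal ((N + 1) * Real.exp Real.pi) * ∫⁻ θ in Set.Ioc (0 : ℝ) 1, K :=
        mul_le_mul_right (setLIntegral_mono measurable_const step) _
    _ = ENNReal.ofReal ((N + 1) * Real.exp Real.pi) * K := by simp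
    _ < ⊤ := ENNReal.mul_lt_top ENNReal.ofReal_lt_top hKt

open scoped SchwartzMap in
lemma schwartz_norm_le (φ : 𝓢(MatSpace n m, ℂ)) (N : ℕ) :
    ∃ C : ℝ, 0 ≤ C ∧ ∀ z, ‖φ z‖ ≤ C * (1 + ‖z‖ ^ 2)⁻¹ ^ N := by
  refine ⟨2 ^ (2 * N) *
    (Finset.Iic (2 * N, 0)).sup (fun m => SchwartzMap.seminorm ℝ m.1 m.2) φ,
    by positivity, fun z => ?_⟩
  have h := SchwartzMap.one_add_le_sup_seminorm_apply (𝕜 := ℝ) (m := (2 * N, 0)) le_rfl le_rfl φ z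
  rw [norm_iteratedFDeriv_zero] at h
  have hz := norm_nonneg z
  have h1 : (1 + ‖z‖ ^ 2) ^ N ≤ (1 + ‖z‖) ^ (2 * N) := by
    rw [pow_mul]
    exact pow_le_pow_left₀ (by positivity) (by nlinarith) N
  rw [inv_pow, ← div_eq_mul_inv, le_div_iff₀ (by positivity), mul_comm]
  exact (mul_le_mul_of_nonneg_right h1 (norm_nonneg _)).trans h

end ConeBounds

end

end MatrixWavelet

namespace MatrixWavelet

noncomputable section

open scoped RealInnerProductSpace Matrix

/-! ### The truncated wavelet integral of a potential as one absolutely convergent mixture. -/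

section WaveletMixture

open scoped SchwartzMap FourierTransform

variable {n m : ℕ}

/-! ### The wavelet transform of a Riesz potential as a Gaussian mixture -/

/-- The restriction of the invariant measure to `(εI, ρI)`. -/
def coneSlab (m : ℕ) (ε ρ : ℝ) : Measure (Matrix (Fin m) (Fin m) ℝ) :=
  (coneMeasure m).restrict (coneInterval (ε • (1 : Matrix (Fin m) (Fin m) ℝ)) (ρ • 1))

instance (ε ρ : ℝ) : SFinite (coneSlab m ε ρ) := by
  unfold coneSlab
  infer_instance

lemma isFiniteMeasure_coneSlab {ε : ℝ} (hε : 0 < ε) (ρ : ℝ) :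
    IsFiniteMeasure (coneSlab m ε ρ) :=
  ⟨by
    rw [coneSlab, Measure.restrict_apply_univ]
    exact coneMeasure_coneInterval_lt_top hε ρ⟩

lemma ae_mem_coneSlab (ε ρ : ℝ) : ∀ᵐ a ∂(coneSlab m ε ρ),
    a ∈ coneInterval (ε • (1 : Matrix (Fin m) (Fin m) ℝ)) (ρ • 1) :=
  ae_restrict_mem (measurableSet_coneInterval _ _)

/-- The weight `w(y) |a|^{-α/2}`. -/
def waveletWeight (w : MatSpace n m → ℂ) (α : ℂ) (q : Matrix (Fin m) (Fin m) ℝ × MatSpace n m) :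
    ℂ :=
  w q.2 / (q.1.det : ℂ) ^ (α / 2)

lemma measurable_waveletWeight (w : 𝓢(MatSpace n m, ℂ)) (α : ℂ) :
    Measurable (waveletWeight (fun y => w y) α) :=
  (w.continuous.measurable.comp measurable_snd).div
    ((measurable_ofReal_det_cpow _).comp measurable_fst)

lemma enorm_inv_det_cpow_le {ε ρ : ℝ} (hε : 0 < ε) {α : ℂ} (hα : 0 ≤ α.re)
    {a : Matrix (Fin m) (Fin m) ℝ}
    (ha : a ∈ coneInterval (ε • (1 : Matrix (Fin m) (Fin m) ℝ)) (ρ • 1)) :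
    ‖((a.det : ℂ) ^ (α / 2))⁻¹‖ₑ ≤ ENNReal.ofReal ((ε ^ m) ^ (-(α.re / 2))) := by
  have hd := (posDef_of_mem_coneInterval hε ha).det_pos
  rw [← ofReal_norm, norm_inv, norm_det_cpow (posDef_of_mem_coneInterval hε ha), half_re,
    ← Real.rpow_neg hd.le]
  exact ENNReal.ofReal_le_ofReal (Real.rpow_le_rpow_of_nonpos (by positivity)
    (pow_le_det_of_mem_coneInterval hε ha) (by linarith))

lemma integrable_inv_det_cpow {ε : ℝ} (hε : 0 < ε) (ρ : ℝ) {α : ℂ} (hα : 0 ≤ α.re) :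
    Integrable (fun a : Matrix (Fin m) (Fin m) ℝ => ((a.det : ℂ) ^ (α / 2))⁻¹)
      (coneSlab m ε ρ) := by
  have := isFiniteMeasure_coneSlab (m := m) hε ρ
  refine Integrable.of_bound (measurable_ofReal_det_cpow _).inv.aestronglyMeasurable
    ((ε ^ m) ^ (-(α.re / 2))) ?_
  filter_upwards [ae_mem_coneSlab ε ρ] with a ha
  have := enorm_inv_det_cpow_le hε hα ha
  rwa [← ofReal_norm, ENNReal.ofReal_le_ofReal_iff (by positivity)] at this

lemma integrable_waveletWeight (w : 𝓢(MatSpace n m, ℂ)) {ε : ℝ} (hε : 0 < ε) (ρ : ℝ) {α : ℂ}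
    (hα : 0 ≤ α.re) :
    Integrable (waveletWeight (fun y => w y) α) ((coneSlab m ε ρ).prod volume) := by
  refine ((integrable_inv_det_cpow hε ρ hα).mul_prod w.integrable).congr
    (Eventually.of_forall fun q => ?_)
  simp only [waveletWeight, div_eq_mul_inv, mul_comm]

variable {α : ℂ} (R : RieszMixture n m α) (w : 𝓢(MatSpace n m, ℂ))

/-- The truncated wavelet transform of `I^α f`, written as a mixture of Gaussian averages of `f`. -/
def waveletMixture (ε ρ : ℝ) (f : MatSpace n m → ℂ) (x : MatSpace n m) : ℂ :=
  mixtureAverage (((coneSlab m ε ρ).prod volume).prod R.Λ)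
    (fun e => mulRight n (CFC.sqrt e.1.1) e.1.2) (fun e => R.c e.2)
    (fun e => waveletWeight (fun y => w y) α e.1 * R.ω e.2) f x

/-- The Fourier multiplier of `waveletMixture`. -/
def waveletMultiplier (ε ρ : ℝ) (z : MatSpace n m) : ℂ :=
  mixtureMultiplier (((coneSlab m ε ρ).prod volume).prod R.Λ)
    (fun e => mulRight n (CFC.sqrt e.1.1) e.1.2) (fun e => R.c e.2)
    (fun e => waveletWeight (fun y => w y) α e.1 * R.ω e.2) z

lemma measurable_waveletMixture_shift : Measurable
    fun e : (Matrix (Fin m) (Fin m) ℝ × MatSpace n m) × R.S => mulRight n (CFC.sqrt e.1.1) e.1.2 :=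
  measurable_mulRight_sqrt.comp measurable_fst

lemma measurable_waveletMixture_weight : Measurable
    fun e : (Matrix (Fin m) (Fin m) ℝ × MatSpace n m) × R.S =>
      waveletWeight (fun y => w y) α e.1 * R.ω e.2 :=
  ((measurable_waveletWeight w α).comp measurable_fst).mul (R.meas_ω.comp measurable_snd)

/-- The Gaussian average `∫∫ |f(u - G c(s)) ω(s)| dγ(G) dΛ(s)`. -/
def RieszMixture.absAverage (f : MatSpace n m → ℂ) (u : MatSpace n m) : ℝ≥0∞ :=
  ∫⁻ q, ‖f (u - mulRight n (R.c q.1) q.2) * R.ω q.1‖ₑ ∂(R.Λ.prod (gaussMeasure n R.l))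

lemma RieszMixture.measurable_integrand {f : MatSpace n m → ℂ} (hf : Measurable f) :
    Measurable fun r : MatSpace n m × (R.S × MatSpace n R.l) =>
      f (r.1 - mulRight n (R.c r.2.1) r.2.2) * R.ω r.2.1 :=
  (hf.comp (measurable_fst.sub (R.measurable_shift.comp measurable_snd))).mul
    (R.meas_ω.comp (measurable_fst.comp measurable_snd))

lemma RieszMixture.measurable_absAverage {f : MatSpace n m → ℂ} (hf : Measurable f) :
    Measurable (R.absAverage f) :=
  (R.measurable_integrand hf).enorm.lintegral_prod_right'

lemma lintegral_waveletMixture {ε ρ : ℝ} {f : MatSpace n m → ℂ} (hf : Measurable f)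
    (x : MatSpace n m) :
    ∫⁻ q, ‖f (x - mulRight n (CFC.sqrt q.1.1.1) q.1.1.2 - mulRight n (R.c q.1.2) q.2) *
      (waveletWeight (fun y => w y) α q.1.1 * R.ω q.1.2)‖ₑ
      ∂((((coneSlab m ε ρ).prod volume).prod R.Λ).prod (gaussMeasure n R.l)) =
    ∫⁻ a, ∫⁻ y, ‖waveletWeight (fun y => w y) α (a, y)‖ₑ *
      R.absAverage f (x - mulRight n (CFC.sqrt a) y) ∂volume ∂(coneSlab m ε ρ) := by
  have hm : Measurable fun r : (Matrix (Fin m) (Fin m) ℝ × MatSpace n m) ×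
      (R.S × MatSpace n R.l) =>
      ‖f (x - mulRight n (CFC.sqrt r.1.1) r.1.2 - mulRight n (R.c r.2.1) r.2.2) *
      (waveletWeight (fun y => w y) α r.1 * R.ω r.2.1)‖ₑ := by
    refine Measurable.enorm (Measurable.mul (hf.comp ?_) (Measurable.mul ?_ ?_))
    · exact (measurable_const.sub (measurable_mulRight_sqrt.comp measurable_fst)).sub
        (R.measurable_shift.comp measurable_snd)
    · exact (measurable_waveletWeight w α).comp measurable_fst
    · exact R.meas_ω.comp (measurable_fst.comp measurable_snd)
  have h1 := (measurePreserving_prodAssoc ((coneSlab m ε ρ).prod (volume : Measure (MatSpace n m)))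
    R.Λ (gaussMeasure n R.l)).lintegral_comp hm
  have hB : Measurable fun q : Matrix (Fin m) (Fin m) ℝ × MatSpace n m =>
      ‖waveletWeight (fun y => w y) α q‖ₑ * R.absAverage f (x - mulRight n (CFC.sqrt q.1) q.2) :=
    (measurable_waveletWeight w α).enorm.mul ((R.measurable_absAverage hf).comp
      (measurable_const.sub measurable_mulRight_sqrt))
  refine h1.trans ?_
  rw [lintegral_prod _ hm.aemeasurable]
  refine Eq.trans (lintegral_congr fun q => ?_) (lintegral_prod _ hB.aemeasurable)
  rw [RieszMixture.absAverage, ← lintegral_const_mul' _ _ enorm_ne_top]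
  refine lintegral_congr fun r => ?_
  simp only [enorm_mul]
  ring

lemma norm_sq_mulRight_sqrt_le {ε ρ : ℝ} (hε : 0 < ε) {a : Matrix (Fin m) (Fin m) ℝ}
    (ha : a ∈ coneInterval (ε • (1 : Matrix (Fin m) (Fin m) ℝ)) (ρ • 1)) (y : MatSpace n m) :
    ‖mulRight n (CFC.sqrt a) y‖ ^ 2 ≤ ρ * ‖y‖ ^ 2 := by
  rw [← trace_gram_mul y (posDef_of_mem_coneInterval hε ha).posSemidef]
  refine (trace_gram_mul_mono y ha.2.posSemidef).trans (le_of_eq ?_)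
  rw [Matrix.mul_smul, Matrix.trace_smul, Matrix.mul_one, norm_sq_eq_trace_gram, smul_eq_mul]

/-- On the interval, the substitution u = y a^{1/2} has a bounded Jacobian, and the decay of w in y
becomes decay in u of the order for which weighted averages of |f| are bounded. The interval has
finite invariant measure. -/
theorem exists_lintegral_waveletMixture_le {p : ℝ} (hp : 1 ≤ p)
    (hp' : (α.re + m - 1) / 2 < n / (2 * p)) (hα : 0 ≤ α.re) {f : MatSpace n m → ℂ}
    (hf : Measurable f) (hfp : MemLp f (ENNReal.ofReal p) volume) {ε : ℝ} (hε : 0 < ε) (ρ : ℝ) :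
    ∃ C : ℝ≥0∞, C ≠ ⊤ ∧ ∀ x : MatSpace n m,
    ∫⁻ q, ‖f (x - mulRight n (CFC.sqrt q.1.1.1) q.1.1.2 - mulRight n (R.c q.1.2) q.2) *
      (waveletWeight (fun y => w y) α q.1.1 * R.ω q.1.2)‖ₑ
      ∂((((coneSlab m ε ρ).prod volume).prod R.Λ).prod (gaussMeasure n R.l)) ≤ C := by
  obtain ⟨C₁, hC₁, hC₁x⟩ := R.exists_lintegral_le hp hp' hf hfp
  obtain ⟨C₂, hC₂0, hC₂⟩ := schwartz_norm_le w R.order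
  have hfin := isFiniteMeasure_coneSlab (m := m) hε ρ
  -- With the maximum, 1 + |y a^{1/2}|² ≤ ρ'(1 + |y|²) holds for small ρ too.
  set ρ' := max 1 ρ with hρ'
  have hρ1 : 1 ≤ ρ' := le_max_left _ _
  set K : ℝ≥0∞ := ENNReal.ofReal ((ε ^ m) ^ (-(α.re / 2))) *
    ENNReal.ofReal (C₂ * ρ' ^ R.order) with hK
  set L : ℝ≥0∞ := ENNReal.ofReal ((Real.sqrt (ε ^ m))⁻¹ ^ n) with hL
  refine ⟨K * (L * C₁) * coneSlab m ε ρ Set.univ, ENNReal.mul_ne_top (ENNReal.mul_ne_top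
    (ENNReal.mul_ne_top ENNReal.ofReal_ne_top ENNReal.ofReal_ne_top)
    (ENNReal.mul_ne_top ENNReal.ofReal_ne_top hC₁)) (measure_ne_top _ _), fun x => ?_⟩
  rw [lintegral_waveletMixture R w hf, ← lintegral_const]
  refine lintegral_mono_ae ?_
  filter_upwards [ae_mem_coneSlab ε ρ] with a ha
  have hpd := posDef_of_mem_coneInterval hε ha
  have hd := (sqrt_posDef hpd).det_pos
  set F : MatSpace n m → ℝ≥0∞ := fun y => ENNReal.ofReal ((1 + ‖y‖ ^ 2)⁻¹ ^ R.order) *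
    R.absAverage f (x - y) with hF
  have hwt : ∀ y, ‖waveletWeight (fun y => w y) α (a, y)‖ₑ ≤
      K * ENNReal.ofReal ((1 + ‖mulRight n (CFC.sqrt a) y‖ ^ 2)⁻¹ ^ R.order) := by
    intro y
    rw [waveletWeight, div_eq_mul_inv, mul_comm, enorm_mul, hK, mul_assoc]
    refine mul_le_mul' (enorm_inv_det_cpow_le hε hα ha) ?_
    rw [← ofReal_norm, ← ENNReal.ofReal_mul (by positivity)]
    refine ENNReal.ofReal_le_ofReal ((hC₂ y).trans ?_)
    rw [mul_assoc, ← mul_pow]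
    refine mul_le_mul_of_nonneg_left (pow_le_pow_left₀ (by positivity) ?_ _) hC₂0
    rw [← div_eq_mul_inv, inv_eq_one_div, div_le_div_iff₀ (by positivity) (by positivity), one_mul]
    have h1 := norm_sq_mulRight_sqrt_le (n := n) hε ha y
    have h2 : ρ * ‖y‖ ^ 2 ≤ ρ' * ‖y‖ ^ 2 :=
      mul_le_mul_of_nonneg_right (le_max_right _ _) (sq_nonneg _)
    linarith
  calc ∫⁻ y, ‖waveletWeight (fun y => w y) α (a, y)‖ₑ *
        R.absAverage f (x - mulRight n (CFC.sqrt a) y)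
      ≤ ∫⁻ y, K * F (mulRight n (CFC.sqrt a) y) := by
        refine lintegral_mono fun y => ?_
        rw [hF, ← mul_assoc]
        exact mul_le_mul_left (hwt y) _
    _ = K * (ENNReal.ofReal (|(CFC.sqrt a).det|⁻¹ ^ n) * ∫⁻ y, F y) := by
        rw [lintegral_const_mul' _ _ (ENNReal.mul_ne_top ENNReal.ofReal_ne_top
          ENNReal.ofReal_ne_top), lintegral_mulRight _ hd.ne']
    _ ≤ K * (L * C₁) := by
        refine mul_le_mul_right (mul_le_mul' (ENNReal.ofReal_le_ofReal ?_) (hC₁x x)) _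
        refine pow_le_pow_left₀ (by positivity) ?_ _
        rw [abs_of_pos hd, det_sqrt hpd.posSemidef]
        exact inv_anti₀ (by positivity)
          (Real.sqrt_le_sqrt (pow_le_det_of_mem_coneInterval hε ha))

/-- The wavelet weight is integrable in (a, y) and independent of the mixing variable, so the
integral factors and the bound of `R` applies. -/
lemma lintegral_waveletMixture_weight_le {ε : ℝ} (hε : 0 < ε) (ρ : ℝ) (hα : 0 ≤ α.re) :
    ∃ K : ℝ≥0∞, K ≠ ⊤ ∧ ∀ z : MatSpace n m, matAbs z ≠ 0 →
      ∫⁻ e : (Matrix (Fin m) (Fin m) ℝ × MatSpace n m) × R.S,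
        ‖waveletWeight (fun y => w y) α e.1 * R.ω e.2‖ₑ *
        ENNReal.ofReal (Real.exp (-(Real.pi * ‖mulRight n (R.c e.2)ᵀ z‖ ^ 2)))
        ∂(((coneSlab m ε ρ).prod volume).prod R.Λ) ≤
      K * ENNReal.ofReal (matAbs z ^ (-α.re)) := by
  obtain ⟨C, hC⟩ := R.lintegral_exp_le
  set A := ∫⁻ q, ‖waveletWeight (fun y => w y) α q‖ₑ
    ∂((coneSlab m ε ρ).prod (volume : Measure (MatSpace n m))) with hA
  have hAt : A ≠ ⊤ := (integrable_waveletWeight w hε ρ hα).2.ne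
  refine ⟨A * ENNReal.ofReal C, ENNReal.mul_ne_top hAt ENNReal.ofReal_ne_top, fun z hz => ?_⟩
  have hT : Continuous fun p : Matrix (Fin R.l) (Fin m) ℝ => mulRight n pᵀ z :=
    continuous_mulRight_uncurry.comp
      (continuous_id.matrix_transpose.prodMk continuous_const)
  have hm : Measurable fun s : R.S => ‖R.ω s‖ₑ *
      ENNReal.ofReal (Real.exp (-(Real.pi * ‖mulRight n (R.c s)ᵀ z‖ ^ 2))) := by
    refine R.meas_ω.enorm.mul (ENNReal.measurable_ofReal.comp (Real.measurable_exp.comp ?_))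
    exact (((hT.measurable.comp R.meas_c).norm.pow_const 2).const_mul _).neg
  have h1 : ∀ e : (Matrix (Fin m) (Fin m) ℝ × MatSpace n m) × R.S,
      ‖waveletWeight (fun y => w y) α e.1 * R.ω e.2‖ₑ *
        ENNReal.ofReal (Real.exp (-(Real.pi * ‖mulRight n (R.c e.2)ᵀ z‖ ^ 2))) =
      ‖waveletWeight (fun y => w y) α e.1‖ₑ * (‖R.ω e.2‖ₑ *
        ENNReal.ofReal (Real.exp (-(Real.pi * ‖mulRight n (R.c e.2)ᵀ z‖ ^ 2)))) := fun e => by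
    rw [enorm_mul, mul_assoc]
  simp_rw [h1]
  rw [lintegral_prod_mul (measurable_waveletWeight w α).enorm.aemeasurable hm.aemeasurable,
    mul_assoc]
  refine mul_le_mul_right ((hC z hz).trans (le_of_eq ?_)) _
  rw [ENNReal.ofReal_mul' (Real.rpow_nonneg (matAbs_nonneg z) _)]

lemma lintegral_schwartz_mul_matAbs_lt_top (hnm : m ≤ n) {a : ℝ} (ha : 0 ≤ a)
    (ha' : a < (n : ℝ) - m + 1) (φ : 𝓢(MatSpace n m, ℂ)) :
    ∫⁻ z, ‖φ z‖ₑ * ENNReal.ofReal (matAbs z ^ (-a)) < ⊤ := by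
  obtain ⟨C, hC0, hC⟩ := schwartz_norm_le φ (n * m + 1)
  have h := ENNReal.mul_lt_top (ENNReal.ofReal_lt_top (r := C))
    (lintegral_one_add_pow_mul_matAbs_rpow_lt_top hnm ha ha')
  rw [← lintegral_const_mul' _ _ ENNReal.ofReal_ne_top] at h
  refine lt_of_le_of_lt (lintegral_mono fun z => ?_) h
  rw [← mul_assoc, ← ENNReal.ofReal_mul hC0, ← ofReal_norm]
  exact mul_le_mul_left (ENNReal.ofReal_le_ofReal (hC z)) _

end WaveletMixture

end

end MatrixWavelet

namespace MatrixWavelet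

noncomputable section

open scoped RealInnerProductSpace Matrix

/-! ### The multiplier as an integral over the cone, and the constant d_w(α). -/

section WaveletSymbol

open scoped SchwartzMap FourierTransform

variable {n m : ℕ} {α : ℂ} (R : RieszMixture n m α) (w : 𝓢(MatSpace n m, ℂ))

/-! ### The multiplier of the truncated wavelet transform -/

lemma gram_eyeMat (hnm : m ≤ n) : gram (eyeMat n m) = 1 := by
  ext i j
  rw [gram, Matrix.mul_apply, Matrix.one_apply]
  simp only [eyeMat, toMat_ofMat, Matrix.transpose_apply, Matrix.of_apply]
  rw [Finset.sum_eq_single (Fin.castLE hnm i)]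
  · simp [Fin.ext_iff]
  · intro b _ hb
    have : ¬ b.val = i.val := fun h => hb (Fin.ext h)
    simp [this]
  · simp

/-- This provides a Borel section of x ↦ x'x over the cone. -/
lemma gram_mulRight_sqrt_eyeMat (hnm : m ≤ n) {s : Matrix (Fin m) (Fin m) ℝ} (hs : s.PosDef) :
    gram (mulRight n (CFC.sqrt s) (eyeMat n m)) = s := by
  rw [gram_mulRight, gram_eyeMat hnm, Matrix.mul_one, sqrt_transpose, sqrt_mul_sqrt hs.posSemidef]

lemma matFourier_eq (y : MatSpace n m) :
    matFourier (fun x => w x) y = ∫ x, Complex.exp (Complex.I * (⟪y, x⟫ : ℝ)) * w x := by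
  simp only [matFourier, inner_eq_trace]

lemma continuous_matFourier : Continuous (matFourier fun x => w x) := by
  have h : matFourier (fun x => w x) = fun y => 𝓕 w (-(2 * Real.pi)⁻¹ • y) := by
    ext y
    rw [matFourier_eq, SchwartzMap.fourier_coe, Real.fourier_eq']
    refine integral_congr_ae (Eventually.of_forall fun x => ?_)
    simp only [smul_eq_mul]
    rw [inner_smul_right, real_inner_comm]
    congr 2
    have hpi : (Real.pi : ℂ) ≠ 0 := by exact_mod_cast Real.pi_ne_zero
    push_cast
    field_simp
  rw [h]
  have h2 : Continuous fun y : MatSpace n m => -(2 * Real.pi)⁻¹ • y := by fun_prop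
  have h3 : Continuous fun y : MatSpace n m => (𝓕 w : 𝓢(MatSpace n m, ℂ)) y :=
    SchwartzMap.continuous _
  exact h3.comp' h2

/-- The function `u` with `(𝓕 w)(y) = u(y'y)`, for radial `w`. -/
def waveletSymbol (s : Matrix (Fin m) (Fin m) ℝ) : ℂ :=
  matFourier (fun x => w x) (mulRight n (CFC.sqrt s) (eyeMat n m))

lemma measurable_mulRight_sqrt_left (e : MatSpace n m) :
    Measurable fun s : Matrix (Fin m) (Fin m) ℝ => mulRight n (CFC.sqrt s) e := by
  have h1 : Continuous fun A : Matrix (Fin m) (Fin m) ℝ => mulRight n A e :=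
    continuous_mulRight_uncurry.comp (continuous_id.prodMk continuous_const)
  simpa only [Function.comp_def] using h1.measurable.comp (measurable_sqrt (m := m))

/-- The function `u₀` carries no measurability. The symbol is a continuous function composed with a
Borel section, and it agrees with `u₀` on the cone, so it replaces `u₀` under integrals. -/
lemma measurable_waveletSymbol : Measurable (waveletSymbol w) := by
  unfold waveletSymbol
  simpa only [Function.comp_def] using
    (continuous_matFourier w).measurable.comp (measurable_mulRight_sqrt_left (eyeMat n m))

/-- The density `u(s) |s|^{-α/2}`. -/
def symbolDensity (α : ℂ) (s : Matrix (Fin m) (Fin m) ℝ) : ℂ :=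
  waveletSymbol w s / (s.det : ℂ) ^ (α / 2)

lemma measurable_symbolDensity (α : ℂ) : Measurable (symbolDensity w α) :=
  (measurable_waveletSymbol w).div (measurable_ofReal_det_cpow _)

variable {w} {u₀ : Matrix (Fin m) (Fin m) ℝ → ℂ}

lemma waveletSymbol_eq (hnm : m ≤ n)
    (hu : ∀ y : MatSpace n m, gram y ∈ cone m → matFourier (fun x => w x) y = u₀ (gram y))
    {s : Matrix (Fin m) (Fin m) ℝ} (hs : s ∈ cone m) : waveletSymbol w s = u₀ s := by
  have h := gram_mulRight_sqrt_eyeMat (n := n) hnm hs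
  rw [waveletSymbol, hu _ (by rwa [h]), h]

/-- The Gram matrix of the argument is a^{1/2} ζ'ζ a^{1/2}. The symmetry of `u₀` exchanges a with
ζ'ζ, so that the integration variable a undergoes a congruence. -/
lemma matFourier_mulRight_sqrt (hnm : m ≤ n)
    (hu : ∀ y : MatSpace n m, gram y ∈ cone m → matFourier (fun x => w x) y = u₀ (gram y))
    (husymm : IsSymmetricFun u₀) {a : Matrix (Fin m) (Fin m) ℝ} (ha : a ∈ cone m)
    {ζ : MatSpace n m} (hζ : gram ζ ∈ cone m) :
    matFourier (fun x => w x) (mulRight n (CFC.sqrt a) ζ) =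
      waveletSymbol w (CFC.sqrt (gram ζ) * a * (CFC.sqrt (gram ζ))ᵀ) := by
  have h1 : (CFC.sqrt a * gram ζ * (CFC.sqrt a)ᵀ).PosDef :=
    (congr_posDef_iff (sqrt_posDef ha).det_pos.ne').2 hζ
  have h2 : (CFC.sqrt (gram ζ) * a * (CFC.sqrt (gram ζ))ᵀ).PosDef :=
    (congr_posDef_iff (sqrt_posDef hζ).det_pos.ne').2 ha
  have h3 : gram (mulRight n (CFC.sqrt a) ζ) = CFC.sqrt a * gram ζ * (CFC.sqrt a)ᵀ := by
    rw [gram_mulRight, sqrt_transpose]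
  rw [waveletSymbol_eq hnm hu h2, hu _ (by rw [h3]; exact h1), h3, sqrt_transpose, sqrt_transpose]
  exact husymm _ hζ _ ha

lemma matAbs_smul (t : ℝ) (ht : 0 ≤ t) (z : MatSpace n m) : matAbs (t • z) = t ^ m * matAbs z := by
  rw [matAbs, gram_smul, Matrix.det_smul, Fintype.card_fin, ← pow_mul, mul_comm 2 m, pow_mul,
    Real.sqrt_mul (sq_nonneg _), Real.sqrt_sq (pow_nonneg ht m), matAbs]

/-- The multiplier factors into a wavelet part and a potential part by Fubini. The scaling 2πz
reconciles the kernel e^{i tr(y'x)} with e^{2πi⟨x,z⟩}. -/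
lemma waveletMultiplier_eq_mul (w : 𝓢(MatSpace n m, ℂ)) (hα : 0 ≤ α.re) {ε : ℝ} (hε : 0 < ε)
    (ρ : ℝ) {z : MatSpace n m} (hz : matAbs z ≠ 0) :
    waveletMultiplier R w ε ρ z = (∫ a, ((a.det : ℂ) ^ (α / 2))⁻¹ *
      matFourier (fun x => w x) (mulRight n (CFC.sqrt a) ((2 * Real.pi) • z)) ∂(coneSlab m ε ρ)) *
        (matAbs ((2 * Real.pi) • z) : ℂ) ^ (-α) := by
  rw [matAbs_smul _ (by positivity), ← R.integral_exp z hz, waveletMultiplier, mixtureMultiplier]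
  have hi : Integrable (fun q : Matrix (Fin m) (Fin m) ℝ × MatSpace n m =>
      waveletWeight (fun y => w y) α q *
        Complex.exp (2 * Real.pi * Complex.I * (⟪mulRight n (CFC.sqrt q.1) q.2, z⟫ : ℝ)))
      ((coneSlab m ε ρ).prod volume) := by
    have hm : Measurable fun q : Matrix (Fin m) (Fin m) ℝ × MatSpace n m =>
        waveletWeight (fun y => w y) α q *
          Complex.exp (2 * Real.pi * Complex.I * (⟪mulRight n (CFC.sqrt q.1) q.2, z⟫ : ℝ)) := by
      have h1 : Measurable fun q : Matrix (Fin m) (Fin m) ℝ × MatSpace n m =>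
          ⟪mulRight n (CFC.sqrt q.1) q.2, z⟫ := measurable_mulRight_sqrt.inner measurable_const
      exact (measurable_waveletWeight w α).mul
        (Complex.measurable_exp.comp ((Complex.measurable_ofReal.comp h1).const_mul _))
    refine (integrable_waveletWeight w hε ρ hα).mono hm.aestronglyMeasurable
      (Eventually.of_forall fun q => ?_)
    rw [norm_mul, norm_exp_two_pi_I, mul_one]
  have hA : (∫ a, ((a.det : ℂ) ^ (α / 2))⁻¹ *
      matFourier (fun x => w x) (mulRight n (CFC.sqrt a) ((2 * Real.pi) • z)) ∂(coneSlab m ε ρ)) =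
      ∫ q : Matrix (Fin m) (Fin m) ℝ × MatSpace n m, waveletWeight (fun y => w y) α q *
        Complex.exp (2 * Real.pi * Complex.I * (⟪mulRight n (CFC.sqrt q.1) q.2, z⟫ : ℝ))
        ∂((coneSlab m ε ρ).prod volume) := by
    rw [integral_prod _ hi]
    refine integral_congr_ae (Eventually.of_forall fun a => ?_)
    simp only
    rw [matFourier_eq, ← integral_const_mul]
    refine integral_congr_ae (Eventually.of_forall fun y => ?_)
    simp only [waveletWeight]
    rw [inner_mulRight, sqrt_transpose, inner_smul_left, real_inner_comm]
    simp only [conj_trivial]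
    push_cast
    ring_nf
  rw [hA, ← integral_prod_mul (L := ℂ)]
  refine integral_congr_ae (Eventually.of_forall fun e => ?_)
  simp only
  ring

/-- With ζ = 2πz and r = ζ'ζ, |ζ|_m^{-α} |a|^{-α/2} is a power of |r^{1/2} a r^{1/2}|, so both
factors merge into one function of r^{1/2} a r^{1/2}. -/
lemma waveletMultiplier_eq (hnm : m ≤ n)
    (hu : ∀ y : MatSpace n m, gram y ∈ cone m → matFourier (fun x => w x) y = u₀ (gram y))
    (husymm : IsSymmetricFun u₀) (hα : 0 ≤ α.re) {ε : ℝ} (hε : 0 < ε) (ρ : ℝ) {z : MatSpace n m}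
    (hz : matAbs z ≠ 0) :
    waveletMultiplier R w ε ρ z =
      ∫ a in coneInterval (ε • (1 : Matrix (Fin m) (Fin m) ℝ)) (ρ • 1),
        symbolDensity w α (CFC.sqrt (gram ((2 * Real.pi) • z)) * a *
          (CFC.sqrt (gram ((2 * Real.pi) • z)))ᵀ) ∂(coneMeasure m) := by
  set ζ := (2 * Real.pi) • z with hζd
  have hζ0 : matAbs ζ ≠ 0 := by
    rw [hζd, matAbs_smul _ (by positivity)]
    exact mul_ne_zero (by positivity) hz
  have hζ : (gram ζ).PosDef := (gram_posDef_iff ζ).2 hζ0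
  have hζp : 0 < matAbs ζ := (matAbs_pos ζ).2 hζ
  rw [waveletMultiplier_eq_mul R w hα hε ρ hz, ← integral_mul_const, ← coneSlab]
  refine integral_congr_ae ?_
  filter_upwards [ae_mem_coneSlab ε ρ] with a ha
  have hpd : a.PosDef := posDef_of_mem_coneInterval hε ha
  have hd := hpd.det_pos
  have hdet : (CFC.sqrt (gram ζ) * a * (CFC.sqrt (gram ζ))ᵀ).det = matAbs ζ ^ 2 * a.det := by
    rw [Matrix.det_mul, Matrix.det_mul, Matrix.det_transpose, mul_right_comm, ← Matrix.det_mul,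
      sqrt_mul_sqrt hζ.posSemidef, ← matAbs_sq]
  rw [matFourier_mulRight_sqrt hnm hu husymm hpd hζ, symbolDensity, hdet, ← hζd]
  have h1 : ((matAbs ζ ^ 2 * a.det : ℝ) : ℂ) ^ (α / 2) =
      (a.det : ℂ) ^ (α / 2) * (matAbs ζ : ℂ) ^ α := by
    rw [ofReal_cpow_eq_exp (by positivity), ofReal_cpow_eq_exp hd, ofReal_cpow_eq_exp hζp,
      Real.log_mul (by positivity) hd.ne', Real.log_pow, ← Complex.exp_add]
    congr 1
    push_cast
    ring
  rw [h1, Complex.cpow_neg, div_eq_mul_inv (waveletSymbol w _), mul_inv]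
  ring

/-- Congruence by the square root of a positive definite matrix. -/
def sqrtCongr {r : Matrix (Fin m) (Fin m) ℝ} (hr : r.PosDef) :
    Matrix (Fin m) (Fin m) ℝ ≃ᵐ Matrix (Fin m) (Fin m) ℝ :=
  congrEquiv (CFC.sqrt r) (sqrt_posDef hr).det_pos.ne'

lemma measurePreserving_sqrtCongr {r : Matrix (Fin m) (Fin m) ℝ} (hr : r.PosDef) :
    MeasurePreserving (sqrtCongr hr) (coneMeasure m) (coneMeasure m) :=
  measurePreserving_congr _ _

/-- The congruence depends on z alone, so one measure preserving map serves all ε and ρ. -/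
lemma waveletMultiplier_eq_sqrtCongr (hnm : m ≤ n)
    (hu : ∀ y : MatSpace n m, gram y ∈ cone m → matFourier (fun x => w x) y = u₀ (gram y))
    (husymm : IsSymmetricFun u₀) (hα : 0 ≤ α.re) {z : MatSpace n m} (hz : matAbs z ≠ 0) :
    ∃ (r : Matrix (Fin m) (Fin m) ℝ) (hr : r.PosDef), ∀ ε ρ : ℝ, 0 < ε →
      waveletMultiplier R w ε ρ z =
        ∫ a in coneInterval (ε • (1 : Matrix (Fin m) (Fin m) ℝ)) (ρ • 1),
          symbolDensity w α (sqrtCongr hr a) ∂(coneMeasure m) := by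
  have hr : (gram ((2 * Real.pi) • z)).PosDef := by
    rw [gram_posDef_iff, matAbs_smul _ (by positivity)]
    exact mul_ne_zero (by positivity) hz
  exact ⟨_, hr, fun ε ρ hε => waveletMultiplier_eq R hnm hu husymm hα hε ρ hz⟩

/-- Invariance of d_* under the congruence makes the bound independent of z, ε and ρ. -/
lemma norm_waveletMultiplier_le (hnm : m ≤ n)
    (hu : ∀ y : MatSpace n m, gram y ∈ cone m → matFourier (fun x => w x) y = u₀ (gram y))
    (husymm : IsSymmetricFun u₀) (hα : 0 ≤ α.re)
    (hg : Integrable (symbolDensity w α) (coneMeasure m)) {ε : ℝ} (hε : 0 < ε) (ρ : ℝ)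
    {z : MatSpace n m} (hz : matAbs z ≠ 0) :
    ‖waveletMultiplier R w ε ρ z‖ ≤ ∫ s, ‖symbolDensity w α s‖ ∂(coneMeasure m) := by
  obtain ⟨r, hr, h⟩ := waveletMultiplier_eq_sqrtCongr R hnm hu husymm hα hz
  have hmp := measurePreserving_sqrtCongr hr
  have hi := (hmp.integrable_comp_emb (sqrtCongr hr).measurableEmbedding).2 hg
  rw [h ε ρ hε]
  refine (norm_integral_le_integral_norm _).trans ?_
  rw [← hmp.integral_comp (sqrtCongr hr).measurableEmbedding]
  exact setIntegral_le_integral hi.norm (Eventually.of_forall fun a => norm_nonneg _)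

/-- The intervals exhaust the cone, and invariance removes z from the limit. This is why the
limiting operator is a multiple of the identity. -/
lemma tendsto_waveletMultiplier (hnm : m ≤ n)
    (hu : ∀ y : MatSpace n m, gram y ∈ cone m → matFourier (fun x => w x) y = u₀ (gram y))
    (husymm : IsSymmetricFun u₀) (hα : 0 ≤ α.re)
    (hg : Integrable (symbolDensity w α) (coneMeasure m)) {z : MatSpace n m} (hz : matAbs z ≠ 0) :
    Tendsto (fun q : ℝ × ℝ => waveletMultiplier R w q.1 q.2 z) (𝓝[>] (0 : ℝ) ×ˢ atTop)
      (𝓝 (∫ s, symbolDensity w α s ∂(coneMeasure m))) := by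
  obtain ⟨r, hr, h⟩ := waveletMultiplier_eq_sqrtCongr R hnm hu husymm hα hz
  have hmp := measurePreserving_sqrtCongr hr
  have hi := (hmp.integrable_comp_emb (sqrtCongr hr).measurableEmbedding).2 hg
  have hpos : ∀ᶠ q : ℝ × ℝ in 𝓝[>] (0 : ℝ) ×ˢ atTop, 0 < q.1 :=
    tendsto_fst.eventually self_mem_nhdsWithin
  rw [← hmp.integral_comp (sqrtCongr hr).measurableEmbedding]
  have hlim : Tendsto (fun q : ℝ × ℝ => ∫ a, (coneInterval
      (q.1 • (1 : Matrix (Fin m) (Fin m) ℝ)) (q.2 • 1)).indicator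
        (fun a => symbolDensity w α (sqrtCongr hr a)) a ∂(coneMeasure m))
      (𝓝[>] (0 : ℝ) ×ˢ atTop)
      (𝓝 (∫ a, symbolDensity w α (sqrtCongr hr a) ∂(coneMeasure m))) := by
    refine tendsto_integral_filter_of_dominated_convergence
      (fun a => ‖symbolDensity w α (sqrtCongr hr a)‖) ?_ ?_ hi.norm ?_
    · exact Eventually.of_forall fun q => hi.1.indicator (measurableSet_coneInterval _ _)
    · exact Eventually.of_forall fun q => Eventually.of_forall fun a => norm_indicator_le_norm_self _ _
    · filter_upwards [ae_mem_cone] with a (ha : a.PosDef)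
      refine tendsto_const_nhds.congr' ?_
      filter_upwards [eventually_mem_coneInterval ha] with q hq
      rw [Set.indicator_of_mem hq]
  refine hlim.congr' ?_
  filter_upwards [hpos] with q hq
  rw [h _ _ hq, integral_indicator (measurableSet_coneInterval _ _)]

/-! ### The constant of the wavelet -/

lemma ae_matFourier_div_eq (hnm : m ≤ n)
    (hu : ∀ y : MatSpace n m, gram y ∈ cone m → matFourier (fun x => w x) y = u₀ (gram y)) (α : ℂ) :
    (fun z : MatSpace n m => matFourier (fun x => w x) z /
      ((matAbs z : ℝ) : ℂ) ^ ((n : ℂ) + α)) =ᵐ[volume]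
      fun z => waveletSymbol w (gram z) / ((gram z).det : ℂ) ^ (((n : ℂ) + α) / 2) := by
  filter_upwards [ae_matAbs_ne_zero hnm] with z hz
  have hg : gram z ∈ cone m := (gram_posDef_iff z).2 hz
  have hp : 0 < matAbs z := (matAbs_pos z).2 hg
  rw [waveletSymbol_eq hnm hu hg, hu z hg, ← matAbs_sq, ofReal_cpow_eq_exp hp,
    ofReal_cpow_eq_exp (by positivity), Real.log_pow]
  congr 2
  push_cast
  ring

lemma measurable_waveletSymbol_div (w : 𝓢(MatSpace n m, ℂ)) (β : ℂ) :
    Measurable fun s : Matrix (Fin m) (Fin m) ℝ => waveletSymbol w s / (s.det : ℂ) ^ β :=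
  (measurable_waveletSymbol w).div (measurable_ofReal_det_cpow _)

lemma det_rpow_mul_waveletSymbol_div {s : Matrix (Fin m) (Fin m) ℝ} (hs : s ∈ cone m)
    (w : 𝓢(MatSpace n m, ℂ)) (α : ℂ) :
    ((s.det ^ ((n : ℝ) / 2) : ℝ) : ℂ) * (waveletSymbol w s / (s.det : ℂ) ^ (((n : ℂ) + α) / 2)) =
      symbolDensity w α s := by
  have hd : 0 < s.det := Matrix.PosDef.det_pos hs
  have h0 : ((s.det ^ ((n : ℝ) / 2) : ℝ) : ℂ) ≠ 0 := by
    exact_mod_cast (Real.rpow_pos_of_pos hd _).ne'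
  have h1 : (s.det : ℂ) ^ (((n : ℂ) + α) / 2) =
      ((s.det ^ ((n : ℝ) / 2) : ℝ) : ℂ) * (s.det : ℂ) ^ (α / 2) := by
    rw [Complex.ofReal_cpow hd.le, ofReal_cpow_eq_exp hd, ofReal_cpow_eq_exp hd,
      ofReal_cpow_eq_exp hd, ← Complex.exp_add]
    congr 1
    push_cast
    ring
  rw [h1, symbolDensity, mul_div_assoc', mul_div_mul_left _ _ h0]

/-- Polar coordinates turn absolute convergence of d_w(α) into that of ∫ g d_*; the polar constant
is not 0, so finiteness carries over. -/
lemma integrable_symbolDensity (hnm : m ≤ n)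
    (hu : ∀ y : MatSpace n m, gram y ∈ cone m → matFourier (fun x => w x) y = u₀ (gram y))
    (hd : Integrable (fun z : MatSpace n m =>
      matFourier (fun x => w x) z / ((matAbs z : ℝ) : ℂ) ^ ((n : ℂ) + α)) volume) :
    Integrable (symbolDensity w α) (coneMeasure m) := by
  refine ⟨(measurable_symbolDensity w α).aestronglyMeasurable, ?_⟩
  have h1 := (hd.congr (ae_matFourier_div_eq hnm hu α)).2
  rw [hasFiniteIntegral_iff_enorm, lintegral_gram (n := n) hnm
    (measurable_waveletSymbol_div w (((n : ℂ) + α) / 2)).enorm] at h1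
  rw [hasFiniteIntegral_iff_enorm]
  have h2 : ∫⁻ s, ‖symbolDensity w α s‖ₑ ∂(coneMeasure m) =
      ∫⁻ r, ENNReal.ofReal (r.det ^ ((n : ℝ) / 2)) *
        ‖waveletSymbol w r / (r.det : ℂ) ^ (((n : ℂ) + α) / 2)‖ₑ ∂(coneMeasure m) := by
    refine lintegral_congr_ae ?_
    filter_upwards [ae_mem_cone] with r hr
    have hdr : 0 < r.det := Matrix.PosDef.det_pos hr
    rw [← det_rpow_mul_waveletSymbol_div (n := n) hr, enorm_mul, ← ofReal_norm (Complex.ofReal _),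
      Complex.norm_real, Real.norm_of_nonneg (by positivity)]
  rw [h2]
  refine lt_top_iff_ne_top.2 fun htop => ?_
  rw [htop, ENNReal.mul_top (polarConst_ne_zero hnm)] at h1
  exact lt_irrefl _ h1

/-- The factor |r|^{n/2} of polar coordinates cancels the part n/2 of the exponent, and 2^m/σ_{n,m}
is the reciprocal of the polar constant. -/
lemma waveletConst_eq (hnm : m ≤ n)
    (hu : ∀ y : MatSpace n m, gram y ∈ cone m → matFourier (fun x => w x) y = u₀ (gram y)) (α : ℂ) :
    waveletConst (fun x => w x) α = ∫ s, symbolDensity w α s ∂(coneMeasure m) := by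
  have hG := coneGamma_pos_lt_top m _ (half_gt_of_le hnm)
  have hS := siegelGamma_ofReal (m := m) ((n : ℝ) / 2)
  push_cast at hS
  have hG' : ((coneGamma m ((n : ℝ) / 2)).toReal : ℂ) ≠ 0 := by
    exact_mod_cast (ENNReal.toReal_pos hG.1 hG.2).ne'
  have hpi : (Real.pi : ℂ) ^ ((n : ℂ) * m / 2) ≠ 0 := by
    rw [ofReal_cpow_eq_exp Real.pi_pos]
    exact Complex.exp_ne_zero _
  have hc : (2 : ℂ) ^ m / stiefelMass n m * ((polarConst n m).toReal : ℂ) = 1 := by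
    have h1 : ((Real.pi ^ ((n : ℝ) * m / 2) : ℝ) : ℂ) = (Real.pi : ℂ) ^ ((n : ℂ) * m / 2) := by
      rw [Complex.ofReal_cpow Real.pi_pos.le]
      push_cast
      rfl
    rw [stiefelMass, polarConst, ENNReal.toReal_div, ENNReal.toReal_ofReal (by positivity), hS,
      Complex.ofReal_div, h1]
    field_simp
  rw [waveletConst, integral_congr_ae (ae_matFourier_div_eq hnm hu α),
    integral_gram (n := n) hnm (measurable_waveletSymbol_div w (((n : ℂ) + α) / 2)), ← mul_assoc,
    hc, one_mul]
  refine integral_congr_ae ?_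
  filter_upwards [ae_mem_cone] with r hr
  exact det_rpow_mul_waveletSymbol_div hr w α

end WaveletSymbol

end

end MatrixWavelet

namespace MatrixWavelet

noncomputable section

open scoped RealInnerProductSpace Matrix

/-! ### Null sets, almost everywhere convergence, and the truncated integral as a mixture. -/

section Representation

open scoped SchwartzMap FourierTransform

variable {n m : ℕ} {α : ℂ}

/-! ### Dependence of Riesz potentials on null sets -/

/-- For fixed y the translation x ↦ x - y respects null sets, and Fubini exchanges the quantifiers.
Hence ν may be singular, as the rank measures are when k < m. -/
lemma ae_ae_comp_sub_eq (ν : Measure (MatSpace n m)) [SFinite ν] {f g : MatSpace n m → ℂ}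
    (h : f =ᵐ[volume] g) : ∀ᵐ x : MatSpace n m, (fun y => f (x - y)) =ᵐ[ν] fun y => g (x - y) := by
  obtain ⟨N, hN, hNm, hN0⟩ := exists_measurable_superset_of_null h
  have hp : MeasurableSet {q : MatSpace n m × MatSpace n m | q.1 - q.2 ∈ Nᶜ} :=
    (measurable_fst.sub measurable_snd) hNm.compl
  have hae : ∀ᵐ u : MatSpace n m, u ∈ Nᶜ := compl_mem_ae_iff.2 hN0
  have h1 : ∀ᵐ x : MatSpace n m, ∀ᵐ y ∂ν, x - y ∈ Nᶜ := by
    rw [Measure.ae_ae_comm (p := fun x y : MatSpace n m => x - y ∈ Nᶜ) hp]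
    exact Eventually.of_forall fun y =>
      (measurePreserving_sub_right volume y).quasiMeasurePreserving.ae hae
  filter_upwards [h1] with x hx
  filter_upwards [hx] with y hy
  by_contra hne
  exact hy (hN hne)

instance (k : ℕ) : SFinite (rankMeasure n m k) := by
  unfold rankMeasure
  infer_instance

lemma ae_rieszPotential_congr {f g : MatSpace n m → ℂ} (h : f =ᵐ[volume] g) :
    ∀ᵐ x : MatSpace n m, (RieszConverges n m α f x ↔ RieszConverges n m α g x) ∧
      rieszPotential n m α f x = rieszPotential n m α g x := by
  by_cases hα : (m : ℝ) - 1 < α.re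
  · filter_upwards [ae_ae_comp_sub_eq volume h] with x hx
    have h1 : (fun y => f (x - y) * ((matAbs y : ℝ) : ℂ) ^ (α - n)) =ᵐ[volume]
        fun y => g (x - y) * ((matAbs y : ℝ) : ℂ) ^ (α - n) := by
      filter_upwards [hx] with y hy
      rw [hy]
    simp only [RieszConverges, rieszPotential, if_pos hα]
    exact ⟨integrable_congr h1, by rw [integral_congr_ae h1]⟩
  · filter_upwards [ae_ae_comp_sub_eq (rankMeasure n m ⌊α.re⌋₊) h] with x hx
    simp only [RieszConverges, rieszPotential, if_neg hα]
    exact ⟨integrable_congr hx, by rw [integral_congr_ae hx]⟩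

/-- For each a in the interval y ↦ x - y a^{1/2} is an invertible affine map, so it pulls null sets
back to null sets. -/
lemma ae_comp_sub_mulRight_sqrt {P : MatSpace n m → Prop} (h : ∀ᵐ u, P u) {ε : ℝ} (hε : 0 < ε)
    (ρ : ℝ) (x : MatSpace n m) :
    ∀ᵐ q : Matrix (Fin m) (Fin m) ℝ × MatSpace n m ∂((coneSlab m ε ρ).prod volume),
      P (x - mulRight n (CFC.sqrt q.1) q.2) := by
  obtain ⟨N, hN, hNm, hN0⟩ := exists_measurable_superset_of_null (ae_iff.1 h)
  have hm : Measurable fun q : Matrix (Fin m) (Fin m) ℝ × MatSpace n m =>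
      x - mulRight n (CFC.sqrt q.1) q.2 := measurable_const.sub measurable_mulRight_sqrt
  have hi : Measurable fun q : Matrix (Fin m) (Fin m) ℝ × MatSpace n m =>
      N.indicator (1 : MatSpace n m → ℝ≥0∞) (x - mulRight n (CFC.sqrt q.1) q.2) :=
    (measurable_one.indicator hNm).comp hm
  have h0 : ∫⁻ q : Matrix (Fin m) (Fin m) ℝ × MatSpace n m,
      N.indicator 1 (x - mulRight n (CFC.sqrt q.1) q.2) ∂((coneSlab m ε ρ).prod volume) = 0 := by
    rw [lintegral_prod _ hi.aemeasurable, ← lintegral_zero (μ := coneSlab m ε ρ)]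
    refine lintegral_congr_ae ?_
    filter_upwards [ae_mem_coneSlab ε ρ] with a ha
    have hd := (sqrt_posDef (posDef_of_mem_coneInterval hε ha)).det_pos
    rw [lintegral_mulRight (F := fun u => N.indicator 1 (x - u)) _ hd.ne',
      lintegral_sub_left_eq_self (fun u => N.indicator (1 : MatSpace n m → ℝ≥0∞) u) x,
      lintegral_indicator_one hNm, hN0, mul_zero]
  filter_upwards [(lintegral_eq_zero_iff hi).1 h0] with q hq
  by_contra hne
  have hmem : x - mulRight n (CFC.sqrt q.1) q.2 ∈ N := hN hne
  simp [Set.indicator_of_mem hmem] at hq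

/-! ### Wavelet transforms of Riesz potentials as mixtures -/

variable (R : RieszMixture n m α) (w : 𝓢(MatSpace n m, ℂ))

/-- At the single point x = 0 the weighted integral of the absolute averages is finite, and the
weight is positive; so the averages are finite almost everywhere. -/
theorem RieszMixture.ae_rieszConverges (R : RieszMixture n m α) {p : ℝ} (hp : 1 ≤ p)
    (hp' : (α.re + m - 1) / 2 < n / (2 * p)) {f : MatSpace n m → ℂ} (hf : Measurable f)
    (hfp : MemLp f (ENNReal.ofReal p) volume) : ∀ᵐ x : MatSpace n m, RieszConverges n m α f x := by
  obtain ⟨C, hC, hCx⟩ := R.exists_lintegral_le hp hp' hf hfp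
  have hm : Measurable fun y : MatSpace n m => ENNReal.ofReal ((1 + ‖y‖ ^ 2)⁻¹ ^ R.order) *
      R.absAverage f (0 - y) := by
    refine Measurable.mul ?_ ((R.measurable_absAverage hf).comp (measurable_const.sub measurable_id))
    fun_prop
  have h1 : ∀ᵐ y : MatSpace n m, R.absAverage f (0 - y) < ⊤ := by
    filter_upwards [ae_lt_top hm (ne_top_of_le_ne_top hC (hCx 0))] with y hy
    rcases ENNReal.mul_lt_top_iff.1 hy with h | h | h
    · exact h.2
    · rw [ENNReal.ofReal_eq_zero] at h
      exact absurd h (not_le.2 (by positivity))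
    · rw [h]
      exact ENNReal.zero_lt_top
  have h2 : ∀ᵐ x : MatSpace n m, R.absAverage f x < ⊤ := by
    have := (Measure.measurePreserving_sub_left (volume : Measure (MatSpace n m)) 0)
      |>.quasiMeasurePreserving.ae h1
    simpa using this
  filter_upwards [h2] with x hx
  have hmx : Measurable fun q : R.S × MatSpace n R.l =>
      f (x - mulRight n (R.c q.1) q.2) * R.ω q.1 :=
    (R.measurable_integrand hf).comp measurable_prodMk_left
  exact (R.rep f hf x ⟨hmx.aestronglyMeasurable, hx⟩).1

/-- Since the whole mixture converges absolutely, the mixing and Gaussian variables can be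
integrated out first, and `rep` reproduces the potential. Passing from f to g costs only a null set
of pairs (a, y). -/
theorem truncatedInverse_eq_waveletMixture {f g : MatSpace n m → ℂ} (hg : Measurable g)
    (hfg : f =ᵐ[volume] g) {ε : ℝ} (hε : 0 < ε) (ρ : ℝ) (x : MatSpace n m)
    (hfin : ∫⁻ q, ‖g (x - mulRight n (CFC.sqrt q.1.1.1) q.1.1.2 - mulRight n (R.c q.1.2) q.2) *
      (waveletWeight (fun y => w y) α q.1.1 * R.ω q.1.2)‖ₑ
      ∂((((coneSlab m ε ρ).prod volume).prod R.Λ).prod (gaussMeasure n R.l)) < ⊤) :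
    Integrable (fun q : Matrix (Fin m) (Fin m) ℝ × MatSpace n m =>
      rieszPotential n m α f (x - rmul q.2 (CFC.sqrt q.1)) * w q.2 /
        ((q.1.det : ℝ) : ℂ) ^ (α / 2)) ((coneSlab m ε ρ).prod volume) ∧
      truncatedInverse (fun y => w y) α ε ρ (rieszPotential n m α f) x =
        waveletMixture R w ε ρ g x := by
  have hm : Measurable fun r : (Matrix (Fin m) (Fin m) ℝ × MatSpace n m) ×
      (R.S × MatSpace n R.l) =>
      g (x - mulRight n (CFC.sqrt r.1.1) r.1.2 - mulRight n (R.c r.2.1) r.2.2) *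
      (waveletWeight (fun y => w y) α r.1 * R.ω r.2.1) := by
    refine Measurable.mul (hg.comp ?_) (Measurable.mul ?_ ?_)
    · exact (measurable_const.sub (measurable_mulRight_sqrt.comp measurable_fst)).sub
        (R.measurable_shift.comp measurable_snd)
    · exact (measurable_waveletWeight w α).comp measurable_fst
    · exact R.meas_ω.comp (measurable_fst.comp measurable_snd)
  have hmp := measurePreserving_prodAssoc
    ((coneSlab m ε ρ).prod (volume : Measure (MatSpace n m))) R.Λ (gaussMeasure n R.l)
  have hi : Integrable (fun r : (Matrix (Fin m) (Fin m) ℝ × MatSpace n m) ×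
      (R.S × MatSpace n R.l) =>
      g (x - mulRight n (CFC.sqrt r.1.1) r.1.2 - mulRight n (R.c r.2.1) r.2.2) *
      (waveletWeight (fun y => w y) α r.1 * R.ω r.2.1))
      (((coneSlab m ε ρ).prod volume).prod (R.Λ.prod (gaussMeasure n R.l))) := by
    refine ⟨hm.aestronglyMeasurable, ?_⟩
    rw [hasFiniteIntegral_iff_enorm, ← hmp.lintegral_comp hm.enorm]
    exact hfin
  have hint : ∀ᵐ q : Matrix (Fin m) (Fin m) ℝ × MatSpace n m ∂((coneSlab m ε ρ).prod volume),
      (∫ r : R.S × MatSpace n R.l,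
        g (x - mulRight n (CFC.sqrt q.1) q.2 - mulRight n (R.c r.1) r.2) *
          (waveletWeight (fun y => w y) α q * R.ω r.1) ∂(R.Λ.prod (gaussMeasure n R.l))) =
      rieszPotential n m α f (x - rmul q.2 (CFC.sqrt q.1)) * w q.2 /
        ((q.1.det : ℝ) : ℂ) ^ (α / 2) := by
    filter_upwards [hi.prod_right_ae, ae_comp_sub_mulRight_sqrt
      (ae_rieszPotential_congr (α := α) hfg) hε ρ x] with q hq hq'
    have h1 : ∀ r : R.S × MatSpace n R.l,
        g (x - mulRight n (CFC.sqrt q.1) q.2 - mulRight n (R.c r.1) r.2) *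
          (waveletWeight (fun y => w y) α q * R.ω r.1) = waveletWeight (fun y => w y) α q *
        (g (x - mulRight n (CFC.sqrt q.1) q.2 - mulRight n (R.c r.1) r.2) * R.ω r.1) :=
      fun r => by ring
    rw [rmul_eq_mulRight, hq'.2, mul_div_assoc]
    simp only [h1] at hq ⊢
    rw [integral_const_mul]
    change _ = _ * waveletWeight (fun y => w y) α q
    -- Where the weight vanishes both sides are 0; elsewhere it can be divided out to obtain the
    -- integrability that `rep` requires.
    by_cases h0 : waveletWeight (fun y => w y) α q = 0
    · rw [h0, zero_mul, mul_zero]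
    · have h2 := (integrable_const_mul_iff (isUnit_iff_ne_zero.2 h0) _).1 hq
      rw [(R.rep g hg _ h2).2, mul_comm]
  have hI := hi.integral_prod_left.congr hint
  refine ⟨hI, ?_⟩
  have h3 : waveletMixture R w ε ρ g x =
      ∫ r : (Matrix (Fin m) (Fin m) ℝ × MatSpace n m) × (R.S × MatSpace n R.l),
      g (x - mulRight n (CFC.sqrt r.1.1) r.1.2 - mulRight n (R.c r.2.1) r.2.2) *
      (waveletWeight (fun y => w y) α r.1 * R.ω r.2.1)
      ∂(((coneSlab m ε ρ).prod volume).prod (R.Λ.prod (gaussMeasure n R.l))) := by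
    rw [← hmp.integral_comp MeasurableEquiv.prodAssoc.measurableEmbedding]
    rfl
  rw [h3, integral_prod _ hi, integral_congr_ae hint, integral_prod _ hI, truncatedInverse,
    ← coneSlab]
  refine integral_congr_ae (Eventually.of_forall fun a => ?_)
  simp only [waveletTransform]
  rw [integral_div]

end Representation

end

end MatrixWavelet

namespace MatrixWavelet

noncomputable section

open scoped RealInnerProductSpace Matrix

/-! ### Limits: exhaustion by z'z < B and convergence of the multiplier operators. -/

section Inversion

open scoped SchwartzMap FourierTransform

variable {n m : ℕ} {α : ℂ}

/-! ### Exhaustion of the matrix space -/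

lemma measurableSet_gram_lt (B : Matrix (Fin m) (Fin m) ℝ) :
    MeasurableSet {z : MatSpace n m | (B - gram z).PosDef} :=
  (measurableSet_cone (m := m)).preimage (continuous_const.sub continuous_gram).measurable

/-- The sets z'z < kI exhaust the space and lie inside z'z < B as soon as B > kI, so one tail of
∫|F| controls all such B. -/
lemma exists_norm_setIntegral_gram_lt_sub_lt {F : MatSpace n m → ℂ} (hF : Integrable F volume)
    {δ : ℝ} (hδ : 0 < δ) : ∃ B₀ ∈ cone m, ∀ B : Matrix (Fin m) (Fin m) ℝ, (B - B₀) ∈ cone m →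
      ‖(∫ z in {z : MatSpace n m | (B - gram z).PosDef}, F z) - ∫ z, F z‖ < δ := by
  have hlim : Tendsto (fun k : ℝ => ∫ z, ({z : MatSpace n m |
      (k • (1 : Matrix (Fin m) (Fin m) ℝ) - gram z).PosDef}ᶜ).indicator (fun z => ‖F z‖) z) atTop
      (𝓝 (∫ _ : MatSpace n m, (0 : ℝ))) := by
    refine tendsto_integral_filter_of_dominated_convergence (fun z => ‖F z‖) ?_ ?_ hF.norm ?_
    · exact Eventually.of_forall fun k => hF.norm.1.indicator (measurableSet_gram_lt _).compl
    · refine Eventually.of_forall fun k => Eventually.of_forall fun z => ?_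
      exact (norm_indicator_le_norm_self _ _).trans_eq (norm_norm _)
    · refine Eventually.of_forall fun z => tendsto_const_nhds.congr' ?_
      filter_upwards [eventually_posDef_smul_one_sub (gram_posSemidef z).isHermitian] with k hk
      rw [Set.indicator_of_notMem]
      exact fun h => h hk
  rw [integral_zero] at hlim
  obtain ⟨k, hk, hk0⟩ := ((hlim.eventually (gt_mem_nhds hδ)).and (eventually_gt_atTop 0)).exists
  refine ⟨k • 1, Matrix.PosDef.one.smul hk0, fun B hB => lt_of_le_of_lt ?_ hk⟩
  rw [integral_indicator (measurableSet_gram_lt _).compl,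
    ← integral_add_compl (measurableSet_gram_lt B) hF, sub_add_cancel_left, norm_neg]
  refine (norm_integral_le_integral_norm _).trans (setIntegral_mono_set hF.norm.integrableOn
    (Eventually.of_forall fun z => norm_nonneg _) (LE.le.eventuallyLE ?_))
  refine Set.compl_subset_compl.2 fun z hz => ?_
  have h1 : (B - k • (1 : Matrix (Fin m) (Fin m) ℝ)).PosDef := hB
  have h2 : (k • (1 : Matrix (Fin m) (Fin m) ℝ) - gram z).PosDef := hz
  have h3 := h1.add h2
  rwa [sub_add_sub_cancel] at h3

/-! ### Convergence of multipliers -/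

lemma tendsto_eLpNorm_sub_mul {ι : Type*} {l : Filter ι} [l.IsCountablyGenerated]
    {M : ι → MatSpace n m → ℂ} {d : ℂ} {D : ℝ} {F : MatSpace n m → ℂ} (hF : MemLp F 2 volume)
    (hM : ∀ᶠ i in l, AEStronglyMeasurable (M i) volume)
    (hD : ∀ᶠ i in l, ∀ᵐ z : MatSpace n m, ‖M i z - d‖ ≤ D)
    (hlim : ∀ᵐ z : MatSpace n m, Tendsto (fun i => M i z) l (𝓝 d)) :
    Tendsto (fun i => eLpNorm (fun z => (M i z - d) * F z) 2 volume) l (𝓝 0) := by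
  have h1 : Tendsto (fun i => ∫⁻ z : MatSpace n m, ‖(M i z - d) * F z‖ₑ ^ (2 : ℝ)) l
      (𝓝 (∫⁻ _ : MatSpace n m, 0)) := by
    refine tendsto_lintegral_filter_of_dominated_convergence'
      (fun z => (ENNReal.ofReal D * ‖F z‖ₑ) ^ (2 : ℝ)) ?_ ?_ ?_ ?_
    · filter_upwards [hM] with i hi
      exact ((hi.sub aestronglyMeasurable_const).mul hF.1).enorm.pow_const _
    · filter_upwards [hD] with i hi
      filter_upwards [hi] with z hz
      refine ENNReal.rpow_le_rpow ?_ (by norm_num)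
      rw [enorm_mul, ← ofReal_norm]
      exact mul_le_mul_left (ENNReal.ofReal_le_ofReal hz) _
    · simp_rw [ENNReal.mul_rpow_of_nonneg _ _ (zero_le_two : (0 : ℝ) ≤ 2)]
      rw [lintegral_const_mul' _ _ (ENNReal.rpow_ne_top_of_nonneg zero_le_two ENNReal.ofReal_ne_top)]
      refine ENNReal.mul_ne_top (ENNReal.rpow_ne_top_of_nonneg zero_le_two ENNReal.ofReal_ne_top) ?_
      have := lintegral_rpow_enorm_lt_top_of_eLpNorm_lt_top (by norm_num) (by norm_num) hF.2
      simpa using this.ne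
    · filter_upwards [hlim] with z hz
      have h2 : Tendsto (fun i => ‖(M i z - d) * F z‖ₑ) l (𝓝 0) := by
        have h3 : Tendsto (fun i => (M i z - d) * F z) l (𝓝 0) := by
          simpa using (hz.sub_const d).mul_const (F z)
        simpa using h3.enorm
      simpa using h2.ennrpow_const 2
  rw [lintegral_zero] at h1
  have h4 := h1.ennrpow_const (1 / 2)
  rw [ENNReal.zero_rpow_of_pos (by norm_num)] at h4
  refine h4.congr fun i => ?_
  rw [eLpNorm_eq_lintegral_rpow_enorm_toReal (by norm_num) (by norm_num)]
  simp

/-! ### The wavelet inversion formula -/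

variable (R : RieszMixture n m α) {w : 𝓢(MatSpace n m, ℂ)} {u₀ : Matrix (Fin m) (Fin m) ℝ → ℂ}

lemma aestronglyMeasurable_waveletMultiplier (w : 𝓢(MatSpace n m, ℂ)) (ε ρ : ℝ) :
    AEStronglyMeasurable (waveletMultiplier R w ε ρ) :=
  aestronglyMeasurable_mixtureMultiplier (measurable_waveletMixture_shift R)
    (R.meas_c.comp measurable_snd) (measurable_waveletMixture_weight R w)

/-- Membership in L^p bounds the average pointwise and makes the pairing formula available. The
bounded multiplier and membership in L² then put Plancherel to use. -/
theorem memLp_waveletMixture_and_eLpNorm_sub (hnm : m ≤ n)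
    (hu : ∀ y : MatSpace n m, gram y ∈ cone m → matFourier (fun x => w x) y = u₀ (gram y))
    (husymm : IsSymmetricFun u₀) (hα : 0 ≤ α.re) (hα' : α.re < (n : ℝ) - m + 1)
    (hg : Integrable (symbolDensity w α) (coneMeasure m)) {p : ℝ} (hp : 1 ≤ p)
    (hp' : (α.re + m - 1) / 2 < n / (2 * p)) {f : MatSpace n m → ℂ} (hf : Measurable f)
    (hfp : MemLp f (ENNReal.ofReal p) volume) (hf2 : MemLp f 2 volume) {ε : ℝ} (hε : 0 < ε)
    (ρ : ℝ) :
    MemLp (waveletMixture R w ε ρ f) 2 volume ∧ ∀ d : ℂ,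
      eLpNorm (fun x => waveletMixture R w ε ρ f x - d * f x) 2 volume =
        eLpNorm (fun z => (waveletMultiplier R w ε ρ z - d) *
          (𝓕⁻ (hf2.toLp f) : Lp ℂ 2 (volume : Measure (MatSpace n m))) z) 2 volume := by
  obtain ⟨C, hC, hbd⟩ := exists_lintegral_waveletMixture_le R w hp hp' hα hf hfp hε ρ
  obtain ⟨K, hK, hKz⟩ := lintegral_waveletMixture_weight_le R w hε ρ hα
  have hsh := measurable_waveletMixture_shift R
  have hc : Measurable fun e : (Matrix (Fin m) (Fin m) ℝ × MatSpace n m) × R.S => R.c e.2 :=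
    R.meas_c.comp measurable_snd
  have hW := measurable_waveletMixture_weight R w
  refine memLp_and_eLpNorm_sub_of_pairing hf2 (aestronglyMeasurable_waveletMultiplier R w ε ρ)
    (D := ∫ s, ‖symbolDensity w α s‖ ∂(coneMeasure m)) ?_
    (locallyIntegrable_mixtureAverage hsh hc hW hf hC hbd) fun φ => ?_
  · filter_upwards [ae_matAbs_ne_zero hnm] with z hz
    exact norm_waveletMultiplier_le R hnm hu husymm hα hg hε ρ hz
  · refine integral_schwartz_smul_mixtureAverage hsh hc hW hf hC hbd
      (h := fun z => K * ENNReal.ofReal (matAbs z ^ (-α.re))) ?_ φ ?_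
    · filter_upwards [ae_matAbs_ne_zero hnm] with z hz
      exact hKz z hz
    · have h1 : ∀ z : MatSpace n m, ‖𝓕 φ z‖ₑ * (K * ENNReal.ofReal (matAbs z ^ (-α.re))) =
          K * (‖𝓕 φ z‖ₑ * ENNReal.ofReal (matAbs z ^ (-α.re))) := fun z => by ring
      simp_rw [h1]
      rw [lintegral_const_mul' _ _ hK]
      exact ENNReal.mul_lt_top hK.lt_top (lintegral_schwartz_mul_matAbs_lt_top hnm hα hα' (𝓕 φ))

theorem tendsto_eLpNorm_waveletMixture_sub (hnm : m ≤ n)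
    (hu : ∀ y : MatSpace n m, gram y ∈ cone m → matFourier (fun x => w x) y = u₀ (gram y))
    (husymm : IsSymmetricFun u₀) (hα : 0 ≤ α.re) (hα' : α.re < (n : ℝ) - m + 1)
    (hg : Integrable (symbolDensity w α) (coneMeasure m)) {p : ℝ} (hp : 1 ≤ p)
    (hp' : (α.re + m - 1) / 2 < n / (2 * p)) {f : MatSpace n m → ℂ} (hf : Measurable f)
    (hfp : MemLp f (ENNReal.ofReal p) volume) (hf2 : MemLp f 2 volume) :
    Tendsto (fun q : ℝ × ℝ => eLpNorm (fun x => waveletMixture R w q.1 q.2 f x -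
      (∫ s, symbolDensity w α s ∂(coneMeasure m)) * f x) 2 volume)
      (𝓝[>] (0 : ℝ) ×ˢ atTop) (𝓝 0) := by
  set d := ∫ s, symbolDensity w α s ∂(coneMeasure m) with hd
  have hpos : ∀ᶠ q : ℝ × ℝ in 𝓝[>] (0 : ℝ) ×ˢ atTop, 0 < q.1 :=
    tendsto_fst.eventually self_mem_nhdsWithin
  have h := tendsto_eLpNorm_sub_mul (l := 𝓝[>] (0 : ℝ) ×ˢ (atTop : Filter ℝ))
    (M := fun q => waveletMultiplier R w q.1 q.2) (d := d)
    (D := (∫ s, ‖symbolDensity w α s‖ ∂(coneMeasure m)) + ‖d‖)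
    (Lp.memLp (𝓕⁻ (hf2.toLp f) : Lp ℂ 2 (volume : Measure (MatSpace n m))))
    (Eventually.of_forall fun q => aestronglyMeasurable_waveletMultiplier R w q.1 q.2) ?_ ?_
  · refine h.congr' ?_
    filter_upwards [hpos] with q hq
    exact ((memLp_waveletMixture_and_eLpNorm_sub R hnm hu husymm hα hα' hg hp hp' hf hfp hf2 hq
      q.2).2 d).symm
  · filter_upwards [hpos] with q hq
    filter_upwards [ae_matAbs_ne_zero hnm] with z hz
    exact (norm_sub_le _ _).trans (add_le_add_left
      (norm_waveletMultiplier_le R hnm hu husymm hα hg hq q.2 hz) _)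
  · filter_upwards [ae_matAbs_ne_zero hnm] with z hz
    exact tendsto_waveletMultiplier R hnm hu husymm hα hg hz

lemma re_nonneg_of_mem_wallachSet (hm : 1 ≤ m) (hα : α ∈ wallachSet n m) : 0 ≤ α.re := by
  rcases hα with ⟨k, -, rfl⟩ | ⟨h, -⟩
  · simp
  · have : (1 : ℝ) ≤ m := by exact_mod_cast hm
    linarith

end Inversion

end

end MatrixWavelet

/-! ### The inversion theorem. -/

open MatrixWavelet in
theorem mainTheorem2 (n m : ℕ) (hm : 2 ≤ m) (hnm : m ≤ n)
    (α : ℂ) (hα : α ∈ wallachSet n m)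
    (p : ℝ) (hp1 : 1 ≤ p) (hp2 : p < (n : ℝ) / (α.re + m - 1))
    (f : MatSpace n m → ℂ) (hf2 : MemLp f 2 volume) (hfp : MemLp f (ENNReal.ofReal p) volume)
    (w : SchwartzMap (MatSpace n m) ℂ) (hw : IsRadial (fun y => w y))
    (u₀ : Matrix (Fin m) (Fin m) ℝ → ℂ)
    (hu : ∀ y : MatSpace n m, gram y ∈ cone m → matFourier (fun x => w x) y = u₀ (gram y))
    (husymm : IsSymmetricFun u₀) (huvan : VanishesNearBoundary u₀)
    (hd : Integrable (fun z : MatSpace n m =>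
      matFourier (fun x => w x) z / ((matAbs z : ℝ) : ℂ) ^ ((n : ℂ) + α)) volume) :
    -- the integral `d_w(α)` is the limit of its truncations `z'z < B` as `B → ∞` in the cone
    (∀ δ : ℝ, 0 < δ → ∃ B₀ ∈ cone m, ∀ B ∈ cone m, (B - B₀) ∈ cone m →
      ‖truncatedWaveletConst (fun x => w x) α B - waveletConst (fun x => w x) α‖ < δ) ∧
    -- `I^α f` converges absolutely almost everywhere
    (∀ᵐ x : MatSpace n m, RieszConverges n m α f x) ∧
    -- the truncated integrals converge absolutely almost everywhere and are in `L²`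
    (∀ ε ρ : ℝ, 0 < ε → ε < ρ →
      (∀ᵐ x : MatSpace n m, Integrable
        (fun q : Matrix (Fin m) (Fin m) ℝ × MatSpace n m =>
          rieszPotential n m α f (x - rmul q.2 (CFC.sqrt q.1)) * w q.2 /
            ((q.1.det : ℝ) : ℂ) ^ (α / 2))
        (((coneMeasure m).restrict
          (coneInterval (ε • (1 : Matrix (Fin m) (Fin m) ℝ)) (ρ • 1))).prod volume)) ∧
      MemLp (truncatedInverse (fun x => w x) α ε ρ (rieszPotential n m α f)) 2 volume) ∧
    -- the `L²`-limit as `ε → 0`, `ρ → ∞` is `d_w(α) f`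
    Tendsto (fun q : ℝ × ℝ =>
      eLpNorm (fun x => truncatedInverse (fun y => w y) α q.1 q.2 (rieszPotential n m α f) x -
        waveletConst (fun y => w y) α * f x) 2 volume)
      (𝓝[>] (0 : ℝ) ×ˢ atTop) (𝓝 0) := by
  have hm1 : 1 ≤ m := by omega
  have hm2 : (2 : ℝ) ≤ m := by exact_mod_cast hm
  have hα0 := re_nonneg_of_mem_wallachSet hm1 hα
  have hs : 0 < α.re + m - 1 := by linarith
  have hp0 : 0 < p := by linarith
  have hps : p * (α.re + m - 1) < n := (lt_div_iff₀ hs).1 hp2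
  -- As p ≥ 1, the inequality p(Re α + m - 1) < n already forces Re α + m - 1 < n.
  have hα1 : α.re < (n : ℝ) - m + 1 := by nlinarith
  have hp' : (α.re + m - 1) / 2 < n / (2 * p) := by
    rw [div_lt_div_iff₀ two_pos (by positivity)]
    nlinarith
  obtain ⟨R⟩ := exists_rieszMixture hm1 hnm hα hα1
  -- The mixture is formed with a Borel representative g of f, since its integrand composes the
  -- function with maps on product spaces.
  obtain ⟨g, hgm, hfg⟩ := hf2.1.aemeasurable
  have hg2 : MemLp g 2 volume := (memLp_congr_ae hfg).1 hf2
  have hgp : MemLp g (ENNReal.ofReal p) volume := (memLp_congr_ae hfg).1 hfp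
  have hS := integrable_symbolDensity hnm hu hd
  have hT : ∀ ε ρ : ℝ, 0 < ε → ∀ x : MatSpace n m,
      Integrable (fun q : Matrix (Fin m) (Fin m) ℝ × MatSpace n m =>
        rieszPotential n m α f (x - rmul q.2 (CFC.sqrt q.1)) * w q.2 /
          ((q.1.det : ℝ) : ℂ) ^ (α / 2)) ((coneSlab m ε ρ).prod volume) ∧
      truncatedInverse (fun y => w y) α ε ρ (rieszPotential n m α f) x =
        waveletMixture R w ε ρ g x := fun ε ρ hε x => by
    obtain ⟨C, hC, hbd⟩ := exists_lintegral_waveletMixture_le R w hp1 hp' hα0 hgm hgp hε ρ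
    exact truncatedInverse_eq_waveletMixture R w hgm hfg hε ρ x ((hbd x).trans_lt hC.lt_top)
  refine ⟨fun δ hδ => ?_, ?_, fun ε ρ hε _ => ⟨?_, ?_⟩, ?_⟩
  · set c : ℂ := 2 ^ m / stiefelMass n m with hc
    -- The denominator ‖c‖ + 1 is positive even if c were 0.
    obtain ⟨B₀, hB₀, h⟩ := exists_norm_setIntegral_gram_lt_sub_lt hd
      (δ := δ / (‖c‖ + 1)) (by positivity)
    refine ⟨B₀, hB₀, fun B _ hB => ?_⟩
    rw [truncatedWaveletConst, waveletConst, ← hc, ← mul_sub, norm_mul]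
    have h1 := h B hB
    rw [lt_div_iff₀ (by positivity)] at h1
    refine lt_of_le_of_lt ?_ h1
    rw [mul_comm]
    exact mul_le_mul_of_nonneg_left (by linarith) (norm_nonneg _)
  · filter_upwards [ae_rieszPotential_congr (α := α) hfg, R.ae_rieszConverges hp1 hp' hgm hgp]
      with x hx hx'
    exact hx.1.2 hx'
  · exact Filter.Eventually.of_forall fun x => (hT ε ρ hε x).1
  · rw [funext fun x => (hT ε ρ hε x).2]
    exact (memLp_waveletMixture_and_eLpNorm_sub R hnm hu husymm hα0 hα1 hS hp1 hp' hgm hgp hg2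
      hε ρ).1
  · have hpos : ∀ᶠ q : ℝ × ℝ in 𝓝[>] (0 : ℝ) ×ˢ atTop, 0 < q.1 :=
      tendsto_fst.eventually self_mem_nhdsWithin
    refine (tendsto_eLpNorm_waveletMixture_sub R hnm hu husymm hα0 hα1 hS hp1 hp' hgm hgp
      hg2).congr' ?_
    filter_upwards [hpos] with q hq
    refine eLpNorm_congr_ae ?_
    filter_upwards [hfg] with x hx
    rw [(hT q.1 q.2 hq x).2, waveletConst_eq hnm hu, hx]
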